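/- **Parameters.** Fix real numbers $\kappa,\alpha,K,C_0>0$, $0<\varepsilon,\gamma\le\frac1{10}$ and $B\ge20$ with $B\varepsilon<\frac12$. For $N\in\mathbb N$ put $n=2\lfloor N^{\varepsilon}/2\rfloor+1$, $\eta_m^*=2^m n^{\gamma}N^{-1}$, and let $\varrho_{sc}(x)=\frac1{2\pi}\sqrt{(4-x^2)_+}$. **Ensemble.** Let $\nu_0,\tilde\nu_0$ be probability measures on $\mathbb R$ with mean $0$ and variances $\frac12$ and $1$. Let $\tau\ge2$, $t=\tau/N$, and let $H_t=e^{-t/2}\hat H+(1-e^{-t})^{1/2}V$, where $\hat H$ is an $N\times N$ Hermitian Wigner matrix whose entries are $N^{-1/2}$ times independent variables (real and imaginary parts of the off-diagonal entries with law $\nu_0$, diagonal entries with law $\tilde\nu_0$) and $V$ is an independent GUE matrix with entries of variance $1/N$. Let $u$ be the density of the GUE eigenvalues $\lambda_1<\dots<\lambda_N$ (ordered), $\mu=u\,d\lambda$, and let $f=f_t$ be the (continuous) density, with respect to $\mu$, of the law of the ordered eigenvalues of $H_t$. $\mathbb E_f$ is expectation under $f\mu$. **Good global configurations.** With $\mathcal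 N_\eta(E)=\#\{i:\lambda_i\in[E-\frac\eta2,E+\frac\eta2]\}$, $\Omega$ is the set of $\lambda_1<\dots<\lambda_N$ such that: $\big|\frac{\mathcal N_{\eta^*_m}(E)}{N\eta^*_m}-\varrho_{sc}(E)\big|\le (N\eta^*_m)^{-1/4}n^{\gamma/12}$ for all integers $0\le m\le\log N$ and all $|E|\le2-\frac\kappa2$; $\big|\frac{\#\{i:\lambda_i\le0\}}{N/2}-1\big|\le n^{-\gamma/6}$; $\mathcal N_{\eta^*_0}(E)\le KN\eta^*_0$ for all $E\in\mathbb R$; and all $\lambda_i\in(-K,K)$. **Conditioning.** For an index $L$ let $J_L=\{-L,\dots,-1,1,\dots,N-L-n\}$. Write $\lambda=(\mathbf y_-,\mathbf x,\mathbf y_+)$ with external points $y_k=\lambda_{L+1+k}$ ($k<0$), $y_k=\lambda_{L+n+k}$ ($k>0$), $k\in J_L$, and internal points $x_j=\lambda_{L+j}$, $1\le j\le n$. Given an increasing $\mathbf y=(y_k)_{k\in J_L}$, let $\mu_{\mathbf y}$ be the probability measure with density proportional to $u(\mathbf y_-,\cdot,\mathbf y_+)$, $f_{\mathbf y}=f(\mathbf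 y_-,\cdot,\mathbf y_+)/\int f(\mathbf y_-,\cdot,\mathbf y_+)\,d\mu_{\mathbf y}$, $\mathbb P_{f_{\mathbf y}},\mathbb E_{f_{\mathbf y}}$ refer to $f_{\mathbf y}\mu_{\mathbf y}$, $\Omega_{\mathbf y}=\{\mathbf x:(\mathbf y_-,\mathbf x,\mathbf y_+)\in\Omega\}$ and $D_{L,\mathbf y}=\int\frac1{2N}|\nabla_{\mathbf x}\sqrt{f_{\mathbf y}}|^2d\mu_{\mathbf y}$. **Good indices.** $\mathcal G$ is the set of $L$ with $N\kappa^{3/2}\le L\le N(1-\kappa^{3/2})$, $\mathbb E_f D_{L,\mathbf y}\le C_0N^{1+\alpha}n^2\tau^{-1}$, and $\mathbb E_f\,\mathbf 1_\Omega\sum_{j\ne a}(N|\lambda_j-\lambda_a|)^{-q}\le C_0n^{3\gamma}$ for $a\in\{L,L+n+1\}$, $q\in\{1,2\}$. **Good external configurations.** For $L\in\mathcal G$, $\mathcal Y_L$ is the set of increasing $\mathbf y=(y_k)_{k\in J_L}$ such that: * $\mathbb P_{f_{\mathbf y}}(\Omega_{\mathbf y})\ge1-C_0e^{-n^{\gamma/12}}$;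 * $y_1-y_{-1}\le KnN^{-1}$; * $D_{L,\mathbf y}\le C_0N^{1+\alpha}n^4\tau^{-1}$; * $\sum_\pm\sum_{k\in J_L,\,k\ne\pm1}|N(y_{\pm1}-y_k)|^{-1}\le C_0n^{3\gamma}$, where both $k=1$ and $k=-1$ are left out of the inner sums; * $\mathbb E_{f_{\mathbf y}}\mathbf 1_{\Omega_{\mathbf y}}\sum_\pm\sum_{j=1}^n(N|x_j-y_{\pm1}|)^{-q}\le C_0n^{4\gamma}$ for $q=1,2$; * $\mathbb E_{f_{\mathbf y}}\mathbf 1_{\Omega_{\mathbf y}}\sup_E\big|n^{-\gamma}\#\{i:N|x_i-E|\le\frac12n^\gamma\}-\varrho_{sc}(E)\big|\le n^{-\gamma/12}$, the supremum being over $E\in[y_{-1}+\frac12\eta_0^*,\,y_1-\frac12\eta_0^*]$. **Rescaled potential and equilibrium measure.** Let $\tilde y_k=T(y_k)$ with $T$ the increasing affine map taking $y_{-1},y_1$ to $-1,1$, and let $$U_{\mathbf y}(x)=-\frac2n\sum_{k\in J_L,\ |k|<n^B}\log|x-\tilde y_k| ,$$ with value $+\infty$ at the points $\tilde y_k$. An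 equilibrium measure for $U_{\mathbf y}$ is a minimizer of $\iint\log|s-t|^{-1}\,\nu(ds)\nu(dt)+\int U_{\mathbf y}\,d\nu$ among the probability measures $\nu$ on $[-1,1]$. **Lemma.** There is $N_0$, depending only on the parameters, such that: 1. For every $\sigma>0$ there are constants $C_1,C_2$, depending only on $\sigma$ and the parameters, such that for all $N\ge N_0$, $\tau\ge2$, $\nu_0,\tilde\nu_0$ as above, $L\in\mathcal G$ and $\mathbf y\in\mathcal Y_L$, the potential $U_{\mathbf y}$ is $C^2$ on $(-1,1)$ and $$|U_{\mathbf y}'(x)|\le C_1,\qquad|U_{\mathbf y}''(x)|\le C_2\qquad\text{for all }x\in J'=[-1+\tfrac\sigma2,\,1-\tfrac\sigma2].$$ 2. There is a constant $C$, depending only on the parameters, such that for all $N\ge N_0$, $\tau\ge2$, $\nu_0,\tilde\nu_0$ as above, $L\in\mathcal G$ and $\mathbf y\in\mathcal Y_L$, an equilibrium measure for $U_{\mathbf y}$ exists, and the support of every such measure is an interval $[a,b]$ with $a<b$ and $$|a+1|,\ |b-1|\le C\,n^{-\gamma/3}\log n .$$ -/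

import Mathlib

open MeasureTheory Filter
open scoped ENNReal Topology

noncomputable section

namespace WignerLocal

/-! ### Exponents and constants -/

/-- The fixed parameters: the bulk cutoff `κ`, the exponents `ε` (window size `n ~ N ^ ε`), `γ`,
`α`, `B` (cutoff `n ^ B`), the "fixed big constant" `K`, and the constant `C₀` standing for all the
unspecified constants `C` in the definitions of the good sets (each of these sets grows with
each such constant, so one common value covers any choice of them). -/
structure Params where
  κ : ℝ
  ε : ℝ
  γ : ℝ
  α : ℝ
  B : ℝ
  K : ℝ
  C₀ : ℝ

/-- The standing restrictions on the parameters. -/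
structure Params.Admissible (p : Params) : Prop where
  κ_pos : 0 < p.κ
  ε_pos : 0 < p.ε
  ε_le : p.ε ≤ 1 / 10
  γ_pos : 0 < p.γ
  γ_le : p.γ ≤ 1 / 10
  α_pos : 0 < p.α
  B_ge : 20 ≤ p.B
  Bε_lt : p.B * p.ε < 1 / 2
  K_pos : 0 < p.K
  C₀_pos : 0 < p.C₀

/-- The odd number `n = 2 [N ^ ε / 2] + 1` of internal points. -/
def Params.n (p : Params) (N : ℕ) : ℕ := 2 * ⌊(N : ℝ) ^ p.ε / 2⌋₊ + 1

/-- `n` as a real number. -/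
abbrev Params.nr (p : Params) (N : ℕ) : ℝ := (p.n N : ℝ)

/-- Semicircle density. -/
def rhoSC (x : ℝ) : ℝ := Real.sqrt (4 - x ^ 2) / (2 * Real.pi)

/-! ### The Wigner ensemble and its evolution -/

/-- Centred probability measure with variance `v`. -/
structure IsEntryLaw (ν : Measure ℝ) (v : ℝ) : Prop where
  prob : IsProbabilityMeasure ν
  memLp : MemLp (fun x : ℝ => x) 2 ν
  mean : ∫ x, x ∂ν = 0
  var : ∫ x, x ^ 2 ∂ν = v

/-- Law at time `t` of a real Ornstein-Uhlenbeck process with stationary variance `v` and initial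
law `ν₀`, that is, the law of `e ^ (-t/2) X + (1 - e ^ (-t)) ^ (1/2) G` with `X ~ ν₀` and `G`
an independent centred Gaussian variable of variance `v`. -/
def ouLaw (t v : ℝ) (ν₀ : Measure ℝ) : Measure ℝ :=
  (ν₀.map (fun x => Real.exp (-t / 2) * x)).conv
    (ProbabilityTheory.gaussianReal 0 (Real.toNNReal ((1 - Real.exp (-t)) * v)))

/-- The Hermitian matrix with `h_jk = N ^ (-1/2) (a_jk + i a_kj)` for `j < k` and
`h_jj = N ^ (-1/2) a_jj`, built from a real array `a`. -/
def wignerMatrix (N : ℕ) (a : Fin N × Fin N → ℝ) : Matrix (Fin N) (Fin N) ℂ :=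
  fun j k => (((Real.sqrt N)⁻¹ : ℝ) : ℂ) *
    (if j < k then (a (j, k) : ℂ) + Complex.I * (a (k, j) : ℂ)
     else if k < j then (a (k, j) : ℂ) - Complex.I * (a (j, k) : ℂ)
     else (a (j, j) : ℂ))

theorem wignerMatrix_isHermitian (N : ℕ) (a : Fin N × Fin N → ℝ) :
    (wignerMatrix N a).IsHermitian := by
  ext j k
  rcases lt_trichotomy j k with h | h | h
  · simp [Matrix.conjTranspose_apply, wignerMatrix, h, not_lt.mpr h.le, sub_eq_add_neg]
  · subst h
    simp [Matrix.conjTranspose_apply, wignerMatrix]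
  · simp [Matrix.conjTranspose_apply, wignerMatrix, h, not_lt.mpr h.le, sub_eq_add_neg]

/-- Eigenvalues of the matrix, in increasing order. -/
def orderedEigenvalues (N : ℕ) (a : Fin N × Fin N → ℝ) : Fin N → ℝ :=
  fun i => (wignerMatrix_isHermitian N a).eigenvalues₀
    (Fin.cast (Fintype.card_fin N).symm (Fin.rev i))

/-- Law of the increasingly ordered eigenvalues of the Wigner matrix evolved up to time `t`: the
real and imaginary parts of the off-diagonal entries start from `ν₀` and the diagonal entries
start from `νd₀`, all independent. -/
def eigenvalueLaw (N : ℕ) (t : ℝ) (ν₀ νd₀ : Measure ℝ) : Measure (Fin N → ℝ) :=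
  (Measure.pi (fun q : Fin N × Fin N =>
    if q.1 = q.2 then ouLaw t 1 νd₀ else ouLaw t (1 / 2) ν₀)).map (orderedEigenvalues N)

/-- Density of the ordered GUE eigenvalues, supported on `λ_1 < ... < λ_N`. -/
def gueDensity (N : ℕ) (lam : Fin N → ℝ) : ℝ :=
  open Classical in
  if StrictMono lam then
    (N.factorial : ℝ) *
      ((N : ℝ) ^ ((N : ℝ) ^ 2 / 2) /
        ((2 * Real.pi) ^ ((N : ℝ) / 2) * ∏ j ∈ Finset.Icc 1 N, (j.factorial : ℝ))) *
      Real.exp (-((N : ℝ) / 2) * ∑ i, lam i ^ 2) *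
      (∏ i, ∏ j ∈ Finset.Ioi i, (lam j - lam i)) ^ 2
  else 0

/-- The equilibrium measure `μ` of ordered GUE eigenvalues. -/
def gueMeasure (N : ℕ) : Measure (Fin N → ℝ) :=
  volume.withDensity (fun lam => ENNReal.ofReal (gueDensity N lam))

/-- The density `f_t` of the law of the ordered eigenvalues at time `t` with respect to `μ`,
evaluated pointwise as the limit of the ratios of the masses of small balls (this selects the
continuous version of the density). -/
def eigenvalueDensity (N : ℕ) (t : ℝ) (ν₀ νd₀ : Measure ℝ) (lam : Fin N → ℝ) : ℝ :=
  limUnder (𝓝[>] (0 : ℝ)) (fun r =>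
    (eigenvalueLaw N t ν₀ νd₀ (Metric.closedBall lam r)).toReal /
      (gueMeasure N (Metric.closedBall lam r)).toReal)

/-! ### Good global configurations -/

/-- Number of points of `lam` in `[E - η/2, E + η/2]`. -/
def count {N : ℕ} (lam : Fin N → ℝ) (η E : ℝ) : ℕ :=
  Set.ncard {i : Fin N | lam i ∈ Set.Icc (E - η / 2) (E + η / 2)}

/-- The scale `η*_m = 2 ^ m n ^ γ / N`. -/
def Params.eta (p : Params) (N m : ℕ) : ℝ := 2 ^ m * p.nr N ^ p.γ / N

/-- The set `Ω` of good global configurations. -/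
def Params.goodGlobal (p : Params) (N : ℕ) : Set (Fin N → ℝ) :=
  {lam | StrictMono lam ∧
    (∀ m : ℕ, (m : ℝ) ≤ Real.log N →
      ∀ E ∈ Set.Icc (-2 + p.κ / 2) (2 - p.κ / 2),
        |(count lam (p.eta N m) E : ℝ) / (N * p.eta N m) - rhoSC E| ≤
          p.nr N ^ (p.γ / 12) / (N * p.eta N m) ^ (1 / 4 : ℝ)) ∧
    |(Set.ncard {i : Fin N | lam i ≤ 0} : ℝ) / ((N : ℝ) / 2) - 1| ≤ p.nr N ^ (-p.γ / 6) ∧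
    (∀ E : ℝ, (count lam (p.eta N 0) E : ℝ) ≤ p.K * N * p.eta N 0) ∧
    (∀ i, lam i ∈ Set.Ioo (-p.K) p.K)}

/-! ### External and internal points

An external configuration is stored as a function `y : ℤ → ℝ`, of which only the values at
the indices in `J_L = {-L, ..., -1, 1, ..., N - L - n}` are ever used. -/

/-- The index set `J_L` of the external points. -/
def Params.J (p : Params) (N L : ℕ) : Finset ℤ :=
  (Finset.Icc (-(L : ℤ)) ((N : ℤ) - L - p.n N)).erase 0

/-- `λ_j` with `j = 1, ..., N`. -/
def eig {N : ℕ} (lam : Fin N → ℝ) (j : ℕ) : ℝ :=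
  if h : 1 ≤ j ∧ j ≤ N then lam ⟨j - 1, by omega⟩ else 0

/-- The external points of `lam`: `y_k = λ_(L+1+k)` for `k < 0`, `y_k = λ_(L+n+k)` for `k > 0`. -/
def Params.external (p : Params) {N : ℕ} (L : ℕ) (lam : Fin N → ℝ) : ℤ → ℝ :=
  fun k => if k < 0 then eig lam ((L : ℤ) + 1 + k).toNat
    else eig lam ((L : ℤ) + p.n N + k).toNat

/-- The full configuration `(y_-, x, y_+)`. -/
def Params.glue (p : Params) (N L : ℕ) (y : ℤ → ℝ) (x : Fin (p.n N) → ℝ) : Fin N → ℝ :=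
  fun i => if h₀ : (i : ℕ) < L then y ((i : ℤ) - L)
    else if h : (i : ℕ) < L + p.n N then x ⟨(i : ℕ) - L, by omega⟩
    else y ((i : ℤ) - L - p.n N + 1)

/-- The conditional equilibrium density `u_y`. -/
def Params.localDensity (p : Params) (N L : ℕ) (y : ℤ → ℝ) (x : Fin (p.n N) → ℝ) : ℝ :=
  gueDensity N (p.glue N L y x) / ∫ x', gueDensity N (p.glue N L y x')

/-- The conditional equilibrium measure `μ_y`. -/
def Params.localEq (p : Params) (N L : ℕ) (y : ℤ → ℝ) : Measure (Fin (p.n N) → ℝ) :=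
  volume.withDensity (fun x => ENNReal.ofReal (p.localDensity N L y x))

/-- The conditional density `f_y` with respect to `μ_y`. -/
def Params.condDensity (p : Params) (N L : ℕ) (f : (Fin N → ℝ) → ℝ) (y : ℤ → ℝ)
    (x : Fin (p.n N) → ℝ) : ℝ :=
  f (p.glue N L y x) / ∫ x', f (p.glue N L y x') ∂(p.localEq N L y)

/-- The conditional law `f_y μ_y`. -/
def Params.condLaw (p : Params) (N L : ℕ) (f : (Fin N → ℝ) → ℝ) (y : ℤ → ℝ) :
    Measure (Fin (p.n N) → ℝ) :=
  (p.localEq N L y).withDensity (fun x => ENNReal.ofReal (p.condDensity N L f y x))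

/-- The global law `f μ`. -/
def globalLaw (N : ℕ) (f : (Fin N → ℝ) → ℝ) : Measure (Fin N → ℝ) :=
  (gueMeasure N).withDensity (fun lam => ENNReal.ofReal (f lam))

/-- The section `Ω_y` of the set of good global configurations. -/
def Params.goodSection (p : Params) (N L : ℕ) (y : ℤ → ℝ) : Set (Fin (p.n N) → ℝ) :=
  {x | p.glue N L y x ∈ p.goodGlobal N}

/-- The local Dirichlet form of the square root of `f_y`, namely
`∫ (1 / 2N) |∇_x √f_y| ^ 2 dμ_y`. -/
def Params.dirichlet (p : Params) (N L : ℕ) (f : (Fin N → ℝ) → ℝ) (y : ℤ → ℝ) : ℝ≥0∞ :=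
  ∫⁻ x, ENNReal.ofReal ((1 / (2 * (N : ℝ))) * ∑ i,
    (deriv (fun s => Real.sqrt (p.condDensity N L f y (Function.update x i s))) (x i)) ^ 2)
    ∂(p.localEq N L y)

/-! ### Good indices and good external configurations -/

/-- The set `𝒢₁` of indices with a good local Dirichlet form. -/
def Params.goodIndices₁ (p : Params) (N : ℕ) (τ : ℝ) (f : (Fin N → ℝ) → ℝ) : Set ℕ :=
  {L | (N : ℝ) * p.κ ^ (3 / 2 : ℝ) ≤ L ∧ (L : ℝ) ≤ N * (1 - p.κ ^ (3 / 2 : ℝ)) ∧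
    ∫⁻ lam, p.dirichlet N L f (p.external L lam) ∂(globalLaw N f) ≤
      ENNReal.ofReal (p.C₀ * (N : ℝ) ^ (1 + p.α) * p.nr N ^ 2 / τ)}

/-- `∑_(j ≠ a) [N |λ_j - λ_a|] ^ (-q)`. -/
def repulsion {N : ℕ} (lam : Fin N → ℝ) (a q : ℕ) : ℝ :=
  ∑ j ∈ (Finset.Icc 1 N).erase a, 1 / ((N : ℝ) * |eig lam j - eig lam a|) ^ q

/-- The set `𝒢` of good indices. -/
def Params.goodIndices (p : Params) (N : ℕ) (τ : ℝ) (f : (Fin N → ℝ) → ℝ) : Set ℕ :=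
  {L | L ∈ p.goodIndices₁ N τ f ∧
    ∀ a ∈ ({L, L + p.n N + 1} : Set ℕ), ∀ q ∈ ({1, 2} : Set ℕ),
      ∫⁻ lam in p.goodGlobal N, ENNReal.ofReal (repulsion lam a q) ∂(globalLaw N f) ≤
        ENNReal.ofReal (p.C₀ * p.nr N ^ (3 * p.γ))}

/-- The set `𝒴_L` of good external configurations. -/
def Params.goodExternal (p : Params) (N : ℕ) (τ : ℝ) (f : (Fin N → ℝ) → ℝ) (L : ℕ) :
    Set (ℤ → ℝ) :=
  {y | StrictMonoOn y (p.J N L : Set ℤ) ∧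
    -- the conditional probability of `Ω_y` is close to one
    ENNReal.ofReal (1 - p.C₀ * Real.exp (-(p.nr N ^ (p.γ / 12)))) ≤
      p.condLaw N L f y (p.goodSection N L y) ∧
    -- the window `I_y` has length at most `K n / N`
    y 1 - y (-1) ≤ p.K * p.nr N / N ∧
    -- bound on the local Dirichlet form
    p.dirichlet N L f y ≤ ENNReal.ofReal (p.C₀ * (N : ℝ) ^ (1 + p.α) * p.nr N ^ 4 / τ) ∧
    -- interaction of the boundary points with the other external points
    (∑ e ∈ ({-1, 1} : Finset ℤ), ∑ k ∈ (p.J N L).filter (fun k => k ≠ 1 ∧ k ≠ -1),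
      1 / |(N : ℝ) * (y e - y k)|) ≤ p.C₀ * p.nr N ^ (3 * p.γ) ∧
    -- interaction of the boundary points with the internal points
    (∀ q ∈ ({1, 2} : Set ℕ),
      ∫⁻ x in p.goodSection N L y, ENNReal.ofReal
        (∑ e ∈ ({-1, 1} : Finset ℤ), ∑ j, 1 / ((N : ℝ) * |x j - y e|) ^ q)
        ∂(p.condLaw N L f y) ≤ ENNReal.ofReal (p.C₀ * p.nr N ^ (4 * p.γ))) ∧
    -- local semicircle law inside the window on scale `η*_0 = n ^ γ / N`
    ∫⁻ x in p.goodSection N L y,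
      (⨆ E ∈ Set.Icc (y (-1) + p.eta N 0 / 2) (y 1 - p.eta N 0 / 2),
        ENNReal.ofReal |p.nr N ^ (-p.γ) *
          (Set.ncard {i | (N : ℝ) * |x i - E| ≤ p.nr N ^ p.γ / 2} : ℝ) - rhoSC E|)
      ∂(p.condLaw N L f y) ≤ ENNReal.ofReal (p.nr N ^ (-p.γ / 12))}

/-! ### The rescaled potential -/

/-- The rescaled external point `T(y_k)`, with `T` affine, `T(y_(-1)) = -1`, `T(y_1) = 1`. -/
def rescaled (y : ℤ → ℝ) (k : ℤ) : ℝ :=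
  2 * (y k - (y (-1) + y 1) / 2) / |y 1 - y (-1)|

/-- The indices `k ∈ J_L` with `|k| < n ^ B`. -/
def Params.cutoff (p : Params) (N L : ℕ) : Finset ℤ :=
  (p.J N L).filter (fun k => |(k : ℝ)| < p.nr N ^ p.B)

/-- The rescaled potential `U_y(x) = -(2 / n) ∑_(|k| < n ^ B) log |x - T(y_k)|`. -/
def Params.potential (p : Params) (N L : ℕ) (y : ℤ → ℝ) (x : ℝ) : ℝ :=
  -(2 / p.nr N) * ∑ k ∈ p.cutoff N L, Real.log |x - rescaled y k|

/-- The rescaled potential with its value `+∞` at the points `T(y_k)`. -/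
def Params.potentialE (p : Params) (N L : ℕ) (y : ℤ → ℝ) (x : ℝ) : EReal :=
  open Classical in
  if ∃ k ∈ p.cutoff N L, x = rescaled y k then ⊤ else ((p.potential N L y x : ℝ) : EReal)

/-! ### Equilibrium measures on `[-1, 1]` -/

/-- Integral of an extended real function: integral of the positive part minus integral of the
negative part. -/
def extIntegral {X : Type*} [MeasurableSpace X] (μ : Measure X) (g : X → EReal) : EReal :=
  ((∫⁻ x, (g x).toENNReal ∂μ : ℝ≥0∞) : EReal) - ((∫⁻ x, (-g x).toENNReal ∂μ : ℝ≥0∞) : EReal)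

/-- The kernel `log |s - t|⁻¹`, equal to `+∞` on the diagonal. -/
def logKernel (s t : ℝ) : EReal :=
  if s = t then ⊤ else ((-Real.log |s - t| : ℝ) : EReal)

/-- The weighted logarithmic energy `∫∫ log |s - t|⁻¹ dν dν + ∫ V dν`. -/
def weightedEnergy (V : ℝ → EReal) (ν : Measure ℝ) : EReal :=
  extIntegral (ν.prod ν) (fun q => logKernel q.1 q.2) + extIntegral ν V

/-- Probability measures on `[-1, 1]`. -/
structure IsProbOnInterval (ν : Measure ℝ) : Prop where
  prob : IsProbabilityMeasure ν
  conc : ν (Set.Icc (-1 : ℝ) 1)ᶜ = 0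

/-- `ν` is an equilibrium measure for the external potential `V`: it minimizes the weighted energy
among the probability measures on `[-1, 1]`. -/
structure IsEquilibriumMeasure (V : ℝ → EReal) (ν : Measure ℝ) : Prop where
  onInterval : IsProbOnInterval ν
  minimal : ∀ ν', IsProbOnInterval ν' → weightedEnergy V ν ≤ weightedEnergy V ν'

end WignerLocal

end

open MeasureTheory Filter
open scoped ENNReal Topology

noncomputable section

namespace WignerLocal


/-! Rigidity. For large `N` the conditional probability of `Ω_y` is positive, so `y` is the exterior
of some configuration in `Ω`, and the rest is deterministic. Chaining the count estimate of `Ω` over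
windows with about `√n` points, anchored at the count below `0`, places all points with `|k| < n^B`
in the bulk. Since `n^B` is at most of order `√N`, they occupy so short a stretch that the
semicircle density is nearly constant on it. After rescaling they are close to the two lattices `±(1
+ 2k/n)`, with relative error `n^(-1/10)` and absolute error `n^(-1/3)` (`eventually_rigid`).

Derivatives. `U'` is a difference of two Stieltjes sums, one for each side. For exact lattices they
cancel up to a constant, and the relative error costs `n^(-1/10) log n`. The sum for `U''` is
bounded directly (`Params.Rigid.derivative_bounds`).

Equilibrium measure. `U` is the potential of finitely many charges of strength `w = 1/n` outside
`(-1, 1)`, so the minimizer can be written down. In the Joukowski coordinate `x = c + h (ζ + 1/ζ)/2`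
of a candidate support `[a, b]`, let `z_k` be the position of the `k`-th charge. In the angle, the
measure has density `1 + w ∑ (1 - P_(z_k))` with Poisson kernels `P`. Two endpoint conditions
(`Balanced`) make this density `sin² θ` times a positive function, the effective potential constant
on `[a, b]`, and at least that constant on the rest of `[-1, 1]` (`Balanced.green_nonneg`). The
logarithmic energy is strictly positive definite, because a Frullani integral writes the kernel as a
mixture of Gaussian kernels (`eq_of_mutualEnergy_le`). Hence these Euler-Lagrange conditions single
out the unique minimizer (`shiftedEnergy_min_of_eulerLagrange`). Endpoints exist because they
maximize a Mhaskar-Saff functional, and the charges at `±1` keep the maximum away from `a = -1` and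
`b = 1` (`exists_endpoints`).

Gaps. Let `α ≥ β` be the distances of the two endpoints from the edges of the window. Comparing the
sums in the endpoint condition with integrals over exact lattices gives `2 ≤ 2 - √α + errors`
(`sqrt_defect_le`). If `α > n^(-γ/3)`, then `√α > n^(-1/60)`, whereas the errors are `O(n^(-1/20))`,
a contradiction. -/

/-! ### Positive definiteness of the logarithmic kernel -/

/-- The nonnegative kernel `log (2 / |s - t|)`, equal to `∞` on the diagonal. -/
def posKernel (s t : ℝ) : ℝ≥0∞ :=
  if s = t then ⊤ else ENNReal.ofReal (Real.log 2 - Real.log |s - t|)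

/-- The mutual energy of two measures for the kernel `log (2 / |s - t|)`. -/
def mutualEnergy (μ ν : Measure ℝ) : ℝ≥0∞ :=
  ∫⁻ q, posKernel q.1 q.2 ∂(μ.prod ν)

lemma measurable_posKernel : Measurable fun q : ℝ × ℝ => posKernel q.1 q.2 := by
  unfold posKernel
  refine Measurable.ite (measurableSet_eq_fun measurable_fst measurable_snd) measurable_const ?_
  fun_prop

lemma lintegral_Ioc_inv {x : ℝ} (hx : 0 < x) (hx1 : x ≤ 1) :
    ∫⁻ v in Set.Ioc x 1, ENNReal.ofReal (1 / (2 * v)) = ENNReal.ofReal (-Real.log x / 2) := by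
  have h0 : (0 : ℝ) ∉ Set.uIcc x 1 := by
    rw [Set.uIcc_of_le hx1]; exact fun h => absurd h.1 (not_le.2 hx)
  have hint : IntervalIntegrable (fun v : ℝ => 1 / (2 * v)) volume x 1 := by
    apply ContinuousOn.intervalIntegrable
    refine continuousOn_const.div (by fun_prop) fun v hv => ?_
    have : v ≠ 0 := fun h => h0 (h ▸ hv)
    positivity
  rw [← ofReal_integral_eq_lintegral_ofReal
    ((intervalIntegrable_iff_integrableOn_Ioc_of_le hx1).1 hint)
    ((ae_restrict_iff' measurableSet_Ioc).2 (ae_of_all _ fun v hv => ?_))]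
  · rw [← intervalIntegral.integral_of_le hx1]
    have : ∀ v : ℝ, 1 / (2 * v) = (1 / 2) * (1 / v) := fun v => by rw [one_div_mul_one_div]
    simp_rw [this]
    rw [intervalIntegral.integral_const_mul, integral_one_div h0, Real.log_div one_ne_zero hx.ne',
      Real.log_one]
    congr 1; ring
  · have : 0 < v := hx.trans hv.1
    simp only [Pi.zero_apply]; positivity

/-- The divergence matches the value `∞` of `posKernel` on the diagonal. -/
lemma lintegral_Ioc_inv_zero :
    ∫⁻ v in Set.Ioc (0 : ℝ) 1, ENNReal.ofReal (1 / (2 * v)) = ⊤ := by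
  refine ENNReal.eq_top_of_forall_nnreal_le fun r => ?_
  have hx : (0 : ℝ) < Real.exp (-(2 * r)) := Real.exp_pos _
  have hx1 : Real.exp (-(2 * r)) ≤ (1 : ℝ) := Real.exp_le_one_iff.2 (by simp)
  calc (r : ℝ≥0∞) = ENNReal.ofReal (-Real.log (Real.exp (-(2 * r))) / 2) := by
        rw [Real.log_exp]; simp
    _ = _ := (lintegral_Ioc_inv hx hx1).symm
    _ ≤ _ := lintegral_mono_set (Set.Ioc_subset_Ioc_left hx.le)

lemma lintegral_Ioi_exp {v : ℝ} (hv : 0 < v) :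
    ∫⁻ u in Set.Ioi (0 : ℝ), ENNReal.ofReal (Real.exp (-(u * v)) / 2) =
      ENNReal.ofReal (1 / (2 * v)) := by
  have h1 : ∀ u : ℝ, Real.exp (-(u * v)) / 2 = Real.exp (-v * u) / 2 := fun u => by ring_nf
  simp_rw [h1]
  rw [← ofReal_integral_eq_lintegral_ofReal
    ((integrableOn_exp_mul_Ioi (by linarith : -v < 0) 0).div_const 2)
    (ae_of_all _ fun u => by simp only [Pi.zero_apply]; positivity)]
  rw [integral_div, integral_exp_mul_Ioi (by linarith : -v < 0) 0]
  congr 1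
  simp
  ring

lemma lintegral_Ioc_exp {x u : ℝ} (hx1 : x ≤ 1) (hu : 0 < u) :
    ∫⁻ v in Set.Ioc x 1, ENNReal.ofReal (Real.exp (-(u * v)) / 2) =
      ENNReal.ofReal ((Real.exp (-(u * x)) - Real.exp (-u)) / (2 * u)) := by
  have hint : IntervalIntegrable (fun v : ℝ => Real.exp (-(u * v)) / 2) volume x 1 :=
    Continuous.intervalIntegrable (by fun_prop) _ _
  rw [← ofReal_integral_eq_lintegral_ofReal
    ((intervalIntegrable_iff_integrableOn_Ioc_of_le hx1).1 hint)
    (ae_of_all _ fun v => by simp only [Pi.zero_apply]; positivity)]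
  rw [← intervalIntegral.integral_of_le hx1]
  have hd : ∀ v ∈ Set.uIcc x 1,
      HasDerivAt (fun v : ℝ => -(Real.exp (-(u * v)) / (2 * u))) (Real.exp (-(u * v)) / 2) v := by
    intro v _
    have h := ((((hasDerivAt_id v).const_mul u).neg.exp).div_const (2 * u)).neg
    refine h.congr_deriv ?_
    simp only [id, Pi.neg_apply]
    field_simp
  rw [intervalIntegral.integral_eq_sub_of_hasDerivAt hd hint]
  congr 1
  rw [mul_one]; ring

/-- Frullani representation of the kernel as a mixture of Gaussian kernels. -/
lemma posKernel_eq_lintegral {s t : ℝ} (h : |s - t| ≤ 2) :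
    posKernel s t = ∫⁻ u in Set.Ioi (0 : ℝ),
      ENNReal.ofReal ((Real.exp (-(u * ((s - t) ^ 2 / 4))) - Real.exp (-u)) / (2 * u)) := by
  set x : ℝ := (s - t) ^ 2 / 4 with hx
  have hx0 : 0 ≤ x := by positivity
  have hx1 : x ≤ 1 := by
    have : (s - t) ^ 2 ≤ 2 ^ 2 := sq_le_sq' (by linarith [abs_le.1 h]) (abs_le.1 h).2
    rw [hx]; linarith
  -- Tonelli for `e^(-uv)/2` on `u > 0`, `x < v ≤ 1`. Integrating in `v` first gives the claimed
  -- integrand; integrating in `u` first gives `∫_x^1 dv/(2v) = -(log x)/2 = log (2/|s - t|)`.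
  have hswap : ∫⁻ u in Set.Ioi (0 : ℝ),
      ENNReal.ofReal ((Real.exp (-(u * x)) - Real.exp (-u)) / (2 * u)) =
      ∫⁻ v in Set.Ioc x 1, ENNReal.ofReal (1 / (2 * v)) := by
    rw [setLIntegral_congr_fun measurableSet_Ioi
      (fun u hu => (lintegral_Ioc_exp (x := x) hx1 hu).symm),
      lintegral_lintegral_swap (by fun_prop)]
    exact setLIntegral_congr_fun measurableSet_Ioc
      (fun v hv => lintegral_Ioi_exp (hx0.trans_lt hv.1))
  rw [hswap]
  by_cases hst : s = t
  · have : x = 0 := by rw [hx, hst]; simp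
    rw [this, lintegral_Ioc_inv_zero, posKernel, if_pos hst]
  · have hpos : 0 < x := by
      have : s - t ≠ 0 := sub_ne_zero.2 hst
      positivity
    rw [lintegral_Ioc_inv hpos hx1, posKernel, if_neg hst]
    congr 1
    rw [hx, ← sq_abs, Real.log_div (by simpa [sub_eq_zero] using hst) (by norm_num), Real.log_pow,
      show (4 : ℝ) = 2 ^ 2 by norm_num, Real.log_pow]
    push_cast; ring

/-! ### Gaussian energies and characteristic functions -/

/-- The mutual energy for a Gaussian kernel. -/
def gaussEnergy (u : ℝ) (μ ν : Measure ℝ) : ℝ :=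
  ∫ q, Real.exp (-(u * ((q.1 - q.2) ^ 2 / 4))) ∂(μ.prod ν)

lemma IsProbOnInterval.ae_mem {ν : Measure ℝ} (h : IsProbOnInterval ν) :
    ∀ᵐ x ∂ν, x ∈ Set.Icc (-1 : ℝ) 1 := h.conc

lemma IsProbOnInterval.ae_prod {μ ν : Measure ℝ} (hμ : IsProbOnInterval μ)
    (hν : IsProbOnInterval ν) :
    ∀ᵐ q ∂(μ.prod ν), q.1 ∈ Set.Icc (-1 : ℝ) 1 ∧ q.2 ∈ Set.Icc (-1 : ℝ) 1 := by
  have := hμ.prob; have := hν.prob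
  have h1 : ∀ᵐ q ∂(μ.prod ν), q.1 ∈ Set.Icc (-1 : ℝ) 1 :=
    Measure.quasiMeasurePreserving_fst.ae hμ.ae_mem
  have h2 : ∀ᵐ q ∂(μ.prod ν), q.2 ∈ Set.Icc (-1 : ℝ) 1 :=
    Measure.quasiMeasurePreserving_snd.ae hν.ae_mem
  filter_upwards [h1, h2] with q a b using ⟨a, b⟩

lemma abs_sub_le_two {s t : ℝ} (hs : s ∈ Set.Icc (-1 : ℝ) 1) (ht : t ∈ Set.Icc (-1 : ℝ) 1) :
    |s - t| ≤ 2 :=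
  abs_le.2 ⟨by linarith [hs.1, ht.2], by linarith [hs.2, ht.1]⟩

lemma gaussKernel_nonneg {u : ℝ} (hu : 0 < u) {s t : ℝ} (hs : s ∈ Set.Icc (-1 : ℝ) 1)
    (ht : t ∈ Set.Icc (-1 : ℝ) 1) :
    0 ≤ Real.exp (-(u * ((s - t) ^ 2 / 4))) - Real.exp (-u) := by
  have h := abs_le.1 (abs_sub_le_two hs ht)
  rw [sub_nonneg]
  apply Real.exp_le_exp.2
  nlinarith [mul_nonneg hu.le (mul_nonneg (by linarith : 0 ≤ s - t + 2) (by linarith : 0 ≤ 2 - (s - t)))]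

lemma integrable_gaussKernel {u : ℝ} (hu : 0 < u) {μ ν : Measure ℝ} [IsProbabilityMeasure μ]
    [IsProbabilityMeasure ν] :
    Integrable (fun q : ℝ × ℝ => Real.exp (-(u * ((q.1 - q.2) ^ 2 / 4)))) (μ.prod ν) := by
  refine Integrable.of_bound (by fun_prop) 1 (ae_of_all _ fun q => ?_)
  rw [Real.norm_eq_abs, abs_of_pos (Real.exp_pos _), Real.exp_le_one_iff, neg_nonpos]
  positivity

/-- The subtracted `e^(-u)` is the same for every pair of probability measures, so it cancels in the
quadratic form, and positivity can be checked for each Gaussian kernel separately. -/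
lemma mutualEnergy_eq {μ ν : Measure ℝ} (hμ : IsProbOnInterval μ) (hν : IsProbOnInterval ν) :
    mutualEnergy μ ν = ∫⁻ u in Set.Ioi (0 : ℝ),
      ENNReal.ofReal ((gaussEnergy u μ ν - Real.exp (-u)) / (2 * u)) := by
  have := hμ.prob; have := hν.prob
  unfold mutualEnergy
  rw [lintegral_congr_ae ((hμ.ae_prod hν).mono fun q hq =>
    posKernel_eq_lintegral (abs_sub_le_two hq.1 hq.2))]
  rw [lintegral_lintegral_swap (by fun_prop)]
  refine setLIntegral_congr_fun measurableSet_Ioi fun u hu => ?_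
  have hu' : 0 < u := hu
  have hi := integrable_gaussKernel hu' (μ := μ) (ν := ν)
  rw [← ofReal_integral_eq_lintegral_ofReal]
  · congr 1
    rw [integral_div, integral_sub hi (integrable_const _)]
    simp [gaussEnergy]
  · exact (hi.sub (integrable_const _)).div_const _
  · filter_upwards [hμ.ae_prod hν] with q hq
    exact div_nonneg (gaussKernel_nonneg hu' hq.1 hq.2) (by positivity)

lemma gaussEnergy_ge {u : ℝ} (hu : 0 < u) {μ ν : Measure ℝ} (hμ : IsProbOnInterval μ)
    (hν : IsProbOnInterval ν) : Real.exp (-u) ≤ gaussEnergy u μ ν := by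
  have := hμ.prob; have := hν.prob
  have hi := integrable_gaussKernel hu (μ := μ) (ν := ν)
  calc Real.exp (-u) = ∫ q, Real.exp (-u) ∂(μ.prod ν) := by simp
    _ ≤ _ := integral_mono_ae (integrable_const _) hi ((hμ.ae_prod hν).mono fun q hq =>
      sub_nonneg.1 (gaussKernel_nonneg hu hq.1 hq.2))

/-- `exp(-u d²/4)` is the characteristic function at `d` of a centred Gaussian of variance `u/2`, so
Fubini turns the energy into an `L²` pairing of characteristic functions. -/
lemma gaussEnergy_eq_charFun {u : ℝ} (hu : 0 < u) (μ ν : Measure ℝ) [IsProbabilityMeasure μ]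
    [IsProbabilityMeasure ν] :
    (gaussEnergy u μ ν : ℂ) = ∫ τ, charFun μ τ * (starRingEnd ℂ) (charFun ν τ)
      ∂(ProbabilityTheory.gaussianReal 0 (Real.toNNReal (u / 2))) := by
  set γ := ProbabilityTheory.gaussianReal 0 (Real.toNNReal (u / 2))
  have h1 : ∀ q : ℝ × ℝ, ((Real.exp (-(u * ((q.1 - q.2) ^ 2 / 4))) : ℝ) : ℂ) =
      ∫ τ, Complex.exp (τ * (q.1 - q.2 : ℝ) * Complex.I) ∂γ := by
    intro q
    have := ProbabilityTheory.charFun_gaussianReal (μ := 0) (v := Real.toNNReal (u / 2)) (q.1 - q.2)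
    rw [charFun_apply_real] at this
    rw [Complex.ofReal_exp]
    refine Eq.trans ?_ (this.symm.trans ?_)
    · congr 1
      have : ((Real.toNNReal (u / 2) : NNReal) : ℂ) = (u / 2 : ℂ) := by
        rw [show ((Real.toNNReal (u / 2) : NNReal) : ℂ) = (((Real.toNNReal (u / 2) : NNReal) : ℝ) : ℂ)
          from rfl, Real.coe_toNNReal _ (by positivity)]
        push_cast; ring
      rw [this]; push_cast; ring
    · refine integral_congr_ae (ae_of_all _ fun τ => ?_)
      dsimp only
      congr 1; ring
  unfold gaussEnergy
  rw [← integral_complex_ofReal]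
  simp_rw [h1]
  rw [integral_integral_swap]
  · refine integral_congr_ae (ae_of_all _ fun τ => ?_)
    dsimp only
    rw [charFun_apply_real, charFun_apply_real, ← integral_conj, ← integral_prod_mul]
    refine integral_congr_ae (ae_of_all _ fun q => ?_)
    dsimp only
    rw [← Complex.exp_conj, ← Complex.exp_add]
    congr 1
    simp
    ring
  · refine Integrable.of_bound (C := 1) ?_ (ae_of_all _ fun q => ?_)
    · apply Continuous.aestronglyMeasurable
      unfold Function.uncurry
      fun_prop
    · simp only [Function.uncurry]
      rw [← Complex.ofReal_mul, Complex.norm_exp_ofReal_mul_I]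

lemma gaussEnergy_add_sub {u : ℝ} (hu : 0 < u) (μ ν : Measure ℝ) [IsProbabilityMeasure μ]
    [IsProbabilityMeasure ν] :
    gaussEnergy u μ μ + gaussEnergy u ν ν - 2 * gaussEnergy u μ ν =
      ∫ τ, ‖charFun μ τ - charFun ν τ‖ ^ 2
        ∂(ProbabilityTheory.gaussianReal 0 (Real.toNNReal (u / 2))) := by
  set γ := ProbabilityTheory.gaussianReal 0 (Real.toNNReal (u / 2))
  have hint : ∀ (α β : Measure ℝ) [IsProbabilityMeasure α] [IsProbabilityMeasure β],
      Integrable (fun τ => charFun α τ * (starRingEnd ℂ) (charFun β τ)) γ := by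
    intro α β _ _
    refine Integrable.of_bound (C := 1) ?_ (ae_of_all _ fun τ => ?_)
    · exact (continuous_charFun.mul (Complex.continuous_conj.comp
        continuous_charFun)).aestronglyMeasurable
    · rw [norm_mul, RCLike.norm_conj]
      exact mul_le_one₀ (norm_charFun_le_one _) (norm_nonneg _) (norm_charFun_le_one _)
  have hre : ∀ (α β : Measure ℝ) [IsProbabilityMeasure α] [IsProbabilityMeasure β],
      gaussEnergy u α β = ∫ τ, (charFun α τ * (starRingEnd ℂ) (charFun β τ)).re ∂γ := by
    intro α β _ _
    have := gaussEnergy_eq_charFun hu α β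
    rw [← Complex.ofReal_re (gaussEnergy u α β), this]
    exact (integral_re (hint α β)).symm
  have hint' : ∀ (α β : Measure ℝ) [IsProbabilityMeasure α] [IsProbabilityMeasure β],
      Integrable (fun τ => (charFun α τ * (starRingEnd ℂ) (charFun β τ)).re) γ :=
    fun α β _ _ => (hint α β).re
  rw [hre μ μ, hre ν ν, hre μ ν, ← integral_const_mul, ← integral_add (hint' μ μ) (hint' ν ν),
    ← integral_sub ?_ ((hint' μ ν).const_mul 2)]
  · refine integral_congr_ae (ae_of_all _ fun τ => ?_)
    dsimp only
    rw [← Complex.normSq_eq_norm_sq, Complex.normSq_sub]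
    simp [Complex.normSq_apply]
  · exact (hint' μ μ).add (hint' ν ν)

lemma gaussEnergy_posDef {u : ℝ} (hu : 0 < u) (μ ν : Measure ℝ) [IsProbabilityMeasure μ]
    [IsProbabilityMeasure ν] :
    2 * gaussEnergy u μ ν ≤ gaussEnergy u μ μ + gaussEnergy u ν ν := by
  have := gaussEnergy_add_sub hu μ ν
  have h2 : 0 ≤ ∫ τ, ‖charFun μ τ - charFun ν τ‖ ^ 2
        ∂(ProbabilityTheory.gaussianReal 0 (Real.toNNReal (u / 2))) :=
    integral_nonneg fun τ => by positivity
  linarith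

/-- The Gaussian weight charges every open set and characteristic functions are continuous, so
vanishing `L²` distance makes them equal everywhere. A single `u` suffices. -/
lemma eq_of_gaussEnergy_eq {u : ℝ} (hu : 0 < u) (μ ν : Measure ℝ) [IsProbabilityMeasure μ]
    [IsProbabilityMeasure ν]
    (h : gaussEnergy u μ μ + gaussEnergy u ν ν ≤ 2 * gaussEnergy u μ ν) : μ = ν := by
  set γ := ProbabilityTheory.gaussianReal 0 (Real.toNNReal (u / 2)) with hγ
  have hv : Real.toNNReal (u / 2) ≠ 0 := by
    simpa using hu
  have h0 : ∫ τ, ‖charFun μ τ - charFun ν τ‖ ^ 2 ∂γ = 0 := by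
    refine le_antisymm ?_ (integral_nonneg fun τ => by positivity)
    rw [← gaussEnergy_add_sub hu]; linarith
  have hc : Continuous fun τ => ‖charFun μ τ - charFun ν τ‖ ^ 2 :=
    ((continuous_charFun.sub continuous_charFun).norm).pow 2
  have hi : Integrable (fun τ => ‖charFun μ τ - charFun ν τ‖ ^ 2) γ := by
    refine Integrable.of_bound (C := 4) hc.aestronglyMeasurable (ae_of_all _ fun τ => ?_)
    rw [Real.norm_eq_abs, abs_of_nonneg (by positivity)]
    have : ‖charFun μ τ - charFun ν τ‖ ≤ 2 := (norm_sub_le _ _).trans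
      (by linarith [norm_charFun_le_one (μ := μ) τ, norm_charFun_le_one (μ := ν) τ])
    nlinarith [norm_nonneg (charFun μ τ - charFun ν τ)]
  have hae := (integral_eq_zero_iff_of_nonneg (fun τ => by positivity) hi).1 h0
  have hae' : (fun τ => ‖charFun μ τ - charFun ν τ‖ ^ 2) =ᵐ[volume] 0 :=
    (ProbabilityTheory.gaussianReal_absolutelyContinuous' 0 hv).ae_eq hae
  have heq := Continuous.ae_eq_iff_eq volume hc continuous_zero |>.1 hae'
  refine Measure.ext_of_charFun (funext fun τ => ?_)
  have := congrFun heq τ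
  simpa [sub_eq_zero] using this

lemma measurable_gaussEnergy (α β : Measure ℝ) [IsProbabilityMeasure α]
    [IsProbabilityMeasure β] :
    Measurable fun u => ENNReal.ofReal ((gaussEnergy u α β - Real.exp (-u)) / (2 * u)) := by
  have : StronglyMeasurable fun u => gaussEnergy u α β := by
    unfold gaussEnergy
    apply StronglyMeasurable.integral_prod_right (f := fun (u : ℝ) (q : ℝ × ℝ) =>
      Real.exp (-(u * ((q.1 - q.2) ^ 2 / 4))))
    apply Continuous.stronglyMeasurable
    unfold Function.uncurry
    fun_prop
  have := this.measurable
  fun_prop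

/-- The logarithmic energy is positive definite. -/
theorem two_mul_mutualEnergy_le {μ ν : Measure ℝ} (hμ : IsProbOnInterval μ)
    (hν : IsProbOnInterval ν) :
    2 * mutualEnergy μ ν ≤ mutualEnergy μ μ + mutualEnergy ν ν := by
  have := hμ.prob; have := hν.prob
  rw [mutualEnergy_eq hμ hν, mutualEnergy_eq hμ hμ, mutualEnergy_eq hν hν,
    ← lintegral_add_left (measurable_gaussEnergy μ μ), ← lintegral_const_mul _ (measurable_gaussEnergy μ ν)]
  refine setLIntegral_mono' measurableSet_Ioi fun u hu => ?_
  have hu' : 0 < u := hu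
  have h1 := gaussEnergy_ge hu' hμ hμ
  have h2 := gaussEnergy_ge hu' hν hν
  rw [← ENNReal.ofReal_add (div_nonneg (by linarith) (by positivity))
    (div_nonneg (by linarith) (by positivity)), show (2 : ℝ≥0∞) = ENNReal.ofReal 2 by simp,
    ← ENNReal.ofReal_mul (by norm_num), ← add_div, ← mul_div_assoc]
  have := gaussEnergy_posDef hu' μ ν
  refine ENNReal.ofReal_le_ofReal ?_
  gcongr
  linarith

/-- The logarithmic energy is strictly positive definite. -/
theorem eq_of_mutualEnergy_le {μ ν : Measure ℝ} (hμ : IsProbOnInterval μ)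
    (hν : IsProbOnInterval ν) (hfin : mutualEnergy μ ν ≠ ⊤)
    (h : mutualEnergy μ μ + mutualEnergy ν ν ≤ 2 * mutualEnergy μ ν) : μ = ν := by
  have := hμ.prob; have := hν.prob
  by_contra hne
  have hfin2 : 2 * mutualEnergy μ ν ≠ ⊤ := ENNReal.mul_ne_top (by simp) hfin
  refine absurd h (not_le.2 ?_)
  rw [mutualEnergy_eq hμ hν, mutualEnergy_eq hμ hμ, mutualEnergy_eq hν hν,
    ← lintegral_add_left (measurable_gaussEnergy μ μ), ← lintegral_const_mul _ (measurable_gaussEnergy μ ν)]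
  -- For distinct measures the integrands are strictly ordered at every `u > 0`; finiteness of the
  -- smaller integral preserves strictness.
  refine setLIntegral_strict_mono measurableSet_Ioi (by simp)
    ((measurable_gaussEnergy μ μ).add (measurable_gaussEnergy ν ν)) ?_ (ae_of_all _ fun u hu => ?_)
  · rwa [lintegral_const_mul _ (measurable_gaussEnergy μ ν), ← mutualEnergy_eq hμ hν]
  have hu' : 0 < u := hu
  have h1 := gaussEnergy_ge hu' hμ hμ
  have h2 := gaussEnergy_ge hu' hν hν
  have h3 := gaussEnergy_ge hu' hμ hν
  have h4 : 2 * gaussEnergy u μ ν < gaussEnergy u μ μ + gaussEnergy u ν ν := by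
    by_contra hc
    exact hne (eq_of_gaussEnergy_eq hu' μ ν (not_lt.1 hc))
  rw [← ENNReal.ofReal_add (div_nonneg (by linarith) (by positivity))
    (div_nonneg (by linarith) (by positivity)), show (2 : ℝ≥0∞) = ENNReal.ofReal 2 by simp,
    ← ENNReal.ofReal_mul (by norm_num), ← add_div, ← mul_div_assoc]
  refine (ENNReal.ofReal_lt_ofReal_iff_of_nonneg
    (div_nonneg (by linarith) (by positivity))).2 ?_
  gcongr
  linarith


/-! ### Poisson averages of logarithms -/

lemma poissonKernel_circleMap (z θ : ℝ) :
    poissonKernel 0 (z : ℂ) (circleMap 0 1 θ) =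
      (1 - z ^ 2) / (1 - 2 * z * Real.cos θ + z ^ 2) := by
  rw [poissonKernel_def]
  have h1 : ‖circleMap 0 1 θ - 0 - ((z : ℂ) - 0)‖ ^ 2 = 1 - 2 * z * Real.cos θ + z ^ 2 := by
    rw [← Complex.normSq_eq_norm_sq, Complex.normSq_apply]
    simp [circleMap, Complex.exp_ofReal_mul_I_re, Complex.exp_ofReal_mul_I_im]
    nlinarith [Real.sin_sq_add_cos_sq θ]
  rw [h1]
  simp

lemma poisson_denom_pos {z : ℝ} (hz : |z| < 1) (θ : ℝ) : 0 < 1 - 2 * z * Real.cos θ + z ^ 2 := by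
  have h := abs_lt.1 hz
  nlinarith [Real.cos_sq_add_sin_sq θ, sq_nonneg (z - Real.cos θ), sq_nonneg (Real.sin θ),
    Real.cos_le_one θ, Real.neg_one_le_cos θ, mul_nonneg (sub_nonneg.2 h.2.le) (sub_nonneg.2 (Real.cos_le_one θ)),
    mul_pos (sub_pos.2 h.2) (sub_pos.2 h.2), mul_pos (sub_pos.2 h.1) (sub_pos.2 h.1)]

lemma continuous_poissonKernel_circleMap {z : ℝ} (hz : |z| < 1) :
    Continuous fun θ : ℝ => poissonKernel 0 (z : ℂ) (circleMap 0 1 θ) := by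
  simp_rw [poissonKernel_circleMap]
  exact Continuous.div (by fun_prop) (by fun_prop) fun θ => (poisson_denom_pos hz θ).ne'

lemma circleIntegrable_poisson_log {z : ℝ} (hz : |z| < 1) (ζ : ℂ) :
    CircleIntegrable (fun w => poissonKernel 0 (z : ℂ) w * Real.log ‖w - ζ‖) 0 1 := by
  have h := circleIntegrable_log_norm_sub_const (a := ζ) (c := 0) 1
  exact IntervalIntegrable.continuousOn_mul h (continuous_poissonKernel_circleMap hz).continuousOn

/-- On the unit circle `|w - ζ| = |1 - conj ζ · w|`. For `|ζ| < 1` the logarithm of the right-hand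
side is harmonic near the closed disc, so the Poisson formula evaluates it at `z`. -/
lemma circleAverage_poisson_log_of_lt {z : ℝ} (hz : |z| < 1) {ζ : ℂ} (hζ : ‖ζ‖ < 1) :
    Real.circleAverage (fun w => poissonKernel 0 (z : ℂ) w * Real.log ‖w - ζ‖) 0 1 =
      Real.log ‖1 - (starRingEnd ℂ) ζ * z‖ := by
  have hmem : (z : ℂ) ∈ Metric.ball (0 : ℂ) 1 := by simpa using hz
  have hh : InnerProductSpace.HarmonicOnNhd (fun w : ℂ => Real.log ‖1 - (starRingEnd ℂ) ζ * w‖)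
      (Metric.closedBall 0 1) := by
    intro w hw
    refine AnalyticAt.harmonicAt_log_norm (f := fun w => 1 - (starRingEnd ℂ) ζ * w) (by fun_prop) ?_
    intro h0
    have : ‖(starRingEnd ℂ) ζ * w‖ = 1 := by rw [← sub_eq_zero.1 h0, norm_one]
    rw [norm_mul, RCLike.norm_conj] at this
    have hw' : ‖w‖ ≤ 1 := by simpa using hw
    nlinarith [norm_nonneg ζ, norm_nonneg w]
  have := hh.circleAverage_poissonKernel_smul hmem
  rw [← this]
  refine Real.circleAverage_congr_sphere fun w hw => ?_
  have hw1 : ‖w‖ = 1 := by simpa using hw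
  simp only [Pi.smul_apply', smul_eq_mul]
  congr 2
  have h1 : w * (1 - (starRingEnd ℂ) w * ζ) = w - ζ := by
    rw [mul_sub, mul_one, ← mul_assoc, Complex.mul_conj, Complex.normSq_eq_norm_sq, hw1]; simp
  rw [← h1, norm_mul, hw1, one_mul, ← RCLike.norm_conj]
  congr 1
  simp [mul_comm]

/-- A lower bound uniform in `r`, which dominates the logarithms when a boundary point `ζ` is
approached along `rζ`. -/
lemma half_norm_sub_le {w ζ : ℂ} (hw : ‖w‖ = 1) (hζ : ‖ζ‖ = 1) {r : ℝ}
    (hr0 : 0 ≤ r) (hr1 : r ≤ 1) : ‖w - ζ‖ / 2 ≤ ‖w - r * ζ‖ := by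
  have h1 : 1 - r ≤ ‖w - r * ζ‖ := by
    have := norm_sub_norm_le w (r * ζ)
    rw [norm_mul, hw, hζ, mul_one, Complex.norm_real, Real.norm_eq_abs] at this
    rwa [abs_of_nonneg hr0] at this
  have h2 : ‖w - ζ‖ ≤ ‖w - r * ζ‖ + (1 - r) := by
    have h3 : ‖(r * ζ - ζ : ℂ)‖ = 1 - r := by
      rw [show (r * ζ - ζ : ℂ) = ((r - 1 : ℝ) : ℂ) * ζ by push_cast; ring, norm_mul, hζ, mul_one,
        Complex.norm_real, Real.norm_eq_abs, abs_of_nonpos (by linarith)]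
      ring
    calc ‖w - ζ‖ = ‖(w - r * ζ) + (r * ζ - ζ)‖ := by congr 1; ring
      _ ≤ _ := (norm_add_le _ _).trans (by rw [h3])
  linarith

lemma ae_circleMap_ne (ζ : ℂ) : ∀ᵐ θ : ℝ, circleMap 0 1 θ ≠ ζ := by
  have : ((circleMap 0 1) ⁻¹' {ζ}).Countable :=
    (Set.countable_singleton ζ).preimage_circleMap 0 one_ne_zero
  exact (this.ae_notMem volume).mono fun θ h => h

/-- Boundary points `|ζ| = 1` are needed because they parametrize the support. They are reached as
limits of `rζ` with `r ↑ 1`, by dominated convergence with `half_norm_sub_le`. -/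
lemma circleAverage_poisson_log {z : ℝ} (hz : |z| < 1) {ζ : ℂ} (hζ : ‖ζ‖ ≤ 1) :
    Real.circleAverage (fun w => poissonKernel 0 (z : ℂ) w * Real.log ‖w - ζ‖) 0 1 =
      Real.log ‖1 - (starRingEnd ℂ) ζ * z‖ := by
  rcases hζ.lt_or_eq with h | h
  · exact circleAverage_poisson_log_of_lt hz h
  have hne : (1 - (starRingEnd ℂ) ζ * z) ≠ 0 := by
    intro h0
    have : ‖(starRingEnd ℂ) ζ * z‖ = 1 := by rw [← sub_eq_zero.1 h0, norm_one]
    rw [norm_mul, RCLike.norm_conj, h, one_mul, Complex.norm_real, Real.norm_eq_abs] at this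
    linarith
  have hlim1 : Tendsto (fun r : ℝ => Real.log ‖1 - (starRingEnd ℂ) (r * ζ) * z‖) (𝓝[<] 1)
      (𝓝 (Real.log ‖1 - (starRingEnd ℂ) ζ * z‖)) := by
    refine Tendsto.mono_left ?_ nhdsWithin_le_nhds
    have hc : ContinuousAt (fun r : ℝ => Real.log ‖1 - (starRingEnd ℂ) (r * ζ) * z‖) 1 := by
      refine ContinuousAt.log (by fun_prop) ?_
      simpa using hne
    simpa using hc.tendsto
  have hlim2 : Tendsto (fun r : ℝ => Real.circleAverage
      (fun w => poissonKernel 0 (z : ℂ) w * Real.log ‖w - r * ζ‖) 0 1) (𝓝[<] 1)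
      (𝓝 (Real.circleAverage (fun w => poissonKernel 0 (z : ℂ) w * Real.log ‖w - ζ‖) 0 1)) := by
    unfold Real.circleAverage
    refine Tendsto.const_smul ?_ _
    have hP := continuous_poissonKernel_circleMap hz
    have hii := circleIntegrable_log_norm_sub_const (a := ζ) (c := 0) 1
    have hI : IntervalIntegrable (fun θ => |poissonKernel 0 (z : ℂ) (circleMap 0 1 θ)| *
        (Real.log 2 + |Real.log ‖circleMap 0 1 θ - ζ‖|)) volume 0 (2 * Real.pi) :=
      IntervalIntegrable.continuousOn_mul (intervalIntegrable_const.add hii.norm)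
        hP.abs.continuousOn
    refine intervalIntegral.tendsto_integral_filter_of_dominated_convergence _ ?_ ?_ hI ?_
    · refine Eventually.of_forall fun r => ?_
      refine (hP.measurable.mul (Real.measurable_log.comp ?_)).aestronglyMeasurable
      exact Continuous.measurable (by fun_prop)
    · filter_upwards [self_mem_nhdsWithin, nhdsWithin_le_nhds (lt_mem_nhds (zero_lt_one' ℝ))]
        with r hr hr0
      have hr1 : r < 1 := hr
      filter_upwards [ae_circleMap_ne ζ] with θ hθ _
      rw [norm_mul, Real.norm_eq_abs, Real.norm_eq_abs]
      refine mul_le_mul_of_nonneg_left ?_ (abs_nonneg _)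
      have hw : ‖circleMap 0 1 θ‖ = 1 := by simp
      have hp : 0 < ‖circleMap 0 1 θ - ζ‖ := norm_pos_iff.2 (sub_ne_zero.2 hθ)
      have hl := half_norm_sub_le hw h hr0.le hr1.le
      have hu : ‖circleMap 0 1 θ - r * ζ‖ ≤ 2 := by
        refine (norm_sub_le _ _).trans ?_
        rw [hw, norm_mul, h, Complex.norm_real, Real.norm_eq_abs, abs_of_pos hr0]; linarith
      have h1 := Real.log_le_log (by linarith) hl
      have h2 := Real.log_le_log (by linarith) hu
      rw [Real.log_div hp.ne' two_ne_zero] at h1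
      have h3 := neg_abs_le (Real.log ‖circleMap 0 1 θ - ζ‖)
      have h4 := abs_nonneg (Real.log ‖circleMap 0 1 θ - ζ‖)
      rw [abs_le]; constructor <;> linarith
    · filter_upwards [ae_circleMap_ne ζ] with θ hθ _
      refine Tendsto.const_mul _ (Tendsto.mono_left ?_ nhdsWithin_le_nhds)
      have hc : ContinuousAt (fun r : ℝ => Real.log ‖circleMap 0 1 θ - r * ζ‖) 1 := by
        refine ContinuousAt.log (by fun_prop) ?_
        simpa [sub_eq_zero] using hθ
      simpa using hc.tendsto
  refine tendsto_nhds_unique hlim2 (hlim1.congr' ?_)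
  filter_upwards [self_mem_nhdsWithin, nhdsWithin_le_nhds (lt_mem_nhds (zero_lt_one' ℝ))]
    with r hr hr0
  refine (circleAverage_poisson_log_of_lt hz ?_).symm
  rw [norm_mul, h, Complex.norm_real, Real.norm_eq_abs, abs_of_pos hr0, mul_one]
  exact hr

lemma circleAverage_poisson {z : ℝ} (hz : |z| < 1) :
    Real.circleAverage (poissonKernel 0 (z : ℂ)) 0 1 = 1 := by
  have hmem : (z : ℂ) ∈ Metric.ball (0 : ℂ) 1 := by simpa using hz
  have hh : InnerProductSpace.HarmonicOnNhd (fun _ : ℂ => (1 : ℝ))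
      (Metric.closedBall 0 1) := fun w hw => by
    simp
  have := hh.circleAverage_poissonKernel_smul hmem
  rw [← this]
  congr 1
  ext w
  simp


/-! ### The explicit equilibrium measure -/

/-- Normalized Lebesgue measure on `(0, 2π]`. -/
def angleMeasure : Measure ℝ :=
  ENNReal.ofReal (2 * Real.pi)⁻¹ • volume.restrict (Set.Ioc 0 (2 * Real.pi))

lemma integral_angleMeasure (f : ℂ → ℝ) :
    ∫ θ, f (circleMap 0 1 θ) ∂angleMeasure = Real.circleAverage f 0 1 := by
  rw [angleMeasure, integral_smul_measure, Real.circleAverage,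
    intervalIntegral.integral_of_le Real.two_pi_pos.le,
    ENNReal.toReal_ofReal (inv_nonneg.2 Real.two_pi_pos.le)]

lemma integrable_angleMeasure {f : ℂ → ℝ} (hf : CircleIntegrable f 0 1) :
    Integrable (fun θ => f (circleMap 0 1 θ)) angleMeasure :=
  ((intervalIntegrable_iff_integrableOn_Ioc_of_le Real.two_pi_pos.le).1 hf).smul_measure
    ENNReal.ofReal_ne_top

lemma ae_angleMeasure_circleMap_ne (ζ : ℂ) : ∀ᵐ θ ∂angleMeasure, circleMap 0 1 θ ≠ ζ :=
  Measure.ae_smul_measure (ae_restrict_of_ae (ae_circleMap_ne ζ)) _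

variable {ι : Type*} {S : Finset ι} {z : ι → ℝ} {w : ℝ}

/-- The density of the equilibrium measure in the angular variable. -/
def angleDensity (S : Finset ι) (z : ι → ℝ) (w : ℝ) (θ : ℝ) : ℝ :=
  1 + w * ∑ k ∈ S, (1 - poissonKernel 0 (z k : ℂ) (circleMap 0 1 θ))

/-- The endpoint conditions for the equilibrium measure, in terms of the positions of the charges
in the exterior conformal coordinate of the support. -/
structure Balanced (S : Finset ι) (z : ι → ℝ) (w : ℝ) : Prop where
  w_pos : 0 < w
  ne_zero : ∀ k ∈ S, z k ≠ 0
  abs_lt : ∀ k ∈ S, |z k| < 1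
  sum_zero : ∑ k ∈ S, z k / (1 - z k ^ 2) = 0
  sum_one : w * ∑ k ∈ S, 2 * z k ^ 2 / (1 - z k ^ 2) = 1

/-- The law of `c + h cos θ` when `θ` has the density `angleDensity`. -/
def arcMeasure (S : Finset ι) (z : ι → ℝ) (w c h : ℝ) : Measure ℝ :=
  (angleMeasure.withDensity (fun θ => ENNReal.ofReal (angleDensity S z w θ))).map
    (fun θ => c + h * Real.cos θ)

lemma one_sub_sq_pos {x : ℝ} (hx : |x| < 1) : 0 < 1 - x ^ 2 := by
  have := (sq_lt_one_iff_abs_lt_one x).2 hx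
  linarith

/-- Replacing the constant `1` by `sum_one` and adding `2 cos θ` times `sum_zero` makes each charge
contribute a nonnegative term with a factor `sin² θ`. Thus the endpoint conditions are what make the
density nonnegative and vanish at both endpoints. -/
lemma Balanced.angleDensity_eq (hb : Balanced S z w) (θ : ℝ) :
    angleDensity S z w θ = 4 * w * Real.sin θ ^ 2 *
      ∑ k ∈ S, z k ^ 2 / ((1 - z k ^ 2) * (1 - 2 * z k * Real.cos θ + z k ^ 2)) := by
  have h1 : angleDensity S z w θ = w * ∑ k ∈ S, (2 * z k ^ 2 / (1 - z k ^ 2) +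
      (1 - poissonKernel 0 (z k : ℂ) (circleMap 0 1 θ)) +
      2 * Real.cos θ * (z k / (1 - z k ^ 2))) := by
    rw [Finset.sum_add_distrib, Finset.sum_add_distrib,
      ← Finset.mul_sum S (fun k => z k / (1 - z k ^ 2)), hb.sum_zero, mul_add,
      mul_add, hb.sum_one, angleDensity]
    ring
  rw [h1, Finset.mul_sum, Finset.mul_sum]
  refine Finset.sum_congr rfl fun k hk => ?_
  have h2 := one_sub_sq_pos (hb.abs_lt k hk)
  have h3 := poisson_denom_pos (hb.abs_lt k hk) θ
  rw [poissonKernel_circleMap, Real.sin_sq]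
  have h2' := h2.ne'
  have h3' := h3.ne'
  field_simp
  ring

lemma Balanced.angleDensity_nonneg (hb : Balanced S z w) (θ : ℝ) :
    0 ≤ angleDensity S z w θ := by
  rw [hb.angleDensity_eq]
  refine mul_nonneg (mul_nonneg (by linarith [hb.w_pos]) (sq_nonneg _))
    (Finset.sum_nonneg fun k hk => ?_)
  have h2 := one_sub_sq_pos (hb.abs_lt k hk)
  have h3 := poisson_denom_pos (hb.abs_lt k hk) θ
  positivity

lemma Balanced.nonempty (hb : Balanced S z w) : S.Nonempty := by
  rw [Finset.nonempty_iff_ne_empty]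
  rintro rfl
  simpa using hb.sum_one

lemma Balanced.angleDensity_pos (hb : Balanced S z w) {θ : ℝ} (hθ : Real.sin θ ≠ 0) :
    0 < angleDensity S z w θ := by
  rw [hb.angleDensity_eq]
  have hw := hb.w_pos
  refine mul_pos (by positivity) (Finset.sum_pos (fun k hk => ?_) hb.nonempty)
  have h2 := one_sub_sq_pos (hb.abs_lt k hk)
  have h3 := poisson_denom_pos (hb.abs_lt k hk) θ
  have h4 := hb.ne_zero k hk
  positivity

lemma Balanced.continuous_angleDensity (hb : Balanced S z w) :
    Continuous (angleDensity S z w) := by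
  unfold angleDensity
  refine continuous_const.add (continuous_const.mul (continuous_finsetSum _ fun k hk => ?_))
  exact continuous_const.sub (continuous_poissonKernel_circleMap (hb.abs_lt k hk))

lemma integrable_poisson_log {x : ℝ} (hx : |x| < 1) (ζ : ℂ) :
    Integrable (fun θ => poissonKernel 0 (x : ℂ) (circleMap 0 1 θ) *
      Real.log ‖circleMap 0 1 θ - ζ‖) angleMeasure :=
  integrable_angleMeasure (circleIntegrable_poisson_log hx ζ)

lemma integrable_log (ζ : ℂ) :
    Integrable (fun θ => Real.log ‖circleMap 0 1 θ - ζ‖) angleMeasure :=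
  integrable_angleMeasure (circleIntegrable_log_norm_sub_const (a := ζ) (c := 0) 1)

lemma integral_log {ζ : ℂ} (hζ : ‖ζ‖ ≤ 1) :
    ∫ θ, Real.log ‖circleMap 0 1 θ - ζ‖ ∂angleMeasure = 0 := by
  have := integral_angleMeasure fun v => Real.log ‖v - ζ‖
  rw [this]
  have := circleAverage_log_norm_sub_const_of_mem_closedBall (c := 0) (R := 1) (a := ζ) (by simpa)
  simpa using this

lemma integrable_poisson {x : ℝ} (hx : |x| < 1) :
    Integrable (fun θ => poissonKernel 0 (x : ℂ) (circleMap 0 1 θ)) angleMeasure :=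
  integrable_angleMeasure (f := poissonKernel 0 (x : ℂ))
    ((continuous_poissonKernel_circleMap hx).intervalIntegrable _ _)

lemma integral_poisson {x : ℝ} (hx : |x| < 1) :
    ∫ θ, poissonKernel 0 (x : ℂ) (circleMap 0 1 θ) ∂angleMeasure = 1 := by
  rw [integral_angleMeasure, circleAverage_poisson hx]

instance : IsProbabilityMeasure angleMeasure := by
  constructor
  rw [angleMeasure, Measure.smul_apply, Measure.restrict_apply_univ, Real.volume_Ioc, smul_eq_mul,
    ← ENNReal.ofReal_mul (inv_nonneg.2 Real.two_pi_pos.le), sub_zero,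
    inv_mul_cancel₀ Real.two_pi_pos.ne', ENNReal.ofReal_one]

lemma Balanced.integrable_angleDensity (hb : Balanced S z w) :
    Integrable (angleDensity S z w) angleMeasure := by
  unfold angleDensity
  exact (integrable_const _).add ((integrable_finsetSum _ fun k hk =>
    (integrable_const _).sub (integrable_poisson (hb.abs_lt k hk))).const_mul _)

lemma Balanced.integral_angleDensity (hb : Balanced S z w) :
    ∫ θ, angleDensity S z w θ ∂angleMeasure = 1 := by
  unfold angleDensity
  have h1 : ∀ k ∈ S, Integrable (fun θ => 1 - poissonKernel 0 (z k : ℂ) (circleMap 0 1 θ))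
      angleMeasure := fun k hk => (integrable_const _).sub (integrable_poisson (hb.abs_lt k hk))
  rw [integral_add (integrable_const _) ((integrable_finsetSum _ h1).const_mul _),
    integral_const_mul, integral_finsetSum _ h1, Finset.sum_eq_zero]
  · simp
  · intro k hk
    rw [integral_sub (integrable_const _) (integrable_poisson (hb.abs_lt k hk)),
      integral_poisson (hb.abs_lt k hk)]
    simp

lemma Balanced.integrable_angleDensity_mul_log (hb : Balanced S z w) (ζ : ℂ) :
    Integrable (fun θ => angleDensity S z w θ * Real.log ‖circleMap 0 1 θ - ζ‖) angleMeasure := by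
  have h1 : ∀ k ∈ S, Integrable (fun θ => Real.log ‖circleMap 0 1 θ - ζ‖ -
      poissonKernel 0 (z k : ℂ) (circleMap 0 1 θ) * Real.log ‖circleMap 0 1 θ - ζ‖)
      angleMeasure := fun k hk => (integrable_log ζ).sub (integrable_poisson_log (hb.abs_lt k hk) ζ)
  refine ((integrable_log ζ).add ((integrable_finsetSum _ h1).const_mul w)).congr
    (ae_of_all _ fun θ => ?_)
  simp only [Pi.add_apply, angleDensity, Finset.sum_sub_distrib, ← Finset.sum_mul]
  simp
  ring

/-- Against the uniform measure the logarithm has mean zero for every `ζ` in the closed disc, so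
only the Poisson terms contribute. -/
lemma Balanced.integral_angleDensity_mul_log (hb : Balanced S z w) {ζ : ℂ} (hζ : ‖ζ‖ ≤ 1) :
    ∫ θ, angleDensity S z w θ * Real.log ‖circleMap 0 1 θ - ζ‖ ∂angleMeasure =
      -w * ∑ k ∈ S, Real.log ‖1 - (starRingEnd ℂ) ζ * z k‖ := by
  have h1 : ∀ k ∈ S, Integrable (fun θ => Real.log ‖circleMap 0 1 θ - ζ‖ -
      poissonKernel 0 (z k : ℂ) (circleMap 0 1 θ) * Real.log ‖circleMap 0 1 θ - ζ‖)
      angleMeasure := fun k hk => (integrable_log ζ).sub (integrable_poisson_log (hb.abs_lt k hk) ζ)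
  have h2 : ∀ θ, angleDensity S z w θ * Real.log ‖circleMap 0 1 θ - ζ‖ =
      Real.log ‖circleMap 0 1 θ - ζ‖ + w * ∑ k ∈ S, (Real.log ‖circleMap 0 1 θ - ζ‖ -
      poissonKernel 0 (z k : ℂ) (circleMap 0 1 θ) * Real.log ‖circleMap 0 1 θ - ζ‖) := by
    intro θ
    simp only [angleDensity, Finset.sum_sub_distrib, ← Finset.sum_mul]
    simp
    ring
  simp_rw [h2]
  rw [integral_add (integrable_log ζ) ((integrable_finsetSum _ h1).const_mul _), integral_log hζ,
    integral_const_mul, integral_finsetSum _ h1, neg_mul, zero_add, ← mul_neg,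
    ← Finset.sum_neg_distrib]
  congr 1
  refine Finset.sum_congr rfl fun k hk => ?_
  rw [integral_sub (integrable_log ζ) (integrable_poisson_log (hb.abs_lt k hk) ζ), integral_log hζ,
    zero_sub]
  have := integral_angleMeasure fun v => poissonKernel 0 (z k : ℂ) v * Real.log ‖v - ζ‖
  rw [this, circleAverage_poisson_log (hb.abs_lt k hk) hζ]

lemma Balanced.isProbabilityMeasure_withDensity (hb : Balanced S z w) :
    IsProbabilityMeasure
      (angleMeasure.withDensity (fun θ => ENNReal.ofReal (angleDensity S z w θ))) := by
  constructor
  rw [withDensity_apply _ MeasurableSet.univ, Measure.restrict_univ,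
    ← ofReal_integral_eq_lintegral_ofReal hb.integrable_angleDensity
      (ae_of_all _ hb.angleDensity_nonneg), hb.integral_angleDensity, ENNReal.ofReal_one]

lemma measurable_arcMap (c h : ℝ) : Measurable fun θ : ℝ => c + h * Real.cos θ := by fun_prop

lemma arcMap_mem {c h : ℝ} (hh : 0 < h) (θ : ℝ) :
    c + h * Real.cos θ ∈ Set.Icc (c - h) (c + h) :=
  ⟨by nlinarith [Real.neg_one_le_cos θ], by nlinarith [Real.cos_le_one θ]⟩

lemma arcMeasure_compl_Icc {c h : ℝ} (hh : 0 < h) :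
    arcMeasure S z w c h (Set.Icc (c - h) (c + h))ᶜ = 0 := by
  rw [arcMeasure, Measure.map_apply (measurable_arcMap c h) measurableSet_Icc.compl]
  convert measure_empty (μ := angleMeasure.withDensity _)
  ext θ
  simpa using arcMap_mem hh θ

lemma Balanced.isProbOnInterval (hb : Balanced S z w) {c h : ℝ} (hh : 0 < h)
    (h1 : -1 ≤ c - h) (h2 : c + h ≤ 1) : IsProbOnInterval (arcMeasure S z w c h) where
  prob := by
    have := hb.isProbabilityMeasure_withDensity
    exact Measure.isProbabilityMeasure_map (measurable_arcMap c h).aemeasurable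
  conc := measure_mono_null (Set.compl_subset_compl.2 (Set.Icc_subset_Icc h1 h2))
    (arcMeasure_compl_Icc hh)

lemma Balanced.support_arcMeasure (hb : Balanced S z w) {c h : ℝ} (hh : 0 < h) :
    (arcMeasure S z w c h).support = Set.Icc (c - h) (c + h) := by
  refine Set.Subset.antisymm
    (Measure.support_subset_of_isClosed isClosed_Icc (arcMeasure_compl_Icc hh)) ?_
  have key : Set.Ioo (c - h) (c + h) ⊆ (arcMeasure S z w c h).support := by
    intro x hx
    rw [Measure.mem_support_iff_forall]
    intro U hU
    obtain ⟨V, hVU, hVo, hxV⟩ := mem_nhds_iff.1 hU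
    refine lt_of_lt_of_le ?_ (measure_mono hVU)
    rw [arcMeasure, Measure.map_apply (measurable_arcMap c h) hVo.measurableSet]
    -- Angles in `(0, π)` suffice: the density is positive there since `sin θ > 0`, and `cos` maps
    -- this interval onto `(-1, 1)`.
    set O : Set ℝ := (fun θ : ℝ => c + h * Real.cos θ) ⁻¹' V ∩ Set.Ioo 0 Real.pi with hO
    have hOo : IsOpen O := (hVo.preimage (by fun_prop)).inter isOpen_Ioo
    have hOm : O ⊆ Set.Ioc 0 (2 * Real.pi) := fun θ hθ =>
      ⟨hθ.2.1, by linarith [hθ.2.2, Real.pi_pos]⟩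
    have hOn : O.Nonempty := by
      have hu1 : -1 < (x - c) / h := by rw [lt_div_iff₀ hh]; linarith [hx.1]
      have hu2 : (x - c) / h < 1 := by rw [div_lt_iff₀ hh]; linarith [hx.2]
      refine ⟨Real.arccos ((x - c) / h), ?_, Real.arccos_pos.2 hu2, ?_⟩
      · rw [Set.mem_preimage, Real.cos_arccos hu1.le hu2.le, mul_div_cancel₀ _ hh.ne']
        simpa using hxV
      · exact Real.arccos_lt_pi.2 hu1
    have hmeas : 0 < (angleMeasure.withDensity
        (fun θ => ENNReal.ofReal (angleDensity S z w θ))) O := by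
      rw [withDensity_apply _ hOo.measurableSet, setLIntegral_pos_iff
        (by exact hb.continuous_angleDensity.measurable.ennreal_ofReal)]
      have hsub : O ⊆ Function.support (fun θ => ENNReal.ofReal (angleDensity S z w θ)) ∩ O := by
        refine fun θ hθ => ⟨?_, hθ⟩
        have : 0 < Real.sin θ := Real.sin_pos_of_mem_Ioo hθ.2
        simpa using hb.angleDensity_pos this.ne'
      refine lt_of_lt_of_le ?_ (measure_mono hsub)
      rw [angleMeasure, Measure.smul_apply, Measure.restrict_apply hOo.measurableSet,
        Set.inter_eq_self_of_subset_left hOm, smul_eq_mul]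
      refine ENNReal.mul_pos ?_ (hOo.measure_pos volume hOn).ne'
      have := Real.pi_pos
      simp only [ne_eq, ENNReal.ofReal_eq_zero, not_le]
      positivity
    exact lt_of_lt_of_le hmeas (measure_mono Set.inter_subset_left)
  have := closure_minimal key Measure.isClosed_support
  rwa [closure_Ioo (by linarith)] at this

/-! ### Its logarithmic potential -/

lemma norm_circleMap_sub_conj (θ : ℝ) (ζ : ℂ) :
    ‖circleMap 0 1 θ - (starRingEnd ℂ) ζ‖ = ‖circleMap 0 1 (-θ) - ζ‖ := by
  rw [← RCLike.norm_conj]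
  congr 1
  simp [circleMap, ← Complex.exp_conj]

/-- In the Joukowski coordinate `x - c - h cos θ` factors as `h/(2ζ) · (e^(iθ) - ζ)(e^(-iθ) - ζ)`,
which splits its logarithm into two circle integrals. -/
lemma dist_arc_eq {c h x : ℝ} (hh : 0 < h) {ζ : ℂ} (h0 : ζ ≠ 0)
    (hx : (x : ℂ) = c + h * ((ζ + ζ⁻¹) / 2)) (θ : ℝ) :
    |x - (c + h * Real.cos θ)| = h / (2 * ‖ζ‖) * (‖circleMap 0 1 θ - ζ‖ *
      ‖circleMap 0 1 θ - (starRingEnd ℂ) ζ‖) := by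
  rw [norm_circleMap_sub_conj, ← norm_mul, ← Real.norm_eq_abs, ← Complex.norm_real]
  have h1 : ((x - (c + h * Real.cos θ) : ℝ) : ℂ) = (h : ℂ) / (2 * ζ) *
      ((circleMap 0 1 θ - ζ) * (circleMap 0 1 (-θ) - ζ)) := by
    push_cast
    rw [hx]
    have h2 : circleMap 0 1 θ * circleMap 0 1 (-θ) = 1 := by
      simp [circleMap, ← Complex.exp_add]
    have h3 : 2 * Complex.cos θ = circleMap 0 1 θ + circleMap 0 1 (-θ) := by
      simp [circleMap, Complex.two_cos]
    have h4 : (circleMap 0 1 θ - ζ) * (circleMap 0 1 (-θ) - ζ) =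
        1 - 2 * Complex.cos θ * ζ + ζ ^ 2 := by
      rw [h3]; linear_combination h2
    rw [h4]
    field_simp
    ring
  rw [h1, norm_mul, norm_div, norm_mul]
  simp [abs_of_pos hh]

/-- The logarithmic potential of `arcMeasure`. -/
lemma Balanced.lintegral_posKernel (hb : Balanced S z w) {c h x : ℝ} (hh : 0 < h)
    (h1 : -1 ≤ c - h) (h2 : c + h ≤ 1) (hx1 : x ∈ Set.Icc (-1 : ℝ) 1) {ζ : ℂ} (h0 : ζ ≠ 0)
    (hζ : ‖ζ‖ ≤ 1) (hx : (x : ℂ) = c + h * ((ζ + ζ⁻¹) / 2)) :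
    0 ≤ Real.log 2 - Real.log (h / (2 * ‖ζ‖)) + 2 * w * ∑ k ∈ S, Real.log ‖1 - ζ * z k‖ ∧
    ∫⁻ s, posKernel x s ∂(arcMeasure S z w c h) =
      ENNReal.ofReal (Real.log 2 - Real.log (h / (2 * ‖ζ‖)) +
        2 * w * ∑ k ∈ S, Real.log ‖1 - ζ * z k‖) := by
  set G : ℝ → ℝ := fun θ => angleDensity S z w θ *
    (Real.log 2 - Real.log |x - (c + h * Real.cos θ)|) with hG
  have hζ' : ‖(starRingEnd ℂ) ζ‖ ≤ 1 := by rwa [RCLike.norm_conj]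
  have hpos : 0 < h / (2 * ‖ζ‖) := by
    have := norm_pos_iff.2 h0
    positivity
  have hGae : G =ᵐ[angleMeasure] fun θ =>
      (Real.log 2 - Real.log (h / (2 * ‖ζ‖))) * angleDensity S z w θ -
        (angleDensity S z w θ * Real.log ‖circleMap 0 1 θ - ζ‖ +
         angleDensity S z w θ * Real.log ‖circleMap 0 1 θ - (starRingEnd ℂ) ζ‖) := by
    filter_upwards [ae_angleMeasure_circleMap_ne ζ,
      ae_angleMeasure_circleMap_ne ((starRingEnd ℂ) ζ)] with θ ha hb'
    have e1 : ‖circleMap 0 1 θ - ζ‖ ≠ 0 := norm_ne_zero_iff.2 (sub_ne_zero.2 ha)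
    have e2 : ‖circleMap 0 1 θ - (starRingEnd ℂ) ζ‖ ≠ 0 := norm_ne_zero_iff.2 (sub_ne_zero.2 hb')
    rw [hG]
    dsimp only
    rw [dist_arc_eq hh h0 hx, Real.log_mul hpos.ne' (mul_ne_zero e1 e2), Real.log_mul e1 e2]
    ring
  have hi1 := hb.integrable_angleDensity.const_mul (Real.log 2 - Real.log (h / (2 * ‖ζ‖)))
  have hi2 : Integrable (fun θ => angleDensity S z w θ * Real.log ‖circleMap 0 1 θ - ζ‖ +
         angleDensity S z w θ * Real.log ‖circleMap 0 1 θ - (starRingEnd ℂ) ζ‖) angleMeasure :=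
    (hb.integrable_angleDensity_mul_log ζ).add
    (hb.integrable_angleDensity_mul_log ((starRingEnd ℂ) ζ))
  have hGi : Integrable G angleMeasure := (hi1.sub hi2).congr hGae.symm
  have hval : ∫ θ, G θ ∂angleMeasure = Real.log 2 - Real.log (h / (2 * ‖ζ‖)) +
      2 * w * ∑ k ∈ S, Real.log ‖1 - ζ * z k‖ := by
    rw [integral_congr_ae hGae, integral_sub hi1 hi2, integral_const_mul, hb.integral_angleDensity,
      integral_add (hb.integrable_angleDensity_mul_log ζ)
      (hb.integrable_angleDensity_mul_log ((starRingEnd ℂ) ζ)),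
      hb.integral_angleDensity_mul_log hζ, hb.integral_angleDensity_mul_log hζ']
    have e : ∀ k, ‖1 - (starRingEnd ℂ) ζ * z k‖ = ‖1 - ζ * z k‖ := fun k => by
      rw [← RCLike.norm_conj]; simp
    simp_rw [Complex.conj_conj, e]
    ring
  -- The sign must be recorded, since `ENNReal.ofReal` would truncate a negative value. It comes
  -- from `|x - s| ≤ 2`; the convention `Real.log 0 = 0` covers coinciding points.
  have hG0 : ∀ θ, 0 ≤ G θ := by
    intro θ
    refine mul_nonneg (hb.angleDensity_nonneg θ) (sub_nonneg.2 ?_)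
    have hm := arcMap_mem (c := c) hh θ
    have h3 := abs_sub_le_two hx1 (⟨h1.trans hm.1, hm.2.trans h2⟩ :
      c + h * Real.cos θ ∈ Set.Icc (-1 : ℝ) 1)
    rcases (abs_nonneg (x - (c + h * Real.cos θ))).eq_or_lt with h4 | h4
    · rw [← h4, Real.log_zero]; exact Real.log_nonneg one_le_two
    · exact Real.log_le_log h4 h3
  rw [← hval]
  refine ⟨integral_nonneg hG0, ?_⟩
  have hmk : Measurable fun s => posKernel x s :=
    measurable_posKernel.comp (measurable_const.prodMk measurable_id)
  rw [arcMeasure, lintegral_map hmk (measurable_arcMap c h),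
    lintegral_withDensity_eq_lintegral_mul _
      (by exact hb.continuous_angleDensity.measurable.ennreal_ofReal)
      (by exact hmk.comp (measurable_arcMap c h)),
    ofReal_integral_eq_lintegral_ofReal hGi (ae_of_all _ hG0)]
  refine lintegral_congr_ae ?_
  filter_upwards [ae_angleMeasure_circleMap_ne ζ,
      ae_angleMeasure_circleMap_ne ((starRingEnd ℂ) ζ)] with θ ha hb'
  have e1 : ‖circleMap 0 1 θ - ζ‖ ≠ 0 := norm_ne_zero_iff.2 (sub_ne_zero.2 ha)
  have e2 : ‖circleMap 0 1 θ - (starRingEnd ℂ) ζ‖ ≠ 0 := norm_ne_zero_iff.2 (sub_ne_zero.2 hb')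
  have hne : x ≠ c + h * Real.cos θ := by
    intro he
    have := dist_arc_eq hh h0 hx θ
    rw [he, sub_self, abs_zero] at this
    exact (mul_ne_zero hpos.ne' (mul_ne_zero e1 e2)) this.symm
  simp only [Pi.mul_apply]
  rw [posKernel, if_neg hne, hG, ENNReal.ofReal_mul (hb.angleDensity_nonneg θ)]


/-! ### Reduction of the weighted energy to nonnegative integrals -/

/-- For `g ≥ -m` this is `(g + m) + g⁻ = g⁺ + m`, stated without subtraction so that infinite values
are harmless under integration. -/
lemma toENNReal_add_neg {m : ℝ} (hm : 0 ≤ m) {g : EReal} (hg : ((-m : ℝ) : EReal) ≤ g) :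
    (g + (m : EReal)).toENNReal + (-g).toENNReal = g.toENNReal + ENNReal.ofReal m := by
  induction g with
  | bot => exact absurd hg (by simp)
  | top => simp
  | coe r =>
    rw [← EReal.coe_add, ← EReal.coe_neg, EReal.toENNReal_of_ne_top (EReal.coe_ne_top _),
      EReal.toENNReal_of_ne_top (EReal.coe_ne_top _), EReal.toENNReal_of_ne_top (EReal.coe_ne_top _)]
    simp only [EReal.toReal_coe]
    have hr : -m ≤ r := EReal.coe_le_coe_iff.1 hg
    rcases le_total 0 r with h | h
    · rw [ENNReal.ofReal_of_nonpos (by linarith : -r ≤ 0), add_zero, ENNReal.ofReal_add h hm]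
    · rw [ENNReal.ofReal_of_nonpos h, zero_add, ← ENNReal.ofReal_add (by linarith) (by linarith)]
      congr 1; ring

/-- The lower bound makes the negative part integrable, so the defining difference is never `∞ - ∞`
and can be rearranged. -/
lemma extIntegral_eq {X : Type*} [MeasurableSpace X] {μ : Measure X} [IsProbabilityMeasure μ]
    {g : X → EReal} (hg : Measurable g) {m : ℝ} (hm : 0 ≤ m)
    (hge : ∀ᵐ x ∂μ, ((-m : ℝ) : EReal) ≤ g x) :
    extIntegral μ g = ((∫⁻ x, (g x + (m : EReal)).toENNReal ∂μ : ℝ≥0∞) : EReal) - (m : EReal) := by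
  have hadd : ∫⁻ x, (g x + (m : EReal)).toENNReal ∂μ + ∫⁻ x, (-g x).toENNReal ∂μ =
      ∫⁻ x, (g x).toENNReal ∂μ + ENNReal.ofReal m := by
    have hmeas : Measurable fun x => (-g x).toENNReal := hg.neg.ereal_toENNReal
    rw [← lintegral_add_right _ hmeas,
      lintegral_congr_ae (hge.mono fun x hx => toENNReal_add_neg hm hx),
      lintegral_add_right _ measurable_const]
    simp
  have hb : ∫⁻ x, (-g x).toENNReal ∂μ ≤ ENNReal.ofReal m := by
    calc ∫⁻ x, (-g x).toENNReal ∂μ ≤ ∫⁻ x, ENNReal.ofReal m ∂μ := by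
          refine lintegral_mono_ae (hge.mono fun x hx => ?_)
          have h0 : ENNReal.ofReal m = ((m : ℝ) : EReal).toENNReal := by
            rw [EReal.toENNReal_of_ne_top (EReal.coe_ne_top m), EReal.toReal_coe]
          rw [h0]
          refine EReal.toENNReal_le_toENNReal ?_
          rw [EReal.neg_le]
          simpa using hx
      _ = _ := by simp
  unfold extIntegral
  generalize ∫⁻ x, (g x + (m : EReal)).toENNReal ∂μ = a at *
  generalize ∫⁻ x, (-g x).toENNReal ∂μ = b at *
  generalize ∫⁻ x, (g x).toENNReal ∂μ = c at *
  lift b to NNReal using ne_top_of_le_ne_top ENNReal.ofReal_ne_top hb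
  by_cases hc : c = ⊤
  · subst hc
    have ha : a = ⊤ := by
      by_contra ha
      exact absurd hadd (by simp [ENNReal.add_eq_top, ha])
    subst ha
    simp
  · have ha : a ≠ ⊤ := by
      rintro rfl
      simp at hadd
      exact ENNReal.add_ne_top.2 ⟨hc, ENNReal.ofReal_ne_top⟩ hadd.symm
    lift c to NNReal using hc
    lift a to NNReal using ha
    have h : ((a : ℝ) + b) = c + m := by
      have := congrArg ENNReal.toReal hadd
      simpa [ENNReal.toReal_add, hm] using this
    rw [EReal.coe_nnreal_eq_coe_real, EReal.coe_nnreal_eq_coe_real, EReal.coe_nnreal_eq_coe_real,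
      ← EReal.coe_sub, ← EReal.coe_sub, EReal.coe_eq_coe_iff]
    linarith

/-- The weighted energy, shifted by a constant, as a nonnegative quantity. -/
def shiftedEnergy (v : ℝ → ℝ≥0∞) (ν : Measure ℝ) : ℝ≥0∞ :=
  mutualEnergy ν ν + ∫⁻ x, v x ∂ν

lemma logKernel_add_log_two (s t : ℝ) :
    (logKernel s t + (Real.log 2 : EReal)).toENNReal = posKernel s t := by
  unfold logKernel posKernel
  split_ifs with h
  · simp
  · rw [← EReal.coe_add, EReal.toENNReal_of_ne_top (EReal.coe_ne_top _), EReal.toReal_coe]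
    congr 1; ring

lemma neg_log_two_le_logKernel {s t : ℝ} (h : |s - t| ≤ 2) :
    ((-Real.log 2 : ℝ) : EReal) ≤ logKernel s t := by
  unfold logKernel
  split_ifs with hst
  · exact le_top
  · rw [EReal.coe_le_coe_iff, neg_le_neg_iff]
    exact Real.log_le_log (abs_pos.2 (sub_ne_zero.2 hst)) h

lemma measurable_logKernel : Measurable fun q : ℝ × ℝ => logKernel q.1 q.2 := by
  unfold logKernel
  refine Measurable.ite (measurableSet_eq_fun measurable_fst measurable_snd) measurable_const ?_
  exact measurable_coe_real_ereal.comp (by fun_prop)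

/-- The shifts are the lower bounds `-log 2` of the kernel on `[-1, 1]²` and `-m` of the potential.
Their sum is the same for all competitors, so the minimization can take place in `ℝ≥0∞`. -/
lemma weightedEnergy_eq {V : ℝ → EReal} (hV : Measurable V) {m : ℝ} (hm : 0 ≤ m)
    (hge : ∀ x ∈ Set.Icc (-1 : ℝ) 1, ((-m : ℝ) : EReal) ≤ V x) {ν : Measure ℝ}
    (hν : IsProbOnInterval ν) :
    weightedEnergy V ν =
      ((shiftedEnergy (fun x => (V x + (m : EReal)).toENNReal) ν : ℝ≥0∞) : EReal) -
        ((Real.log 2 + m : ℝ) : EReal) := by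
  have := hν.prob
  rw [weightedEnergy, extIntegral_eq measurable_logKernel (Real.log_nonneg one_le_two)
    ((hν.ae_prod hν).mono fun q hq => neg_log_two_le_logKernel (abs_sub_le_two hq.1 hq.2)),
    extIntegral_eq hV hm (hν.ae_mem.mono fun x hx => hge x hx)]
  simp_rw [logKernel_add_log_two]
  rw [shiftedEnergy, mutualEnergy]
  generalize ∫⁻ q, posKernel q.1 q.2 ∂(ν.prod ν) = a
  generalize ∫⁻ x, (V x + (m : EReal)).toENNReal ∂ν = b
  rw [EReal.coe_ennreal_add, EReal.coe_add, sub_eq_add_neg, sub_eq_add_neg, sub_eq_add_neg,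
    EReal.neg_add (by simp) (by simp), sub_eq_add_neg]
  exact add_add_add_comm _ _ _ _

lemma coe_sub_le_coe_sub_iff {a b : ℝ≥0∞} {r : ℝ} :
    (a : EReal) - (r : EReal) ≤ (b : EReal) - (r : EReal) ↔ a ≤ b := by
  rw [← EReal.coe_ennreal_le_coe_ennreal_iff]
  refine ⟨fun h => ?_, fun h => EReal.sub_le_sub h le_rfl⟩
  have := add_le_add_left h (r : EReal)
  simpa [EReal.sub_add_cancel] using this

/-- Equilibrium measures are the minimizers of the shifted energy. -/
lemma isEquilibriumMeasure_iff {V : ℝ → EReal} (hV : Measurable V) {m : ℝ} (hm : 0 ≤ m)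
    (hge : ∀ x ∈ Set.Icc (-1 : ℝ) 1, ((-m : ℝ) : EReal) ≤ V x) {ν : Measure ℝ} :
    IsEquilibriumMeasure V ν ↔ IsProbOnInterval ν ∧ ∀ ν', IsProbOnInterval ν' →
      shiftedEnergy (fun x => (V x + (m : EReal)).toENNReal) ν ≤
      shiftedEnergy (fun x => (V x + (m : EReal)).toENNReal) ν' := by
  constructor
  · rintro ⟨h1, h2⟩
    refine ⟨h1, fun ν' hν' => ?_⟩
    have := h2 ν' hν'
    rwa [weightedEnergy_eq hV hm hge h1, weightedEnergy_eq hV hm hge hν',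
      coe_sub_le_coe_sub_iff] at this
  · rintro ⟨h1, h2⟩
    refine ⟨h1, fun ν' hν' => ?_⟩
    rw [weightedEnergy_eq hV hm hge h1, weightedEnergy_eq hV hm hge hν', coe_sub_le_coe_sub_iff]
    exact h2 ν' hν'

/-! ### Sufficiency of the Euler-Lagrange conditions -/

lemma mutualEnergy_eq_lintegral {μ ν : Measure ℝ} [SFinite μ] [SFinite ν] :
    mutualEnergy μ ν = ∫⁻ x, ∫⁻ s, posKernel x s ∂ν ∂μ :=
  lintegral_prod _ measurable_posKernel.aemeasurable

/-- The Euler-Lagrange conditions imply that a measure is the unique minimizer. -/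
theorem shiftedEnergy_min_of_eulerLagrange {v : ℝ → ℝ≥0∞} (hv : Measurable v) {ν₀ : Measure ℝ}
    (h₀ : IsProbOnInterval ν₀) {c : ℝ≥0∞} (hc : c ≠ ⊤)
    (hge : ∀ x ∈ Set.Icc (-1 : ℝ) 1, c ≤ 2 * (∫⁻ s, posKernel x s ∂ν₀) + v x)
    (heq : ∀ᵐ x ∂ν₀, 2 * (∫⁻ s, posKernel x s ∂ν₀) + v x = c) :
    (∀ ν, IsProbOnInterval ν → shiftedEnergy v ν₀ ≤ shiftedEnergy v ν) ∧
    ∀ ν, IsProbOnInterval ν → shiftedEnergy v ν ≤ shiftedEnergy v ν₀ → ν = ν₀ := by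
  have := h₀.prob
  have hmu : Measurable fun x => ∫⁻ s, posKernel x s ∂ν₀ :=
    Measurable.lintegral_prod_right' measurable_posKernel
  have hW : ∀ ν, IsProbOnInterval ν → ∫⁻ x, (2 * (∫⁻ s, posKernel x s ∂ν₀) + v x) ∂ν =
      2 * mutualEnergy ν ν₀ + ∫⁻ x, v x ∂ν := by
    intro ν hν
    have := hν.prob
    rw [lintegral_add_right _ hv, lintegral_const_mul _ hmu, mutualEnergy_eq_lintegral]
  have hW0 : 2 * mutualEnergy ν₀ ν₀ + ∫⁻ x, v x ∂ν₀ = c := by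
    rw [← hW ν₀ h₀, lintegral_congr_ae heq]; simp
  have hWge : ∀ ν, IsProbOnInterval ν → c ≤ 2 * mutualEnergy ν ν₀ + ∫⁻ x, v x ∂ν := by
    intro ν hν
    have := hν.prob
    rw [← hW ν hν]
    calc c = ∫⁻ x, c ∂ν := by simp
      _ ≤ _ := lintegral_mono_ae (hν.ae_mem.mono fun x hx => hge x hx)
  have hfin : mutualEnergy ν₀ ν₀ ≠ ⊤ := by
    intro h
    rw [h] at hW0
    apply hc
    rw [← hW0]; simp
  -- With `I` the mutual energy and `E` the shifted one, the argument is the chain `E(ν₀) + I(ν₀,ν₀)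
  -- = c ≤ 2 I(ν,ν₀) + ∫ v dν ≤ E(ν) + I(ν₀,ν₀)`. The first inequality integrates the Euler-Lagrange
  -- inequality, the second is positive definiteness.
  have hsum : shiftedEnergy v ν₀ + mutualEnergy ν₀ ν₀ = c := by
    rw [← hW0, shiftedEnergy]; ring
  have hfin0 : shiftedEnergy v ν₀ ≠ ⊤ := by
    intro h
    rw [h] at hsum
    exact hc (by rw [← hsum]; simp)
  have hchain : ∀ ν, IsProbOnInterval ν → 2 * mutualEnergy ν ν₀ + ∫⁻ x, v x ∂ν ≤
      shiftedEnergy v ν + mutualEnergy ν₀ ν₀ := by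
    intro ν hν
    calc 2 * mutualEnergy ν ν₀ + ∫⁻ x, v x ∂ν
        ≤ (mutualEnergy ν ν + mutualEnergy ν₀ ν₀) + ∫⁻ x, v x ∂ν := by
          gcongr; exact two_mul_mutualEnergy_le hν h₀
      _ = _ := by rw [shiftedEnergy]; ring
  refine ⟨fun ν hν => ?_, fun ν hν hle => ?_⟩
  · have := (hsum.le.trans (hWge ν hν)).trans (hchain ν hν)
    exact (ENNReal.add_le_add_iff_right hfin).1 this
  · have hνfin : shiftedEnergy v ν ≠ ⊤ := ne_top_of_le_ne_top hfin0 hle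
    have hvfin : ∫⁻ x, v x ∂ν ≠ ⊤ := by
      intro h; exact hνfin (by rw [shiftedEnergy, h]; simp)
    -- If `ν` does at least as well as `ν₀`, the chain closes up; cancelling the finite `∫ v dν`
    -- leaves the equality case of positive definiteness.
    have hle2 : (mutualEnergy ν ν + mutualEnergy ν₀ ν₀) + ∫⁻ x, v x ∂ν ≤
        2 * mutualEnergy ν ν₀ + ∫⁻ x, v x ∂ν := by
      calc (mutualEnergy ν ν + mutualEnergy ν₀ ν₀) + ∫⁻ x, v x ∂ν
          = shiftedEnergy v ν + mutualEnergy ν₀ ν₀ := by rw [shiftedEnergy]; ring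
        _ ≤ shiftedEnergy v ν₀ + mutualEnergy ν₀ ν₀ := by gcongr
        _ = c := hsum
        _ ≤ _ := hWge ν hν
    have hle3 := (ENNReal.add_le_add_iff_right hvfin).1 hle2
    refine eq_of_mutualEnergy_le hν h₀ ?_ hle3
    intro htop
    have h1 := two_mul_mutualEnergy_le hν h₀
    rw [htop, ENNReal.mul_top two_ne_zero, top_le_iff, ENNReal.add_eq_top] at h1
    rcases h1 with h1 | h1
    · exact hνfin (by rw [shiftedEnergy, h1]; simp)
    · exact hfin h1


/-! ### Euler-Lagrange conditions for the explicit measure -/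

section

variable {ι : Type*} {S : Finset ι} {z y : ι → ℝ} {w : ℝ}

/-- The right-hand side is a fixed multiple of the summand of `Balanced.sum_zero`, hence disappears
after summation over the charges. Left minus right is `-(1 - ζ²)² x²` over positive factors. -/
lemma green_term_le {ζ x : ℝ} (h0 : 0 < ζ) (h1 : ζ ≤ 1) (hx : |x| < 1) (hxζ : x < ζ) :
    (1 + x ^ 2) / (1 - x ^ 2) - ζ * x / (1 - ζ * x) - ζ / (ζ - x) ≤
      -((1 + ζ ^ 2) / ζ) * (x / (1 - x ^ 2)) := by
  have e1 := one_sub_sq_pos hx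
  have hx' := _root_.abs_lt.1 hx
  have e2 : 0 < 1 - ζ * x := by nlinarith
  have e3 : 0 < ζ - x := sub_pos.2 hxζ
  have key : (1 + x ^ 2) / (1 - x ^ 2) - ζ * x / (1 - ζ * x) - ζ / (ζ - x) -
      -((1 + ζ ^ 2) / ζ) * (x / (1 - x ^ 2)) =
      -((1 - ζ ^ 2) ^ 2 * x ^ 2 / (ζ * (1 - x ^ 2) * (1 - ζ * x) * (ζ - x))) := by
    have f1 := e1.ne'
    have f2 : 1 - x * ζ ≠ 0 := by rw [mul_comm]; exact e2.ne'
    have f3 := e3.ne'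
    have f0 := h0.ne'
    field_simp
    ring
  have : 0 ≤ (1 - ζ ^ 2) ^ 2 * x ^ 2 / (ζ * (1 - x ^ 2) * (1 - ζ * x) * (ζ - x)) := by positivity
  linarith

/-- The effective potential is at least its value on the support, to the right of the support. -/
lemma Balanced.green_nonneg (hb : Balanced S z w) {ζ : ℝ} (h0 : 0 < ζ) (h1 : ζ ≤ 1)
    (hz : ∀ k ∈ S, z k < ζ) :
    0 ≤ 2 * (1 + S.card * w) * Real.log ζ +
      2 * w * ∑ k ∈ S, (Real.log (1 - ζ * z k) - Real.log (ζ - z k)) := by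
  -- `F` vanishes at `t = 1`, so it is enough that `F` decreases on `[ζ, 1]`.
  set F : ℝ → ℝ := fun t => 2 * (1 + S.card * w) * Real.log t +
      2 * w * ∑ k ∈ S, (Real.log (1 - t * z k) - Real.log (t - z k)) with hF
  have hd : ∀ t ∈ Set.Icc ζ 1, HasDerivAt F (2 * (1 + S.card * w) * t⁻¹ +
      2 * w * ∑ k ∈ S, (-z k / (1 - t * z k) - 1 / (t - z k))) t := by
    intro t ht
    have ht0 : 0 < t := h0.trans_le ht.1
    refine ((Real.hasDerivAt_log ht0.ne').const_mul _).add
      ((HasDerivAt.fun_sum fun k hk => ?_).const_mul _)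
    have hz1 := _root_.abs_lt.1 (hb.abs_lt k hk)
    have e2 : 1 - t * z k ≠ 0 := by nlinarith [ht.2]
    have e3 : t - z k ≠ 0 := by have := hz k hk; have := ht.1; intro h; linarith
    have a1 : HasDerivAt (fun t : ℝ => 1 - t * z k) (-z k) t := by
      simpa using ((hasDerivAt_id t).mul_const (z k)).const_sub 1
    have a2 : HasDerivAt (fun t : ℝ => t - z k) 1 t := (hasDerivAt_id t).sub_const _
    exact (a1.log e2).sub (a2.log e3)
  have hanti : AntitoneOn F (Set.Icc ζ 1) := by
    refine antitoneOn_of_deriv_nonpos (convex_Icc _ _)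
      (fun t ht => (hd t ht).continuousAt.continuousWithinAt)
      (fun t ht => (hd t (interior_subset ht)).differentiableAt.differentiableWithinAt)
      (fun t ht => ?_)
    have ht' := interior_subset ht
    rw [(hd t ht').deriv]
    have ht0 : 0 < t := h0.trans_le ht'.1
    have hw := hb.w_pos
    -- This form of `sum_one` distributes the coefficient `1 + |S| w` of the leading logarithm over
    -- the individual charges.
    have hsum : ∑ k ∈ S, (1 + z k ^ 2) / (1 - z k ^ 2) = S.card + 1 / w := by
      have h2 : ∑ k ∈ S, 2 * z k ^ 2 / (1 - z k ^ 2) = 1 / w := by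
        rw [eq_div_iff hw.ne', mul_comm]; exact hb.sum_one
      rw [← h2, Finset.card_eq_sum_ones, Nat.cast_sum, ← Finset.sum_add_distrib]
      refine Finset.sum_congr rfl fun k hk => ?_
      have := (one_sub_sq_pos (hb.abs_lt k hk)).ne'
      field_simp
      push_cast
      ring
    have hle : ∑ k ∈ S, ((1 + z k ^ 2) / (1 - z k ^ 2) - t * z k / (1 - t * z k) -
        t / (t - z k)) ≤ 0 := by
      calc _ ≤ ∑ k ∈ S, -((1 + t ^ 2) / t) * (z k / (1 - z k ^ 2)) :=
            Finset.sum_le_sum fun k hk => green_term_le ht0 ht'.2 (hb.abs_lt k hk)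
              ((hz k hk).trans_le ht'.1)
        _ = 0 := by rw [← Finset.mul_sum, hb.sum_zero, mul_zero]
    have hid : 2 * (1 + S.card * w) * t⁻¹ +
        2 * w * ∑ k ∈ S, (-z k / (1 - t * z k) - 1 / (t - z k)) =
        2 * w / t * ∑ k ∈ S, ((1 + z k ^ 2) / (1 - z k ^ 2) - t * z k / (1 - t * z k) -
        t / (t - z k)) := by
      have : ∑ k ∈ S, ((1 + z k ^ 2) / (1 - z k ^ 2) - t * z k / (1 - t * z k) -
          t / (t - z k)) = (S.card + 1 / w) +
          t * ∑ k ∈ S, (-z k / (1 - t * z k) - 1 / (t - z k)) := by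
        rw [← hsum, Finset.mul_sum, ← Finset.sum_add_distrib]
        refine Finset.sum_congr rfl fun k hk => ?_
        ring
      rw [this]
      field_simp
      ring
    rw [hid]
    exact mul_nonpos_of_nonneg_of_nonpos (by positivity) hle
  have := hanti ⟨le_rfl, h1⟩ ⟨h1, le_rfl⟩ h1
  refine le_trans (le_of_eq ?_) this
  simp [hF]

/-- Reflection of the line, which reduces the region left of the support to the region right of it.
-/
lemma Balanced.neg (hb : Balanced S z w) : Balanced S (fun k => -z k) w where
  w_pos := hb.w_pos
  ne_zero k hk := neg_ne_zero.2 (hb.ne_zero k hk)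
  abs_lt k hk := by simpa using hb.abs_lt k hk
  sum_zero := by
    have := hb.sum_zero
    simp only [even_two, Even.neg_pow, neg_div, Finset.sum_neg_distrib, this, neg_zero]
  sum_one := by simpa using hb.sum_one

/-- The potential `-2 w ∑ log |x - y_k|`, with value `∞` at the charges. -/
def chargePotential (S : Finset ι) (y : ι → ℝ) (w x : ℝ) : EReal :=
  open Classical in
  if ∃ k ∈ S, x = y k then ⊤ else ((-(2 * w) * ∑ k ∈ S, Real.log |x - y k| : ℝ) : EReal)

lemma measurable_chargePotential : Measurable (chargePotential S y w) := by
  classical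
  unfold chargePotential
  refine Measurable.ite ?_ measurable_const (measurable_coe_real_ereal.comp ?_)
  · have : {x | ∃ k ∈ S, x = y k} = (y '' S) := by
      ext x; simp [eq_comm]
    rw [this]
    exact (S.finite_toSet.image y).measurableSet
  · exact measurable_const.mul (Finset.measurable_sum _ fun k _ => by fun_prop)

/-- A lower bound for `chargePotential` on `[-1, 1]` is minus this number. -/
def chargeBound (S : Finset ι) (y : ι → ℝ) (w : ℝ) : ℝ := 2 * w * ∑ k ∈ S, Real.log (1 + |y k|)

lemma chargeBound_nonneg (hw : 0 < w) : 0 ≤ chargeBound S y w :=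
  mul_nonneg (by positivity) (Finset.sum_nonneg fun k _ =>
    Real.log_nonneg (by linarith [abs_nonneg (y k)]))

lemma sum_log_le_chargeBound (hw : 0 < w) {x : ℝ} (hx : x ∈ Set.Icc (-1 : ℝ) 1)
    (hne : ¬ ∃ k ∈ S, x = y k) :
    0 ≤ -(2 * w) * ∑ k ∈ S, Real.log |x - y k| + chargeBound S y w := by
  have : ∑ k ∈ S, Real.log |x - y k| ≤ ∑ k ∈ S, Real.log (1 + |y k|) := by
    refine Finset.sum_le_sum fun k hk => Real.log_le_log ?_ ?_
    · exact abs_pos.2 (sub_ne_zero.2 fun h => hne ⟨k, hk, h⟩)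
    · exact (abs_sub _ _).trans (by linarith [abs_le.2 ⟨hx.1, hx.2⟩])
  unfold chargeBound
  nlinarith

lemma neg_chargeBound_le (hw : 0 < w) {x : ℝ} (hx : x ∈ Set.Icc (-1 : ℝ) 1) :
    ((-chargeBound S y w : ℝ) : EReal) ≤ chargePotential S y w x := by
  unfold chargePotential
  split_ifs with h
  · exact le_top
  · rw [EReal.coe_le_coe_iff]
    linarith [sum_log_le_chargeBound hw hx h]

lemma toENNReal_chargePotential {x : ℝ} (hne : ¬ ∃ k ∈ S, x = y k) (m : ℝ) :
    (chargePotential S y w x + (m : EReal)).toENNReal =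
      ENNReal.ofReal (-(2 * w) * ∑ k ∈ S, Real.log |x - y k| + m) := by
  rw [chargePotential, if_neg hne, ← EReal.coe_add,
    EReal.toENNReal_of_ne_top (EReal.coe_ne_top _), EReal.toReal_coe]

lemma exists_joukowski {u : ℝ} (hu : 1 < u) :
    ∃ ζ : ℝ, 0 < ζ ∧ ζ < 1 ∧ u = (ζ + ζ⁻¹) / 2 := by
  have h1 : 0 < u ^ 2 - 1 := by nlinarith
  have h2 := Real.sqrt_pos.2 h1
  have h3 := Real.sq_sqrt h1.le
  have h4 : Real.sqrt (u ^ 2 - 1) < u := by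
    rw [Real.sqrt_lt' (by linarith)]; linarith
  refine ⟨u - Real.sqrt (u ^ 2 - 1), by linarith, ?_, ?_⟩
  · by_contra hc
    have : Real.sqrt (u ^ 2 - 1) ≤ u - 1 := by linarith
    nlinarith
  · have : (u - Real.sqrt (u ^ 2 - 1))⁻¹ = u + Real.sqrt (u ^ 2 - 1) := by
      refine inv_eq_of_mul_eq_one_right ?_
      nlinarith
    rw [this]; ring

lemma dist_charge_eq {c h x b : ℝ} (hh : 0 < h) {ζ : ℂ} {t : ℝ} (h0 : ζ ≠ 0) (ht : t ≠ 0)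
    (hx : (x : ℂ) = c + h * ((ζ + ζ⁻¹) / 2)) (hb : b = c + h * ((t + t⁻¹) / 2)) :
    |x - b| = h * (‖ζ - t‖ * ‖1 - ζ * t‖) / (2 * ‖ζ‖ * |t|) := by
  rw [← Real.norm_eq_abs, ← Complex.norm_real, ← Real.norm_eq_abs t, ← Complex.norm_real t]
  have ht' : (t : ℂ) ≠ 0 := by exact_mod_cast ht
  have : ((x - b : ℝ) : ℂ) = -(h * ((ζ - t) * (1 - ζ * t)) / (2 * ζ * t)) := by
    push_cast
    rw [hx, hb]
    push_cast
    field_simp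
    ring
  rw [this, norm_neg, norm_div, norm_mul, norm_mul, norm_mul, norm_mul]
  simp [abs_of_pos hh]

/-- The effective potential in the conformal coordinate. -/
lemma Balanced.effective_eq (hb : Balanced S z w) {c h x : ℝ} (hh : 0 < h)
    (hy : ∀ k ∈ S, y k = c + h * ((z k + (z k)⁻¹) / 2)) {ζ : ℂ} (h0 : ζ ≠ 0)
    (hx : (x : ℂ) = c + h * ((ζ + ζ⁻¹) / 2)) (hne : ¬ ∃ k ∈ S, x = y k) :
    2 * (Real.log 2 - Real.log (h / (2 * ‖ζ‖)) + 2 * w * ∑ k ∈ S, Real.log ‖1 - ζ * z k‖) +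
      -(2 * w) * ∑ k ∈ S, Real.log |x - y k| =
    (2 * Real.log 2 - 2 * Real.log (h / 2) - 2 * w * ∑ k ∈ S,
      (Real.log (h / 2) - Real.log |z k|)) +
    (2 * (1 + S.card * w) * Real.log ‖ζ‖ +
      2 * w * ∑ k ∈ S, (Real.log ‖1 - ζ * z k‖ - Real.log ‖ζ - z k‖)) := by
  have hζ := norm_pos_iff.2 h0
  have h1 : ∀ k ∈ S, Real.log |x - y k| = Real.log (h / 2) + Real.log ‖ζ - z k‖ +
      Real.log ‖1 - ζ * z k‖ - Real.log ‖ζ‖ - Real.log |z k| := by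
    intro k hk
    have hd := dist_charge_eq hh h0 (hb.ne_zero k hk) hx (hy k hk)
    have hpos : 0 < |x - y k| := abs_pos.2 (sub_ne_zero.2 fun h => hne ⟨k, hk, h⟩)
    have hzk := abs_pos.2 (hb.ne_zero k hk)
    have e1 : ‖ζ - z k‖ ≠ 0 := by
      intro h; rw [hd, h] at hpos; simp at hpos
    have e2 : ‖1 - ζ * z k‖ ≠ 0 := by
      intro h; rw [hd, h] at hpos; simp at hpos
    rw [hd, show h * (‖ζ - z k‖ * ‖1 - ζ * z k‖) / (2 * ‖ζ‖ * |z k|) =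
      h / 2 * ‖ζ - z k‖ * ‖1 - ζ * z k‖ / ‖ζ‖ / |z k| by field_simp,
      Real.log_div (by positivity) hzk.ne', Real.log_div (by positivity) hζ.ne',
      Real.log_mul (by positivity) e2, Real.log_mul (by positivity) e1]
  rw [Finset.sum_congr rfl h1, show h / (2 * ‖ζ‖) = h / 2 / ‖ζ‖ by field_simp,
    Real.log_div (by positivity) hζ.ne']
  simp only [Finset.sum_sub_distrib, Finset.sum_add_distrib, Finset.sum_const, nsmul_eq_mul]
  ring

/-- The equilibrium measure of a balanced configuration of charges outside `(-1, 1)` is the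
explicit measure, and it is unique. -/
theorem Balanced.equilibrium (hb : Balanced S z w) {c h : ℝ} (hh : 0 < h) (hl : -1 < c - h)
    (hr : c + h < 1) (hy : ∀ k ∈ S, y k = c + h * ((z k + (z k)⁻¹) / 2))
    (hy1 : ∀ k ∈ S, 1 ≤ |y k|) :
    IsEquilibriumMeasure (chargePotential S y w) (arcMeasure S z w c h) ∧
    ∀ ν, IsEquilibriumMeasure (chargePotential S y w) ν → ν = arcMeasure S z w c h := by
  have hw := hb.w_pos
  set m := chargeBound S y w with hm
  have hm0 : 0 ≤ m := chargeBound_nonneg hw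
  -- The Euler-Lagrange constant: the part of `Balanced.effective_eq` independent of `ζ`, plus the
  -- shift `m` that makes the potential nonnegative.
  set C : ℝ := (2 * Real.log 2 - 2 * Real.log (h / 2) - 2 * w * ∑ k ∈ S,
      (Real.log (h / 2) - Real.log |z k|)) + m with hC
  have hP := hb.isProbOnInterval hh hl.le hr.le
  set v : ℝ → ℝ≥0∞ := fun x => (chargePotential S y w x + (m : EReal)).toENNReal with hv
  have hvm : Measurable v := (measurable_chargePotential.add_const _).ereal_toENNReal
  have hval : ∀ x ∈ Set.Icc (-1 : ℝ) 1, (¬ ∃ k ∈ S, x = y k) → ∀ ζ : ℂ, ζ ≠ 0 → ‖ζ‖ ≤ 1 →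
      (x : ℂ) = c + h * ((ζ + ζ⁻¹) / 2) →
      2 * (∫⁻ s, posKernel x s ∂(arcMeasure S z w c h)) + v x =
      ENNReal.ofReal (C + (2 * (1 + S.card * w) * Real.log ‖ζ‖ +
      2 * w * ∑ k ∈ S, (Real.log ‖1 - ζ * z k‖ - Real.log ‖ζ - z k‖))) := by
    intro x hx hne ζ h0 hζ hxζ
    obtain ⟨p1, p2⟩ := hb.lintegral_posKernel hh hl.le hr.le hx h0 hζ hxζ
    rw [p2, hv]
    dsimp only
    rw [toENNReal_chargePotential hne, show (2 : ℝ≥0∞) = ENNReal.ofReal 2 by simp,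
      ← ENNReal.ofReal_mul zero_le_two, ← ENNReal.ofReal_add (by positivity)
      (sum_log_le_chargeBound hw hx hne), ← add_assoc, hb.effective_eq hh hy h0 hxζ hne, hC]
    congr 1
    ring
  -- On the support `ζ` is on the unit circle, where `log |ζ| = 0` and `|ζ - z_k| = |1 - ζ z_k|` for
  -- real `z_k`, so the effective potential equals `C`.
  have hin : ∀ x ∈ Set.Icc (c - h) (c + h),
      2 * (∫⁻ s, posKernel x s ∂(arcMeasure S z w c h)) + v x = ENNReal.ofReal C := by
    intro x hx
    have hx1 : x ∈ Set.Icc (-1 : ℝ) 1 := ⟨hl.le.trans hx.1, hx.2.trans hr.le⟩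
    have hne : ¬ ∃ k ∈ S, x = y k := by
      rintro ⟨k, hk, rfl⟩
      have : |y k| < 1 := _root_.abs_lt.2 ⟨hl.trans_le hx.1, hx.2.trans_lt hr⟩
      linarith [hy1 k hk]
    have hu1 : -1 ≤ (x - c) / h := by rw [le_div_iff₀ hh]; linarith [hx.1]
    have hu2 : (x - c) / h ≤ 1 := by rw [div_le_iff₀ hh]; linarith [hx.2]
    set φ := Real.arccos ((x - c) / h) with hφ
    have hcos : x = c + h * Real.cos φ := by
      rw [hφ, Real.cos_arccos hu1 hu2, mul_div_cancel₀ _ hh.ne']; ring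
    set ζ := circleMap 0 1 φ with hζd
    have hζn : ‖ζ‖ = 1 := by simp [hζd]
    have hζ0 : ζ ≠ 0 := by rw [← norm_ne_zero_iff, hζn]; exact one_ne_zero
    have hxζ : (x : ℂ) = c + h * ((ζ + ζ⁻¹) / 2) := by
      have h2 : ζ⁻¹ = circleMap 0 1 (-φ) := by
        simp [hζd, circleMap, ← Complex.exp_neg]
      rw [h2, hcos]
      push_cast
      simp only [hζd, circleMap, Complex.cos]
      simp
    rw [hval x hx1 hne ζ hζ0 hζn.le hxζ, hζn, Real.log_one, mul_zero, zero_add,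
      Finset.sum_eq_zero, mul_zero, add_zero]
    intro k _
    rw [sub_eq_zero]
    congr 1
    have h3 : ζ - z k = ζ * (starRingEnd ℂ) (1 - ζ * z k) := by
      rw [map_sub, map_one, map_mul, Complex.conj_ofReal, mul_sub, ← mul_assoc, Complex.mul_conj,
        Complex.normSq_eq_norm_sq, hζn]
      simp
    rw [h3, norm_mul, hζn, one_mul, RCLike.norm_conj]
  have hle : ∀ x ∈ Set.Icc (-1 : ℝ) 1,
      ENNReal.ofReal C ≤ 2 * (∫⁻ s, posKernel x s ∂(arcMeasure S z w c h)) + v x := by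
    intro x hx
    by_cases hne : ∃ k ∈ S, x = y k
    · have : v x = ⊤ := by
        rw [hv]
        dsimp only
        rw [chargePotential, if_pos hne, EReal.top_add_coe, EReal.toENNReal_top]
      rw [this]; simp
    by_cases hmem : x ∈ Set.Icc (c - h) (c + h)
    · exact (hin x hmem).ge
    rcases lt_or_ge (c + h) x with hxr | hxr
    · obtain ⟨ζ, a1, a2, a3⟩ := exists_joukowski (u := (x - c) / h)
        (by rw [lt_div_iff₀ hh]; linarith)
      have hx' : x = c + h * ((ζ + ζ⁻¹) / 2) := by
        rw [← a3, mul_div_cancel₀ _ hh.ne']; ring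
      -- No charge lies between the support and `x`. If `z k ≥ ζ`, then `c + h ≤ y k ≤ x`; as `c + h
      -- > -1`, the bound `|y k| ≥ 1` forces `y k ≥ 1 ≥ x`, so `x` would be a charge.
      have hlt : ∀ k ∈ S, z k < ζ := by
        intro k hk
        rcases lt_or_ge (z k) 0 with hz | hz
        · exact hz.trans a1
        have hz0 : 0 < z k := lt_of_le_of_ne hz (hb.ne_zero k hk).symm
        have hz1 := (_root_.abs_lt.1 (hb.abs_lt k hk)).2
        by_contra hc
        have hc' : ζ ≤ z k := not_lt.1 hc
        have b1 : z k + (z k)⁻¹ ≤ ζ + ζ⁻¹ := by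
          have : ζ + ζ⁻¹ - (z k + (z k)⁻¹) = (z k - ζ) * (1 - ζ * z k) / (ζ * z k) := by
            field_simp; ring
          have : 0 ≤ (z k - ζ) * (1 - ζ * z k) / (ζ * z k) :=
            div_nonneg (mul_nonneg (by linarith) (by nlinarith)) (by positivity)
          linarith
        have b2 : y k ≤ x := by
          rw [hy k hk, hx']; gcongr
        have b3 : c + h ≤ y k := by
          rw [hy k hk]
          have : 1 ≤ (z k + (z k)⁻¹) / 2 := by
            have : (z k + (z k)⁻¹) / 2 - 1 = (1 - z k) ^ 2 / (2 * z k) := by field_simp; ring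
            have : 0 ≤ (1 - z k) ^ 2 / (2 * z k) := by positivity
            linarith
          nlinarith
        have b4 : 1 ≤ y k := by
          rcases le_abs.1 (hy1 k hk) with h | h
          · exact h
          · linarith
        exact hne ⟨k, hk, le_antisymm (hx.2.trans b4) b2⟩
      have hζ0 : (ζ : ℂ) ≠ 0 := by exact_mod_cast a1.ne'
      rw [hval x hx hne ζ hζ0 (by rw [Complex.norm_real, Real.norm_eq_abs, abs_of_pos a1]; exact a2.le)
        (by rw [hx']; push_cast; rfl)]
      refine ENNReal.ofReal_le_ofReal ?_
      have hg := hb.green_nonneg a1 a2.le hlt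
      have e : ∑ k ∈ S, (Real.log ‖1 - (ζ : ℂ) * z k‖ - Real.log ‖(ζ : ℂ) - z k‖) =
          ∑ k ∈ S, (Real.log (1 - ζ * z k) - Real.log (ζ - z k)) := by
        refine Finset.sum_congr rfl fun k hk => ?_
        rw [← Complex.ofReal_mul, ← Complex.ofReal_sub, ← Complex.ofReal_one, ← Complex.ofReal_sub,
          Complex.norm_real, Complex.norm_real, Real.norm_eq_abs, Real.norm_eq_abs, Real.log_abs,
          Real.log_abs]
      rw [e, Complex.norm_real, Real.norm_eq_abs, abs_of_pos a1]
      linarith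
    · have hxl : x < c - h := by
        by_contra hc; exact hmem ⟨not_lt.1 hc, hxr⟩
      obtain ⟨ζ, a1, a2, a3⟩ := exists_joukowski (u := (c - x) / h)
        (by rw [lt_div_iff₀ hh]; linarith)
      have hx' : x = c - h * ((ζ + ζ⁻¹) / 2) := by
        rw [← a3, mul_div_cancel₀ _ hh.ne']; ring
      have hlt : ∀ k ∈ S, -z k < ζ := by
        intro k hk
        rcases lt_or_ge 0 (z k) with hz | hz
        · linarith
        have hz0 : z k < 0 := lt_of_le_of_ne hz (hb.ne_zero k hk)
        have hz1 := (_root_.abs_lt.1 (hb.abs_lt k hk)).1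
        by_contra hc
        have hc' : ζ ≤ -z k := not_lt.1 hc
        have b1 : -(z k + (z k)⁻¹) ≤ ζ + ζ⁻¹ := by
          have : ζ + ζ⁻¹ + (z k + (z k)⁻¹) = (-z k - ζ) * (1 + ζ * z k) / (ζ * -z k) := by
            have := hz0.ne
            field_simp; ring
          have : 0 ≤ (-z k - ζ) * (1 + ζ * z k) / (ζ * -z k) :=
            div_nonneg (mul_nonneg (by linarith) (by nlinarith))
              (mul_nonneg a1.le (by linarith))
          linarith
        have b2 : x ≤ y k := by
          rw [hy k hk, hx']
          nlinarith
        have b3 : y k ≤ c - h := by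
          rw [hy k hk]
          have : (z k + (z k)⁻¹) / 2 ≤ -1 := by
            have : (z k + (z k)⁻¹) / 2 + 1 = -((1 + z k) ^ 2 / (2 * -z k)) := by
              have := hz0.ne
              field_simp; ring
            have : 0 ≤ (1 + z k) ^ 2 / (2 * -z k) := div_nonneg (sq_nonneg _) (by linarith)
            linarith
          nlinarith
        have b4 : y k ≤ -1 := by
          rcases le_abs.1 (hy1 k hk) with h | h
          · linarith
          · linarith
        exact hne ⟨k, hk, le_antisymm b2 (b4.trans hx.1)⟩
      -- Left of the support the coordinate is `-ζ`, and the inequality is `green_nonneg` for the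
      -- reflected charges.
      have hζ0 : ((-ζ : ℝ) : ℂ) ≠ 0 := by
        rw [Complex.ofReal_ne_zero]; linarith
      have hn : ‖((-ζ : ℝ) : ℂ)‖ = ζ := by
        rw [Complex.norm_real, Real.norm_eq_abs, abs_neg, abs_of_pos a1]
      rw [hval x hx hne ((-ζ : ℝ) : ℂ) hζ0 (by rw [hn]; exact a2.le)
        (by rw [hx']; push_cast; rw [inv_neg]; ring)]
      refine ENNReal.ofReal_le_ofReal ?_
      have hg := hb.neg.green_nonneg a1 a2.le hlt
      have e : ∑ k ∈ S, (Real.log ‖1 - ((-ζ : ℝ) : ℂ) * z k‖ - Real.log ‖((-ζ : ℝ) : ℂ) - z k‖) =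
          ∑ k ∈ S, (Real.log (1 - ζ * -z k) - Real.log (ζ - -z k)) := by
        refine Finset.sum_congr rfl fun k hk => ?_
        rw [← Complex.ofReal_mul, ← Complex.ofReal_sub, ← Complex.ofReal_one, ← Complex.ofReal_sub,
          Complex.norm_real, Complex.norm_real, Real.norm_eq_abs, Real.norm_eq_abs, Real.log_abs,
          Real.log_abs, show -ζ - z k = -(ζ - -z k) by ring, Real.log_neg_eq_log]
        congr 2; ring
      rw [e, hn]
      linarith
  have hae : ∀ᵐ x ∂(arcMeasure S z w c h),
      2 * (∫⁻ s, posKernel x s ∂(arcMeasure S z w c h)) + v x = ENNReal.ofReal C :=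
    Filter.Eventually.mono (show ∀ᵐ x ∂(arcMeasure S z w c h), x ∈ Set.Icc (c - h) (c + h) from
      arcMeasure_compl_Icc hh) hin
  obtain ⟨q1, q2⟩ := shiftedEnergy_min_of_eulerLagrange hvm hP ENNReal.ofReal_ne_top hle hae
  have hiff : ∀ {ν}, IsEquilibriumMeasure (chargePotential S y w) ν ↔ _ := fun {ν} =>
    isEquilibriumMeasure_iff (ν := ν) measurable_chargePotential hm0
      (fun x hx => neg_chargeBound_le hw hx)
  refine ⟨hiff.2 ⟨hP, q1⟩, fun ν hν => ?_⟩
  obtain ⟨r1, r2⟩ := hiff.1 hν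
  exact q2 ν r1 (r2 _ hP)

end


/-! ### Existence of the endpoints -/

section

variable {ι : Type*} {S : Finset ι} {y : ι → ℝ} {w : ℝ}

/-- The Mhaskar-Saff functional of the interval `[a, b]`, up to constants. -/
def endpointFunctional (S : Finset ι) (y : ι → ℝ) (w a b : ℝ) : ℝ :=
  Real.log (b - a) + 2 * w * ∑ k ∈ S, Real.log (Real.sqrt |y k - a| + Real.sqrt |y k - b|)

lemma sqrt_add_sqrt_pos {a b t : ℝ} (h : a < b) : 0 < Real.sqrt |t - a| + Real.sqrt |t - b| := by
  by_contra hc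
  have h1 := Real.sqrt_nonneg |t - a|
  have h2 := Real.sqrt_nonneg |t - b|
  have h3 : Real.sqrt |t - a| = 0 := by linarith
  have h4 : Real.sqrt |t - b| = 0 := by linarith
  rw [Real.sqrt_eq_zero (abs_nonneg _), abs_eq_zero] at h3 h4
  linarith

/-- The exponential of the functional extends continuously to the closed triangle `-1 ≤ a ≤ b ≤ 1`
and vanishes on the diagonal, so its maximum is attained off the diagonal. -/
lemma exists_max_endpointFunctional (hw : 0 < w) :
    ∃ a b : ℝ, -1 ≤ a ∧ a < b ∧ b ≤ 1 ∧ ∀ a' b' : ℝ, -1 ≤ a' → a' < b' → b' ≤ 1 →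
      endpointFunctional S y w a' b' ≤ endpointFunctional S y w a b := by
  set G : ℝ × ℝ → ℝ := fun p => (p.2 - p.1) *
    ∏ k ∈ S, (Real.sqrt |y k - p.1| + Real.sqrt |y k - p.2|) ^ (2 * w) with hG
  have hGc : Continuous G := by
    refine Continuous.mul (by fun_prop) (continuous_finsetProd _ fun k _ => ?_)
    exact Continuous.rpow_const (by fun_prop) fun p => Or.inr (by positivity)
  have hlog : ∀ a b : ℝ, a < b → 0 < G (a, b) ∧
      Real.log (G (a, b)) = endpointFunctional S y w a b := by
    intro a b hab
    have hpos : ∀ k ∈ S, 0 < (Real.sqrt |y k - a| + Real.sqrt |y k - b|) ^ (2 * w) := fun k _ =>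
      Real.rpow_pos_of_pos (sqrt_add_sqrt_pos hab) _
    have h1 : 0 < b - a := sub_pos.2 hab
    refine ⟨mul_pos h1 (Finset.prod_pos hpos), ?_⟩
    simp only [hG]
    rw [Real.log_mul h1.ne' (Finset.prod_pos hpos).ne', Real.log_prod fun k hk => (hpos k hk).ne',
      endpointFunctional, Finset.mul_sum]
    congr 1
    exact Finset.sum_congr rfl fun k _ => Real.log_rpow (sqrt_add_sqrt_pos hab) _
  set K : Set (ℝ × ℝ) := (Set.Icc (-1) 1 ×ˢ Set.Icc (-1) 1) ∩ {p | p.1 ≤ p.2} with hK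
  have hKc : IsCompact K := (isCompact_Icc.prod isCompact_Icc).inter_right
    (isClosed_le continuous_fst continuous_snd)
  obtain ⟨⟨a, b⟩, hab, hmax⟩ := hKc.exists_isMaxOn
    ⟨((-1 : ℝ), (1 : ℝ)), by simp [hK]⟩ hGc.continuousOn
  have hlt : a < b := by
    refine lt_of_le_of_ne hab.2 fun h => ?_
    have h1 : G (-1, 1) ≤ G (a, b) := hmax (by simp [hK])
    have h2 := (hlog (-1) 1 (by norm_num)).1
    have h3 : G (a, b) = 0 := by
      have h' : a = b := h
      simp [hG, h']
    linarith
  refine ⟨a, b, hab.1.1.1, hlt, hab.1.2.2, fun a' b' h1 h2 h3 => ?_⟩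
  rw [← (hlog a' b' h2).2, ← (hlog a b hlt).2]
  refine Real.log_le_log (hlog a' b' h2).1 (hmax ?_)
  exact ⟨⟨⟨h1, by linarith⟩, ⟨by linarith, h3⟩⟩, h2.le⟩

/-- The formula rests on `b - a` being, up to sign, the difference of the squares of the two roots.
The case `t = b = 1` is admitted because `b < 1` is not yet known when this is applied. -/
lemma hasDerivAt_log_sqrt_add {t a b : ℝ} (ht : 1 ≤ |t|) (ha : -1 < a) (hab : a < b)
    (hb : b ≤ 1) :
    HasDerivAt (fun x => Real.log (Real.sqrt |t - x| + Real.sqrt |t - b|))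
      ((Real.sqrt ((t - b) / (t - a)) - 1) / (2 * (b - a))) a := by
  have hba : 0 < b - a := sub_pos.2 hab
  rcases le_abs.1 ht with h | h
  · have h1 : 0 < t - a := by linarith
    have h2 : 0 ≤ t - b := by linarith
    have hs1 := Real.sqrt_pos.2 h1
    have hs2 := Real.sqrt_nonneg (t - b)
    have hd : HasDerivAt (fun x => Real.log (Real.sqrt (t - x) + Real.sqrt (t - b)))
        ((-1 / (2 * Real.sqrt (t - a))) / (Real.sqrt (t - a) + Real.sqrt (t - b))) a := by
      refine HasDerivAt.log ?_ (by positivity)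
      exact (((hasDerivAt_id a).const_sub t).sqrt h1.ne').add_const _
    have he : (-1 / (2 * Real.sqrt (t - a))) / (Real.sqrt (t - a) + Real.sqrt (t - b)) =
        (Real.sqrt ((t - b) / (t - a)) - 1) / (2 * (b - a)) := by
      rw [Real.sqrt_div h2]
      have e1 := Real.sq_sqrt h1.le
      have e2 := Real.sq_sqrt h2
      have e3 : b - a = (Real.sqrt (t - a) - Real.sqrt (t - b)) *
          (Real.sqrt (t - a) + Real.sqrt (t - b)) := by
        rw [mul_comm, ← sq_sub_sq, e1, e2]; ring
      have e4 : Real.sqrt (t - a) - Real.sqrt (t - b) ≠ 0 := by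
        intro h0; rw [e3, h0, zero_mul] at hba; exact lt_irrefl _ hba
      have e5 : Real.sqrt (t - a) + Real.sqrt (t - b) ≠ 0 := by positivity
      rw [e3]
      field_simp
      ring
    rw [he] at hd
    refine hd.congr_of_eventuallyEq ?_
    filter_upwards [Iio_mem_nhds (by linarith : a < t)] with x hx
    have hx' : x < t := hx
    rw [abs_of_pos (by linarith), abs_of_nonneg h2]
  · have h1 : 0 < a - t := by linarith
    have h2 : 0 < b - t := by linarith
    have hs1 := Real.sqrt_pos.2 h1
    have hs2 := Real.sqrt_pos.2 h2
    have hd : HasDerivAt (fun x => Real.log (Real.sqrt (x - t) + Real.sqrt (b - t)))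
        ((1 / (2 * Real.sqrt (a - t))) / (Real.sqrt (a - t) + Real.sqrt (b - t))) a := by
      refine HasDerivAt.log ?_ (by positivity)
      exact (((hasDerivAt_id a).sub_const t).sqrt h1.ne').add_const _
    have he : (1 / (2 * Real.sqrt (a - t))) / (Real.sqrt (a - t) + Real.sqrt (b - t)) =
        (Real.sqrt ((t - b) / (t - a)) - 1) / (2 * (b - a)) := by
      rw [← neg_div_neg_eq (t - b) (t - a), neg_sub, neg_sub, Real.sqrt_div h2.le]
      have e1 := Real.sq_sqrt h1.le
      have e2 := Real.sq_sqrt h2.le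
      have e3 : b - a = (Real.sqrt (b - t) - Real.sqrt (a - t)) *
          (Real.sqrt (a - t) + Real.sqrt (b - t)) := by
        rw [mul_comm, add_comm (Real.sqrt (a - t)), ← sq_sub_sq, e1, e2]; ring
      have e4 : Real.sqrt (b - t) - Real.sqrt (a - t) ≠ 0 := by
        intro h0; rw [e3, h0, zero_mul] at hba; exact lt_irrefl _ hba
      have e5 : Real.sqrt (a - t) + Real.sqrt (b - t) ≠ 0 := by positivity
      rw [e3]
      field_simp
    rw [he] at hd
    refine hd.congr_of_eventuallyEq ?_
    filter_upwards [Ioi_mem_nhds (by linarith : t < a)] with x hx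
    have hx' : t < x := hx
    rw [abs_of_neg (by linarith), abs_of_neg (by linarith), neg_sub, neg_sub]

/-- A maximizing interval does not contain a point `-1` carrying a charge. -/
lemma left_endpoint_gt (hw : 0 < w) (hy : ∀ k ∈ S, 1 ≤ |y k|) {l : ι} (hl : l ∈ S)
    (hyl : y l = -1) {a b : ℝ} (ha : -1 ≤ a) (hab : a < b) (hb : b ≤ 1)
    (hmax : ∀ a' : ℝ, -1 ≤ a' → a' < b →
      endpointFunctional S y w a' b ≤ endpointFunctional S y w a b) : -1 < a := by
  classical
  refine lt_of_le_of_ne ha fun h => ?_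
  subst h
  -- Put `a = -1 + s²`. The charge `l` contributes `log (s + √(b+1))`, which grows linearly in `s`,
  -- while the length of the interval and the charges `y k ≥ 1` contribute with zero derivative at
  -- `s = 0`. The terms of the other charges `y k ≤ -1` increase with `a`, so their value at `a =
  -- -1` is kept as a lower bound.
  set R : ι → ℝ → ℝ := fun k s => if 1 ≤ y k then
    Real.log (Real.sqrt (y k + 1 - s ^ 2) + Real.sqrt |y k - b|) else
    Real.log (Real.sqrt |y k + 1| + Real.sqrt |y k - b|) with hR
  set χ : ℝ → ℝ := fun s => Real.log (b + 1 - s ^ 2) + 2 * w *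
    (Real.log (s + Real.sqrt (b + 1)) + ∑ k ∈ S.erase l, R k s) with hχ
  have hb1 : 0 < b + 1 := by linarith
  have hsb := Real.sqrt_pos.2 hb1
  have hχd : HasDerivAt χ (2 * w * (1 / Real.sqrt (b + 1))) 0 := by
    have d1 : HasDerivAt (fun s : ℝ => Real.log (b + 1 - s ^ 2)) 0 0 := by
      have := ((hasDerivAt_pow 2 (0 : ℝ)).const_sub (b + 1)).log (by simpa using hb1.ne')
      simpa using this
    have d2 : HasDerivAt (fun s : ℝ => Real.log (s + Real.sqrt (b + 1)))
        (1 / Real.sqrt (b + 1)) 0 := by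
      have := ((hasDerivAt_id (0 : ℝ)).add_const (Real.sqrt (b + 1))).log (by simpa using hsb.ne')
      simpa using this
    have d3 : HasDerivAt (fun s : ℝ => ∑ k ∈ S.erase l, R k s) (∑ k ∈ S.erase l, 0) 0 := by
      refine HasDerivAt.fun_sum fun k _ => ?_
      simp only [hR]
      split_ifs with hk
      · have hp : 0 < Real.sqrt (y k + 1) := Real.sqrt_pos.2 (by linarith)
        have e1 : HasDerivAt (fun s : ℝ => Real.sqrt (y k + 1 - s ^ 2)) 0 0 := by
          have := ((hasDerivAt_pow 2 (0 : ℝ)).const_sub (y k + 1)).sqrt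
            (by simp; linarith)
          simpa using this
        have := (e1.add_const (Real.sqrt |y k - b|)).log (by
          simp only [ne_eq, OfNat.ofNat_ne_zero, not_false_eq_true, zero_pow, sub_zero]
          have := Real.sqrt_nonneg |y k - b|
          linarith)
        simpa using this
      · exact hasDerivAt_const _ _
    refine (d1.add ((d2.add d3).const_mul (2 * w))).congr_deriv ?_
    simp
  have hχ0 : χ 0 = endpointFunctional S y w (-1) b := by
    rw [hχ, endpointFunctional, ← Finset.add_sum_erase _ _ hl, hyl]
    simp only [hR]
    have e : |(-1 : ℝ) - b| = b + 1 := by rw [abs_of_neg (by linarith)]; ring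
    rw [e]
    simp only [ne_eq, OfNat.ofNat_ne_zero, not_false_eq_true, zero_pow, sub_zero, zero_add,
      sub_neg_eq_add, neg_add_cancel, abs_zero, Real.sqrt_zero]
    congr 3
    refine Finset.sum_congr rfl fun k _ => ?_
    split_ifs with hk
    · rw [abs_of_pos (by linarith : 0 < y k + 1)]
    · rfl
  have hpos : 0 < 2 * w * (1 / Real.sqrt (b + 1)) := by positivity
  have hev : ∀ᶠ s in 𝓝[>] (0 : ℝ), χ 0 < χ s := by
    have := hχd.hasDerivWithinAt (s := Set.Ioi 0)
    have h2 := (hasDerivWithinAt_iff_tendsto_slope' (by simp)).1 this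
    filter_upwards [h2.eventually (lt_mem_nhds hpos), self_mem_nhdsWithin] with s hs hs0
    have hs0' : 0 < s := hs0
    rw [slope_def_field, sub_zero] at hs
    have := (div_pos_iff_of_pos_right hs0').1 hs
    linarith
  have hsmall : ∀ᶠ s in 𝓝[>] (0 : ℝ), s ^ 2 < b + 1 ∧ s ^ 2 < 2 := by
    have : Tendsto (fun s : ℝ => s ^ 2) (𝓝[>] 0) (𝓝 0) := by
      have : Continuous fun s : ℝ => s ^ 2 := by fun_prop
      simpa using (this.tendsto 0).mono_left nhdsWithin_le_nhds
    exact (this.eventually (gt_mem_nhds hb1)).and (this.eventually (gt_mem_nhds two_pos))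
  obtain ⟨s, hs1, ⟨hs2, hs3⟩, hs4⟩ := (hev.and (hsmall.and self_mem_nhdsWithin)).exists
  have hs0 : 0 < s := hs4
  have hle : χ s ≤ endpointFunctional S y w (-1 + s ^ 2) b := by
    rw [hχ, endpointFunctional, ← Finset.add_sum_erase _ _ hl, hyl]
    have e : |(-1 : ℝ) - b| = b + 1 := by rw [abs_of_neg (by linarith)]; ring
    have e2 : |(-1 : ℝ) - (-1 + s ^ 2)| = s ^ 2 := by
      rw [show (-1 : ℝ) - (-1 + s ^ 2) = -(s ^ 2) by ring, abs_neg, abs_of_pos (by positivity)]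
    rw [e, e2, Real.sqrt_sq hs0.le, show b - (-1 + s ^ 2) = b + 1 - s ^ 2 by ring]
    dsimp only
    refine add_le_add le_rfl (mul_le_mul_of_nonneg_left (add_le_add le_rfl
      (Finset.sum_le_sum fun k hk => ?_)) (by positivity))
    simp only [hR]
    split_ifs with h1
    · rw [show y k - (-1 + s ^ 2) = y k + 1 - s ^ 2 by ring,
        abs_of_pos (by linarith : 0 < y k + 1 - s ^ 2)]
    · have hk1 : y k ≤ -1 := by
        rcases le_abs.1 (hy k (Finset.mem_of_mem_erase hk)) with h | h
        · exact absurd h h1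
        · linarith
      have hp : 0 < Real.sqrt |y k - b| := Real.sqrt_pos.2 (abs_pos.2 (by linarith))
      refine Real.log_le_log (by positivity) ?_
      refine add_le_add (Real.sqrt_le_sqrt ?_) le_rfl
      rw [abs_of_nonpos (by linarith), abs_of_nonpos (by nlinarith [sq_nonneg s])]
      nlinarith [sq_nonneg s]
  have := hmax (-1 + s ^ 2) (by nlinarith [sq_nonneg s]) (by linarith)
  linarith

/-- Once `a > -1`, it is an interior maximum for fixed `b`, and stationarity multiplied by `b - a`
is the stated identity. -/
lemma left_endpoint_condition (hw : 0 < w) (hy : ∀ k ∈ S, 1 ≤ |y k|) {l : ι} (hl : l ∈ S)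
    (hyl : y l = -1) {a b : ℝ} (ha : -1 ≤ a) (hab : a < b) (hb : b ≤ 1)
    (hmax : ∀ a' : ℝ, -1 ≤ a' → a' < b →
      endpointFunctional S y w a' b ≤ endpointFunctional S y w a b) :
    -1 < a ∧ w * ∑ k ∈ S, (Real.sqrt ((y k - b) / (y k - a)) - 1) = 1 := by
  have ha1 := left_endpoint_gt hw hy hl hyl ha hab hb hmax
  refine ⟨ha1, ?_⟩
  have hba : 0 < b - a := sub_pos.2 hab
  have hd : HasDerivAt (fun x => endpointFunctional S y w x b) (-1 / (b - a) + 2 * w *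
      ∑ k ∈ S, (Real.sqrt ((y k - b) / (y k - a)) - 1) / (2 * (b - a))) a := by
    unfold endpointFunctional
    refine HasDerivAt.add ?_ ((HasDerivAt.fun_sum fun k hk =>
      hasDerivAt_log_sqrt_add (hy k hk) ha1 hab hb).const_mul _)
    exact ((hasDerivAt_id a).const_sub b).log hba.ne'
  have hloc : IsLocalMax (fun x => endpointFunctional S y w x b) a := by
    filter_upwards [Ioo_mem_nhds ha1 hab] with x hx
    exact hmax x hx.1.le hx.2
  have h0 := hloc.hasDerivAt_eq_zero hd
  rw [← Finset.sum_div] at h0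
  field_simp at h0
  linarith

lemma endpointFunctional_neg (a b : ℝ) :
    endpointFunctional S (fun k => -y k) w (-b) (-a) = endpointFunctional S y w a b := by
  unfold endpointFunctional
  congr 1
  · congr 1; ring
  · congr 1
    refine Finset.sum_congr rfl fun k _ => ?_
    rw [add_comm, show -y k - -a = -(y k - a) by ring, show -y k - -b = -(y k - b) by ring, abs_neg,
      abs_neg]

/-- Existence of the endpoints of the support. -/
theorem exists_endpoints (hw : 0 < w) (hy : ∀ k ∈ S, 1 ≤ |y k|) {l r : ι} (hl : l ∈ S)
    (hyl : y l = -1) (hr : r ∈ S) (hyr : y r = 1) :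
    ∃ a b : ℝ, -1 < a ∧ a < b ∧ b < 1 ∧
      w * ∑ k ∈ S, (Real.sqrt ((y k - b) / (y k - a)) - 1) = 1 ∧
      w * ∑ k ∈ S, (Real.sqrt ((y k - a) / (y k - b)) - 1) = 1 := by
  obtain ⟨a, b, ha, hab, hb, hmax⟩ := exists_max_endpointFunctional (S := S) (y := y) hw
  obtain ⟨p1, p2⟩ := left_endpoint_condition hw hy hl hyl ha hab hb
    fun a' h1 h2 => hmax a' b h1 h2 hb
  -- The condition at `b` is the one at the left endpoint `-b` for the reflected charges.
  obtain ⟨q1, q2⟩ := left_endpoint_condition (y := fun k => -y k) hw (by simpa using hy) hr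
    (by simp [hyr]) (a := -b) (b := -a) (by linarith) (by linarith) (by linarith) fun a' h1 h2 => by
      rw [endpointFunctional_neg]
      have := endpointFunctional_neg (S := S) (y := y) (w := w) a (-a')
      rw [neg_neg] at this
      rw [this]
      exact hmax a (-a') ha (by linarith) (by linarith)
  refine ⟨a, b, p1, hab, by linarith, p2, ?_⟩
  convert q2 using 4 with k hk
  rw [show -y k - -a = -(y k - a) by ring, show -y k - -b = -(y k - b) by ring, neg_div_neg_eq]

/-! ### From endpoints to the equilibrium measure -/

/-- The exterior conformal coordinate of the charge `t` for the interval `[a, b]`. -/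
def conformalCoord (a b t : ℝ) : ℝ :=
  (1 - Real.sqrt ((t - b) / (t - a))) / (1 + Real.sqrt ((t - b) / (t - a)))

lemma conformalCoord_facts {a b t : ℝ} (ha : -1 < a) (hab : a < b) (hb : b < 1) (ht : 1 ≤ |t|) :
    0 < (t - b) / (t - a) ∧ (t - b) / (t - a) ≠ 1 := by
  have hta : t - a ≠ 0 := by
    intro h
    rcases le_abs.1 ht with h' | h' <;> linarith
  constructor
  · rcases le_abs.1 ht with h | h
    · exact div_pos (by linarith) (by linarith)
    · exact div_pos_of_neg_of_neg (by linarith) (by linarith)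
  · rw [ne_eq, div_eq_one_iff_eq hta]
    intro h; linarith

/-- Endpoints solving the endpoint conditions give a balanced configuration. -/
lemma balanced_of_endpoints (hw : 0 < w) (hy : ∀ k ∈ S, 1 ≤ |y k|) {a b : ℝ}
    (ha : -1 < a) (hab : a < b) (hb : b < 1)
    (hA : w * ∑ k ∈ S, (Real.sqrt ((y k - b) / (y k - a)) - 1) = 1)
    (hB : w * ∑ k ∈ S, (Real.sqrt ((y k - a) / (y k - b)) - 1) = 1) :
    Balanced S (fun k => conformalCoord a b (y k)) w ∧
    ∀ k ∈ S, y k = (a + b) / 2 + (b - a) / 2 *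
      ((conformalCoord a b (y k) + (conformalCoord a b (y k))⁻¹) / 2) := by
  -- In terms of `q`, `z/(1-z²) = (q⁻¹ - q)/4` and `2z²/(1-z²) = (q + q⁻¹ - 2)/2`. Hence the
  -- difference of the two endpoint conditions gives `sum_zero` and their mean gives `sum_one`.
  set q : ι → ℝ := fun k => Real.sqrt ((y k - b) / (y k - a)) with hq
  have hq0 : ∀ k ∈ S, 0 < q k := fun k hk =>
    Real.sqrt_pos.2 (conformalCoord_facts ha hab hb (hy k hk)).1
  have hq1 : ∀ k ∈ S, 1 - q k ≠ 0 := fun k hk h => by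
    have h1 : q k = 1 := by linarith
    simp only [hq] at h1
    rw [Real.sqrt_eq_one] at h1
    exact (conformalCoord_facts ha hab hb (hy k hk)).2 h1
  have hinv : ∀ k, Real.sqrt ((y k - a) / (y k - b)) = (q k)⁻¹ := fun k => by
    rw [hq, ← Real.sqrt_inv, inv_div]
  have hz : ∀ k, conformalCoord a b (y k) = (1 - q k) / (1 + q k) := fun k => rfl
  simp_rw [hinv] at hB
  change w * ∑ k ∈ S, (q k - 1) = 1 at hA
  have hsum : ∑ k ∈ S, (q k - 1) = ∑ k ∈ S, ((q k)⁻¹ - 1) :=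
    mul_left_cancel₀ hw.ne' (hA.trans hB.symm)
  refine ⟨⟨hw, fun k hk => ?_, fun k hk => ?_, ?_, ?_⟩, fun k hk => ?_⟩
  · rw [hz]
    exact div_ne_zero (hq1 k hk) (by have := hq0 k hk; positivity)
  · have := hq0 k hk
    rw [hz, _root_.abs_lt]
    constructor
    · rw [lt_div_iff₀ (by linarith)]; linarith
    · rw [div_lt_iff₀ (by linarith)]; linarith
  · have : ∀ k ∈ S, conformalCoord a b (y k) / (1 - conformalCoord a b (y k) ^ 2) =
        (((q k)⁻¹ - 1) - (q k - 1)) / 4 := by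
      intro k hk
      have h0 := hq0 k hk
      rw [hz, show 1 - ((1 - q k) / (1 + q k)) ^ 2 = 4 * q k / (1 + q k) ^ 2 by field_simp; ring]
      field_simp
      ring
    rw [Finset.sum_congr rfl this, ← Finset.sum_div, Finset.sum_sub_distrib, hsum]
    simp
  · have : ∀ k ∈ S, 2 * conformalCoord a b (y k) ^ 2 / (1 - conformalCoord a b (y k) ^ 2) =
        (((q k)⁻¹ - 1) + (q k - 1)) / 2 := by
      intro k hk
      have h0 := hq0 k hk
      rw [hz, show 1 - ((1 - q k) / (1 + q k)) ^ 2 = 4 * q k / (1 + q k) ^ 2 by field_simp; ring]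
      field_simp
      ring
    rw [Finset.sum_congr rfl this, ← Finset.sum_div, Finset.sum_add_distrib, mul_div_assoc', mul_add,
      hA, hB]
    norm_num
  · have h0 := hq0 k hk
    have h1 := hq1 k hk
    have h2 : q k ^ 2 = (y k - b) / (y k - a) :=
      Real.sq_sqrt (conformalCoord_facts ha hab hb (hy k hk)).1.le
    have hya : y k - a ≠ 0 := by
      intro h
      rcases le_abs.1 (hy k hk) with h' | h' <;> linarith
    have h3 : q k ^ 2 * (y k - a) = y k - b := by rw [h2]; field_simp
    rw [hz]
    field_simp
    linear_combination (-4) * h3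

/-- The equilibrium measure for finitely many charges outside `(-1, 1)`, including `-1` and `1`. -/
theorem exists_unique_equilibrium (hw : 0 < w) (hy : ∀ k ∈ S, 1 ≤ |y k|) {l r : ι} (hl : l ∈ S)
    (hyl : y l = -1) (hr : r ∈ S) (hyr : y r = 1) :
    ∃ a b : ℝ, -1 < a ∧ a < b ∧ b < 1 ∧
      w * ∑ k ∈ S, (Real.sqrt ((y k - b) / (y k - a)) - 1) = 1 ∧
      w * ∑ k ∈ S, (Real.sqrt ((y k - a) / (y k - b)) - 1) = 1 ∧
      (∃ ν, IsEquilibriumMeasure (chargePotential S y w) ν) ∧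
      ∀ ν, IsEquilibriumMeasure (chargePotential S y w) ν → ν.support = Set.Icc a b := by
  obtain ⟨a, b, ha, hab, hb, hA, hB⟩ := exists_endpoints hw hy hl hyl hr hyr
  obtain ⟨hbal, hyz⟩ := balanced_of_endpoints hw hy ha hab hb hA hB
  have hh : 0 < (b - a) / 2 := by linarith
  obtain ⟨h1, h2⟩ := hbal.equilibrium hh (by linarith : -1 < (a + b) / 2 - (b - a) / 2)
    (by linarith) hyz hy
  refine ⟨a, b, ha, hab, hb, hA, hB, ⟨_, h1⟩, fun ν hν => ?_⟩
  rw [h2 ν hν, hbal.support_arcMeasure hh]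
  congr 1 <;> ring

end


/-! ### Sums over perturbed arithmetic progressions -/

section

variable {f Φ : ℝ → ℝ}

lemma mul_le_sub_of_antitone (hΦ : ∀ x, 0 ≤ x → HasDerivAt Φ (f x) x)
    (hf : AntitoneOn f (Set.Ici 0)) {x x' : ℝ} (hx : 0 ≤ x) (hxx : x ≤ x') :
    f x' * (x' - x) ≤ Φ x' - Φ x ∧ Φ x' - Φ x ≤ f x * (x' - x) := by
  rcases hxx.eq_or_lt with h | h
  · subst h; simp
  obtain ⟨c, hc, he⟩ := exists_hasDerivAt_eq_slope Φ f h
    (fun t ht => (hΦ t (hx.trans ht.1)).continuousAt.continuousWithinAt)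
    (fun t ht => hΦ t (hx.trans ht.1.le))
  have h1 : Φ x' - Φ x = f c * (x' - x) := by
    rw [he]; field_simp [(sub_pos.2 h).ne']
  have hc0 : 0 ≤ c := hx.trans hc.1.le
  rw [h1]
  constructor
  · exact mul_le_mul_of_nonneg_right (hf hc0 (hx.trans hxx) hc.2.le) (by linarith)
  · exact mul_le_mul_of_nonneg_right (hf hx hc0 hc.1.le) (by linarith)

/-- The points are compared with the lattice moved left by `e` and truncated at `0`. Each surviving
step is bounded by an integral of `f`; the length lost to truncation is at most `e`, which costs at
most `e f(0)`. -/
lemma sum_le_of_antitone (hΦ : ∀ x, 0 ≤ x → HasDerivAt Φ (f x) x)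
    (hf : AntitoneOn f (Set.Ici 0)) (hf0 : ∀ x, 0 ≤ x → 0 ≤ f x) {ρ e : ℝ} (hρ : 0 ≤ ρ)
    (he : 0 ≤ e) {l : ℕ → ℝ} {M : ℕ} (hl0 : ∀ k < M, 0 ≤ l k)
    (hl : ∀ k < M, ρ * (k + 1 : ℕ) - e ≤ l k) :
    ρ * ∑ k ∈ Finset.range M, f (l k) ≤ Φ (ρ * M) - Φ 0 + e * f 0 := by
  set X : ℕ → ℝ := fun k => max (ρ * k - e) 0 with hX
  have hX0 : ∀ k, 0 ≤ X k := fun k => le_max_right _ _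
  have hstep : ∀ k, X k ≤ X (k + 1) ∧ X (k + 1) ≤ X k + ρ := by
    intro k
    have e1 : ρ * (k + 1 : ℕ) - e = (ρ * k - e) + ρ := by push_cast; ring
    simp only [hX, e1]
    refine ⟨max_le_max (by linarith) le_rfl, max_le ?_ ?_⟩
    · linarith [le_max_left (ρ * k - e) 0]
    · linarith [le_max_right (ρ * k - e) 0]
  have hind : ∀ m ≤ M, ρ * ∑ k ∈ Finset.range m, f (l k) ≤
      Φ (X m) - Φ (X 0) + (ρ * m - X m + X 0) * f 0 := by
    intro m
    induction m with
    | zero => intro _; simp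
    | succ k ih =>
      intro hk
      have h1 := ih (by omega)
      obtain ⟨s1, s2⟩ := hstep k
      have h2 : X (k + 1) ≤ l k := max_le (hl k (by omega)) (hl0 k (by omega))
      have h3 : f (l k) ≤ f (X (k + 1)) := hf (hX0 _) (hl0 k (by omega)) h2
      have h4 := (mul_le_sub_of_antitone hΦ hf (hX0 k) s1).1
      have h5 : f (X (k + 1)) ≤ f 0 := hf Set.self_mem_Ici (hX0 _) (hX0 _)
      rw [Finset.sum_range_succ, mul_add]
      have h6 : ρ * f (l k) ≤ ρ * f (X (k + 1)) := mul_le_mul_of_nonneg_left h3 hρ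
      have h7 : (ρ - (X (k + 1) - X k)) * f (X (k + 1)) ≤ (ρ - (X (k + 1) - X k)) * f 0 :=
        mul_le_mul_of_nonneg_left h5 (by linarith)
      push_cast
      nlinarith
  have h0 : X 0 = 0 := by simp [hX, he]
  have h := hind M le_rfl
  rw [h0, add_zero] at h
  have hXM : X M ≤ ρ * M := max_le (by linarith) (by positivity)
  have h1 : Φ (X M) ≤ Φ (ρ * M) := by
    have := (mul_le_sub_of_antitone hΦ hf (hX0 M) hXM).1
    have h2 := mul_nonneg (hf0 (ρ * M) (by positivity)) (sub_nonneg.2 hXM)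
    linarith
  have h2 : (ρ * M - X M) * f 0 ≤ e * f 0 :=
    mul_le_mul_of_nonneg_right (by linarith [le_max_left (ρ * M - e) 0]) (hf0 0 le_rfl)
  linarith

/-- The sum dominates the integral of `f` from `ρ + e` to `ρ (M + 1) + e`; the missing initial
interval costs at most `(ρ + e) f(0)`. -/
lemma le_sum_of_antitone (hΦ : ∀ x, 0 ≤ x → HasDerivAt Φ (f x) x)
    (hf : AntitoneOn f (Set.Ici 0)) (hf0 : ∀ x, 0 ≤ x → 0 ≤ f x) {ρ e : ℝ} (hρ : 0 ≤ ρ)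
    (he : 0 ≤ e) {r : ℕ → ℝ} {M : ℕ} (hr0 : ∀ k < M, 0 ≤ r k)
    (hr : ∀ k < M, r k ≤ ρ * (k + 1 : ℕ) + e) :
    Φ (ρ * M) - Φ 0 - (ρ + e) * f 0 ≤ ρ * ∑ k ∈ Finset.range M, f (r k) := by
  set X : ℕ → ℝ := fun k => ρ * (k + 1 : ℕ) + e with hX
  have hX0 : ∀ k, 0 ≤ X k := fun k => by simp only [hX]; positivity
  have hind : ∀ m ≤ M, Φ (X m) - Φ (X 0) ≤ ρ * ∑ k ∈ Finset.range m, f (r k) := by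
    intro m
    induction m with
    | zero => intro _; simp
    | succ k ih =>
      intro hk
      have h1 := ih (by omega)
      have e1 : X (k + 1) = X k + ρ := by simp only [hX]; push_cast; ring
      have h3 : f (X k) ≤ f (r k) := hf (hr0 k (by omega)) (hX0 _) (hr k (by omega))
      have h4 := (mul_le_sub_of_antitone hΦ hf (hX0 k) (by linarith : X k ≤ X (k + 1))).2
      rw [Finset.sum_range_succ, mul_add]
      have h6 : ρ * f (X k) ≤ ρ * f (r k) := mul_le_mul_of_nonneg_left h3 hρ
      rw [e1] at h4 ⊢
      nlinarith
  have h := hind M le_rfl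
  have hM : ρ * M ≤ X M := by simp only [hX]; push_cast; nlinarith
  have h1 : Φ (ρ * M) ≤ Φ (X M) := by
    have := (mul_le_sub_of_antitone hΦ hf (by positivity : 0 ≤ ρ * M) hM).1
    have h2 := mul_nonneg (hf0 (X M) (hX0 M)) (sub_nonneg.2 hM)
    linarith
  have h2 := (mul_le_sub_of_antitone hΦ hf le_rfl (hX0 0)).2
  have h3 : X 0 = ρ + e := by simp [hX]
  rw [h3] at h2 h
  linarith

end

/-! ### The two primitives -/

lemma hasDerivAt_sqrt_shift {p x : ℝ} (hp : 0 < x + p) :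
    HasDerivAt (fun x : ℝ => Real.sqrt (x + p)) (1 / (2 * Real.sqrt (x + p))) x :=
  ((hasDerivAt_id x).add_const p).sqrt hp.ne'

/-- A primitive of `√((x + p) / (x + q)) - 1`. -/
def primUp (p q x : ℝ) : ℝ :=
  Real.sqrt (x + p) * Real.sqrt (x + q) +
    (p - q) * Real.log (Real.sqrt (x + p) + Real.sqrt (x + q)) - x

/-- A primitive of `1 - √((x + q) / (x + p))`. -/
def primDown (p q x : ℝ) : ℝ :=
  x - Real.sqrt (x + p) * Real.sqrt (x + q) +
    (p - q) * Real.log (Real.sqrt (x + p) + Real.sqrt (x + q))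

lemma hasDerivAt_log_sqrt_add_sqrt {p q x : ℝ} (hp : 0 < x + p) (hq : 0 < x + q) :
    HasDerivAt (fun x => Real.log (Real.sqrt (x + p) + Real.sqrt (x + q)))
      (1 / (2 * (Real.sqrt (x + p) * Real.sqrt (x + q)))) x := by
  have h1 := Real.sqrt_pos.2 hp
  have h2 := Real.sqrt_pos.2 hq
  refine (((hasDerivAt_sqrt_shift hp).add (hasDerivAt_sqrt_shift hq)).log
    (by simp only [Pi.add_apply]; positivity)).congr_deriv ?_
  simp only [Pi.add_apply]
  field_simp
  ring

lemma hasDerivAt_primUp {p q : ℝ} (hp : 0 < p) (hq : 0 < q) {x : ℝ} (hx : 0 ≤ x) :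
    HasDerivAt (primUp p q) (Real.sqrt ((x + p) / (x + q)) - 1) x := by
  have hp' : 0 < x + p := by linarith
  have hq' : 0 < x + q := by linarith
  have h1 := Real.sqrt_pos.2 hp'
  have h2 := Real.sqrt_pos.2 hq'
  have e1 := Real.sq_sqrt hp'.le
  have e2 := Real.sq_sqrt hq'.le
  refine ((((hasDerivAt_sqrt_shift hp').mul (hasDerivAt_sqrt_shift hq')).add
    ((hasDerivAt_log_sqrt_add_sqrt hp' hq').const_mul (p - q))).sub
      (hasDerivAt_id x)).congr_deriv ?_
  rw [Real.sqrt_div hp'.le]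
  have e3 : p - q = Real.sqrt (x + p) ^ 2 - Real.sqrt (x + q) ^ 2 := by rw [e1, e2]; ring
  rw [e3]
  field_simp
  ring

lemma hasDerivAt_primDown {p q : ℝ} (hp : 0 < p) (hq : 0 < q) {x : ℝ} (hx : 0 ≤ x) :
    HasDerivAt (primDown p q) (1 - Real.sqrt ((x + q) / (x + p))) x := by
  have hp' : 0 < x + p := by linarith
  have hq' : 0 < x + q := by linarith
  have h1 := Real.sqrt_pos.2 hp'
  have h2 := Real.sqrt_pos.2 hq'
  have e1 := Real.sq_sqrt hp'.le
  have e2 := Real.sq_sqrt hq'.le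
  refine (((hasDerivAt_id x).sub ((hasDerivAt_sqrt_shift hp').mul (hasDerivAt_sqrt_shift hq'))).add
    ((hasDerivAt_log_sqrt_add_sqrt hp' hq').const_mul (p - q))).congr_deriv ?_
  rw [Real.sqrt_div hq'.le]
  have e3 : p - q = Real.sqrt (x + p) ^ 2 - Real.sqrt (x + q) ^ 2 := by rw [e1, e2]; ring
  rw [e3]
  field_simp
  ring

lemma antitoneOn_up {p q : ℝ} (hq : 0 < q) (hqp : q ≤ p) :
    AntitoneOn (fun x => Real.sqrt ((x + p) / (x + q)) - 1) (Set.Ici 0) := by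
  intro x hx x' hx' hxx
  have hx0 : (0 : ℝ) ≤ x := hx
  have hx0' : (0 : ℝ) ≤ x' := hx'
  refine sub_le_sub_right (Real.sqrt_le_sqrt ?_) _
  rw [div_le_div_iff₀ (by linarith) (by linarith)]
  nlinarith

lemma antitoneOn_down {p q : ℝ} (hp : 0 < p) (hqp : q ≤ p) :
    AntitoneOn (fun x => 1 - Real.sqrt ((x + q) / (x + p))) (Set.Ici 0) := by
  intro x hx x' hx' hxx
  have hx0 : (0 : ℝ) ≤ x := hx
  have hx0' : (0 : ℝ) ≤ x' := hx'
  refine sub_le_sub_left (Real.sqrt_le_sqrt ?_) _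
  rw [div_le_div_iff₀ (by linarith) (by linarith)]
  nlinarith

lemma up_nonneg {p q x : ℝ} (hq : 0 < q) (hqp : q ≤ p) (hx : 0 ≤ x) :
    0 ≤ Real.sqrt ((x + p) / (x + q)) - 1 := by
  rw [sub_nonneg, Real.one_le_sqrt, le_div_iff₀ (by linarith)]
  linarith

lemma down_nonneg {p q x : ℝ} (hp : 0 < p) (hqp : q ≤ p) (hx : 0 ≤ x) :
    0 ≤ 1 - Real.sqrt ((x + q) / (x + p)) := by
  rw [sub_nonneg, Real.sqrt_le_left zero_le_one, one_pow, div_le_one (by linarith)]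
  linarith

lemma sqrt_mul_sqrt_le {p q x : ℝ} (hp : 0 ≤ x + p) (hq : 0 ≤ x + q) :
    Real.sqrt (x + p) * Real.sqrt (x + q) ≤ x + (p + q) / 2 := by
  nlinarith [sq_nonneg (Real.sqrt (x + p) - Real.sqrt (x + q)), Real.sq_sqrt hp, Real.sq_sqrt hq]

lemma log_sqrt_add_sqrt_le {p q x : ℝ} (hx : 0 ≤ x) (hp : 0 < p) (hq : 0 < q) (hp2 : p ≤ 2)
    (hq2 : q ≤ 2) :
    Real.log (Real.sqrt (x + p) + Real.sqrt (x + q)) ≤ Real.log (4 * (x + 2)) / 2 := by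
  have h1 := Real.sqrt_le_sqrt (by linarith : x + p ≤ x + 2)
  have h2 := Real.sqrt_le_sqrt (by linarith : x + q ≤ x + 2)
  have h3 := Real.sqrt_pos.2 (by linarith : 0 < x + p)
  have h4 := Real.sqrt_nonneg (x + q)
  rw [← Real.log_sqrt (by linarith)]
  refine Real.log_le_log (by positivity) ?_
  rw [Real.sqrt_mul (by norm_num), show (4 : ℝ) = 2 ^ 2 by norm_num, Real.sqrt_sq (by norm_num)]
  linarith

lemma le_log_sqrt_add_sqrt {p q x : ℝ} (hx : 0 < x) (hp : 0 < p) (hq : 0 < q) :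
    Real.log (4 * x) / 2 ≤ Real.log (Real.sqrt (x + p) + Real.sqrt (x + q)) := by
  have h1 := Real.sqrt_le_sqrt (by linarith : x ≤ x + p)
  have h2 := Real.sqrt_le_sqrt (by linarith : x ≤ x + q)
  rw [← Real.log_sqrt (by linarith)]
  refine Real.log_le_log (by positivity) ?_
  rw [Real.sqrt_mul (by norm_num), show (4 : ℝ) = 2 ^ 2 by norm_num, Real.sqrt_sq (by norm_num)]
  linarith

/-- The third bound produces `√α`. Both primitives carry a logarithm with the same factor `d = 2 - α
- β`, so at `Λ` these cancel up to `2/Λ`. The products of roots at `Λ` contribute at most `2` in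
total by the arithmetic-geometric mean inequality, and the product at `0` contributes `-√(2-β) √α ≤
-√α` because `β < 1`. -/
lemma primitive_bounds {α β Λ : ℝ} (hα : 0 < α) (hβ : 0 < β) (hβα : β ≤ α)
    (hαβ : α + β < 2) (hΛ : 0 < Λ) :
    primUp (2 - β) α Λ - primUp (2 - β) α 0 ≤ 3 + Real.log (4 * (Λ + 2)) ∧
    primDown (2 - α) β Λ - primDown (2 - α) β 0 ≤ 3 + Real.log (4 * (Λ + 2)) ∧
    (primUp (2 - β) α Λ - primUp (2 - β) α 0) - (primDown (2 - α) β Λ - primDown (2 - α) β 0) ≤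
      2 - Real.sqrt α + 2 / Λ := by
  have hA : 0 < 2 - α := by linarith
  have hA' : 0 < 2 - β := by linarith
  set YL := primUp (2 - β) α Λ - primUp (2 - β) α 0 with hYL
  set YR := primDown (2 - α) β Λ - primDown (2 - α) β 0 with hYR
  have pL := sqrt_mul_sqrt_le (x := Λ) (p := 2 - β) (q := α) (by linarith) (by linarith)
  have pR := sqrt_mul_sqrt_le (x := Λ) (p := 2 - α) (q := β) (by linarith) (by linarith)
  have lL := log_sqrt_add_sqrt_le hΛ.le hA' hα (by linarith) (by linarith)
  have lR := log_sqrt_add_sqrt_le hΛ.le hA hβ (by linarith) (by linarith)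
  have lR' := le_log_sqrt_add_sqrt hΛ hA hβ
  have pR' : Λ ≤ Real.sqrt (Λ + (2 - α)) * Real.sqrt (Λ + β) := by
    rw [← Real.sqrt_mul (by linarith)]
    refine Real.le_sqrt_of_sq_le ?_
    nlinarith
  have sαpos := Real.sqrt_pos.2 hα
  have sβpos := Real.sqrt_pos.2 hβ
  have sApos := Real.sqrt_pos.2 hA
  have sA'1 : 1 ≤ Real.sqrt (2 - β) := Real.one_le_sqrt.2 (by linarith)
  have sAA' : Real.sqrt (2 - α) ≤ Real.sqrt (2 - β) := Real.sqrt_le_sqrt (by linarith)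
  have sβα : Real.sqrt β ≤ Real.sqrt α := Real.sqrt_le_sqrt hβα
  have l0 : Real.log (Real.sqrt (2 - α) + Real.sqrt β) ≤
      Real.log (Real.sqrt (2 - β) + Real.sqrt α) :=
    Real.log_le_log (by positivity) (by linarith)
  have l0' : 0 ≤ Real.log (Real.sqrt (2 - β) + Real.sqrt α) := Real.log_nonneg (by linarith)
  set d := 2 - α - β with hd
  have hd0 : 0 < d := by rw [hd]; linarith
  have hd2 : d ≤ 2 := by rw [hd]; linarith
  have l0R : -d * Real.log (Real.sqrt (2 - α) + Real.sqrt β) ≤ 1 := by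
    have h1 : Real.log (2 - α) / 2 ≤ Real.log (Real.sqrt (2 - α) + Real.sqrt β) := by
      rw [← Real.log_sqrt hA.le]
      exact Real.log_le_log sApos (by linarith)
    have h2 := Real.one_sub_inv_le_log_of_pos hA
    have h4 : d * (2 - α)⁻¹ ≤ 1 := by
      rw [← div_eq_mul_inv, div_le_one hA]; rw [hd]; linarith
    nlinarith
  have llog : Real.log (4 * (Λ + 2)) - Real.log (4 * Λ) ≤ 2 / Λ := by
    rw [← Real.log_div (by positivity) (by positivity)]
    refine (Real.log_le_sub_one_of_pos (by positivity)).trans (le_of_eq ?_)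
    field_simp
    ring
  have hlogpos : 0 ≤ Real.log (4 * (Λ + 2)) := Real.log_nonneg (by linarith)
  have eYL : YL = Real.sqrt (Λ + (2 - β)) * Real.sqrt (Λ + α) - Λ +
      d * Real.log (Real.sqrt (Λ + (2 - β)) + Real.sqrt (Λ + α)) -
      Real.sqrt (2 - β) * Real.sqrt α -
      d * Real.log (Real.sqrt (2 - β) + Real.sqrt α) := by
    rw [hYL, primUp, primUp, hd]
    simp only [zero_add]
    ring
  have eYR : YR = Λ - Real.sqrt (Λ + (2 - α)) * Real.sqrt (Λ + β) +
      d * Real.log (Real.sqrt (Λ + (2 - α)) + Real.sqrt (Λ + β)) +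
      Real.sqrt (2 - α) * Real.sqrt β -
      d * Real.log (Real.sqrt (2 - α) + Real.sqrt β) := by
    rw [hYR, primDown, primDown, hd]
    simp only [zero_add]
    ring
  have sL : Real.sqrt α ≤ Real.sqrt (2 - β) * Real.sqrt α := by nlinarith
  have sR0 : 0 ≤ Real.sqrt (2 - α) * Real.sqrt β := by positivity
  have sR2 : Real.sqrt (2 - α) * Real.sqrt β ≤ 1 := by
    have := sqrt_mul_sqrt_le (x := 0) (p := 2 - α) (q := β) (by linarith) (by linarith)
    simp only [zero_add] at this
    linarith
  have m1 := mul_le_mul_of_nonneg_left lL hd0.le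
  have m2 := mul_le_mul_of_nonneg_left lR hd0.le
  have m3 := mul_le_mul_of_nonneg_left lR' hd0.le
  have m4 := mul_le_mul_of_nonneg_left l0 hd0.le
  have m5 := mul_nonneg hd0.le l0'
  have m6 := mul_le_mul_of_nonneg_left llog hd0.le
  have m7 : d * (2 / Λ) ≤ 2 * (2 / Λ) := mul_le_mul_of_nonneg_right hd2 (by positivity)
  have m8 : d * Real.log (4 * (Λ + 2)) ≤ 2 * Real.log (4 * (Λ + 2)) :=
    mul_le_mul_of_nonneg_right hd2 hlogpos
  have bYL : YL ≤ 3 + Real.log (4 * (Λ + 2)) := by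
    rw [eYL]; linarith only [pL, hαβ, hβα, hβ, hα, m1, m8, sL, sαpos, m5]
  have bYR : YR ≤ 3 + Real.log (4 * (Λ + 2)) := by
    rw [eYR]; linarith only [pR', m2, m8, sR2, l0R]
  have bdiff : YL - YR ≤ 2 - Real.sqrt α + 2 / Λ := by
    rw [eYL, eYR]; linarith only [pL, pR, m1, m3, m6, m7, m4, sL, sR0]
  exact ⟨bYL, bYR, bdiff⟩

/-- The endpoint condition forces the endpoint with the larger defect `α` to be close to the edge
of the window if the charges are close to arithmetic progressions. -/
theorem sqrt_defect_le {n θ e α β : ℝ} {M : ℕ} {r l : ℕ → ℝ} (hn : 0 < n) (hθ : 0 ≤ θ)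
    (hθ1 : θ ≤ 1 / 2) (he : 0 ≤ e) (hM : 1 ≤ M) (hα : 0 < α) (hβ : 0 < β) (hβα : β ≤ α)
    (hαβ : α + β < 2) (hr0 : ∀ k < M, 0 ≤ r k) (hl0 : ∀ k < M, 0 ≤ l k)
    (hr : ∀ k < M, r k ≤ (1 + θ) * (2 / n) * (k + 1 : ℕ) + e)
    (hl : ∀ k < M, (1 - θ) * (2 / n) * (k + 1 : ℕ) - e ≤ l k)
    (hcond : ∑ k ∈ Finset.range M, (Real.sqrt ((r k + β) / (r k + (2 - α))) - 1) +
      ∑ k ∈ Finset.range M, (Real.sqrt ((l k + (2 - β)) / (l k + α)) - 1) = n) :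
    Real.sqrt α ≤ 2 / (2 / n * M) + 3 * θ * (3 + Real.log (4 * (2 / n * M + 2))) +
      4 * e / Real.sqrt α + 2 * (2 / n) + e := by
  set ρ : ℝ := 2 / n with hρd
  have hρ : 0 < ρ := by positivity
  have hA : 0 < 2 - α := by linarith
  have hA' : 0 < 2 - β := by linarith
  have hqpR : β ≤ 2 - α := by linarith
  have hqpL : α ≤ 2 - β := by linarith
  have hM' : (1 : ℝ) ≤ M := by exact_mod_cast hM
  set Λ : ℝ := ρ * M with hΛd
  have hΛ : 0 < Λ := by positivity
  have hL := sum_le_of_antitone (fun x hx => hasDerivAt_primUp hA' hα hx)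
    (antitoneOn_up hα hqpL) (fun x hx => up_nonneg hα hqpL hx)
    (by have : 0 ≤ 1 - θ := by linarith
        positivity : 0 ≤ (1 - θ) * ρ) he hl0 hl
  have hR := le_sum_of_antitone (fun x hx => hasDerivAt_primDown hA hβ hx)
    (antitoneOn_down hA hqpR) (fun x hx => down_nonneg hA hqpR hx)
    (by positivity : 0 ≤ (1 + θ) * ρ) he hr0 hr
  set SL := ∑ k ∈ Finset.range M, (Real.sqrt ((l k + (2 - β)) / (l k + α)) - 1) with hSL
  set SR := ∑ k ∈ Finset.range M, (1 - Real.sqrt ((r k + β) / (r k + (2 - α)))) with hSR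
  -- The summands of the charges beyond the smaller gap `β` are negative, so the condition is a
  -- difference of two nonnegative sums.
  have hcond' : SL - SR = n := by
    rw [← hcond, hSR, hSL]
    simp only [Finset.sum_sub_distrib]
    ring
  have monoUp : ∀ x x', 0 ≤ x → x ≤ x' → primUp (2 - β) α x ≤ primUp (2 - β) α x' := by
    intro x x' hx hxx
    have := (mul_le_sub_of_antitone (fun x hx => hasDerivAt_primUp hA' hα hx)
      (antitoneOn_up hα hqpL) hx hxx).1
    have h2 := mul_nonneg (up_nonneg hα hqpL (hx.trans hxx)) (sub_nonneg.2 hxx)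
    linarith
  have monoDown : ∀ x x', 0 ≤ x → x ≤ x' → primDown (2 - α) β x ≤ primDown (2 - α) β x' := by
    intro x x' hx hxx
    have := (mul_le_sub_of_antitone (fun x hx => hasDerivAt_primDown hA hβ hx)
      (antitoneOn_down hA hqpR) hx hxx).1
    have h2 := mul_nonneg (down_nonneg hA hqpR (hx.trans hxx)) (sub_nonneg.2 hxx)
    linarith
  set YL := primUp (2 - β) α Λ - primUp (2 - β) α 0 with hYL
  set YR := primDown (2 - α) β Λ - primDown (2 - α) β 0 with hYR
  have hYL0 : 0 ≤ YL := sub_nonneg.2 (monoUp 0 Λ le_rfl hΛ.le)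
  have hYR0 : 0 ≤ YR := sub_nonneg.2 (monoDown 0 Λ le_rfl hΛ.le)
  set fL := Real.sqrt ((0 + (2 - β)) / (0 + α)) - 1 with hfL
  have hfL0 : 0 ≤ fL := up_nonneg hα hqpL le_rfl
  have hL2 : (1 - θ) * (ρ * SL) ≤ YL + e * fL := by
    have h1 := monoUp ((1 - θ) * ρ * M) Λ
      (by have : 0 ≤ 1 - θ := by linarith
          positivity) (by rw [hΛd]; linarith only [mul_nonneg hθ hΛ.le, hΛd])
    rw [hYL, ← mul_assoc]
    linarith
  have hR2 : YR - ((1 + θ) * ρ + e) ≤ (1 + θ) * (ρ * SR) := by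
    have h1 := monoDown Λ ((1 + θ) * ρ * M) hΛ.le
      (by rw [hΛd]; linarith only [mul_nonneg hθ hΛ.le, hΛd])
    have h2 : ((1 + θ) * ρ + e) * (1 - Real.sqrt ((0 + β) / (0 + (2 - α)))) ≤
        ((1 + θ) * ρ + e) * 1 :=
      mul_le_mul_of_nonneg_left (by linarith [Real.sqrt_nonneg ((0 + β) / (0 + (2 - α)))])
        (by positivity)
    rw [hYR, ← mul_assoc]
    linarith
  have hρSL : ρ * SL ≤ YL + 2 * θ * YL + 2 * (e * fL) := by
    have hefL : 0 ≤ e * fL := mul_nonneg he hfL0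
    have h1 : ρ * SL ≤ (YL + e * fL) / (1 - θ) := by
      rw [le_div_iff₀ (by linarith)]; linarith
    -- `1/(1 - θ) ≤ 1 + 2θ` because `θ ≤ 1/2`.
    have h2 : (YL + e * fL) / (1 - θ) ≤ (YL + e * fL) * (1 + 2 * θ) := by
      rw [div_le_iff₀ (by linarith)]
      have h3 := mul_nonneg (add_nonneg hYL0 hefL)
        (mul_nonneg hθ (by linarith only [hθ1] : 0 ≤ 1 - 2 * θ))
      linarith only [h3]
    have h4 := mul_nonneg hefL (by linarith only [hθ1] : 0 ≤ 1 - 2 * θ)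
    linarith only [h1, h2, h4]
  have hρSR : YR - θ * YR - ((1 + θ) * ρ + e) ≤ ρ * SR := by
    by_contra hc
    have hc' := not_le.1 hc
    have : (1 + θ) * (ρ * SR) < (1 + θ) * (YR - θ * YR - ((1 + θ) * ρ + e)) :=
      mul_lt_mul_of_pos_left hc' (by linarith)
    have h3 : 0 ≤ θ * ((1 + θ) * ρ + e) := by positivity
    have h4 : (1 + θ) * (YR - θ * YR - ((1 + θ) * ρ + e)) =
        YR - ((1 + θ) * ρ + e) - θ * θ * YR - θ * ((1 + θ) * ρ + e) := by ring
    have h5 := mul_nonneg (mul_nonneg hθ hθ) hYR0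
    linarith
  -- Multiplied by `ρ = 2/n` the condition reads exactly `2`, the same `2` as in the third bound of
  -- `primitive_bounds`; they cancel and leave `√α` against the errors.
  have hmain : 2 ≤ YL - YR + 2 * θ * YL + θ * YR + 2 * (e * fL) + ((1 + θ) * ρ + e) := by
    have : ρ * SL - ρ * SR = 2 := by rw [← mul_sub, hcond', hρd]; field_simp
    linarith
  obtain ⟨bYL, bYR, bdiff⟩ := primitive_bounds hα hβ hβα hαβ hΛ
  -- The absolute displacement `e` is amplified by the value of the summand at distance `0`, of
  -- order `α^(-1/2)`.
  have hfL2 : fL ≤ 2 / Real.sqrt α := by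
    have h1 : Real.sqrt ((0 + (2 - β)) / (0 + α)) ≤ 2 / Real.sqrt α := by
      rw [zero_add, zero_add, Real.sqrt_div hA'.le]
      gcongr
      rw [Real.sqrt_le_left (by norm_num)]
      linarith
    rw [hfL]; linarith
  have n1 : e * fL ≤ e * (2 / Real.sqrt α) := mul_le_mul_of_nonneg_left hfL2 he
  have n2 := mul_le_mul_of_nonneg_left bYL hθ
  have n3 := mul_le_mul_of_nonneg_left bYR hθ
  have n4 : θ * ρ ≤ ρ := mul_le_of_le_one_left hρ.le (by linarith only [hθ1])
  have n5 : 4 * e / Real.sqrt α = 2 * (e * (2 / Real.sqrt α)) := by ring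
  rw [n5]
  linarith only [hmain, bdiff, n1, n2, n3, n4]


/-! ### The semicircle distribution function -/

lemma continuous_rhoSC : Continuous rhoSC := by
  unfold rhoSC; fun_prop

lemma rhoSC_le_one (x : ℝ) : rhoSC x ≤ 1 := by
  unfold rhoSC
  have h1 : Real.sqrt (4 - x ^ 2) ≤ 2 := by
    rw [Real.sqrt_le_left (by norm_num)]; nlinarith [sq_nonneg x]
  rw [div_le_one (by positivity)]
  linarith [Real.pi_gt_three]

lemma rhoSC_neg (x : ℝ) : rhoSC (-x) = rhoSC x := by simp [rhoSC]

/-- This uses `(√a - √b)² ≤ |a - b|` and that `4 - x²` is 4-Lipschitz on `[-2, 2]`. The Hölder form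
holds up to the edges with a constant independent of `κ`. -/
lemma abs_rhoSC_sub_le {x y : ℝ} (hx : x ∈ Set.Icc (-2 : ℝ) 2) (hy : y ∈ Set.Icc (-2 : ℝ) 2) :
    |rhoSC x - rhoSC y| ≤ Real.sqrt |x - y| := by
  have ha : 0 ≤ 4 - x ^ 2 := by nlinarith [hx.1, hx.2]
  have hb : 0 ≤ 4 - y ^ 2 := by nlinarith [hy.1, hy.2]
  have h1 : |Real.sqrt (4 - x ^ 2) - Real.sqrt (4 - y ^ 2)| ≤ 2 * Real.sqrt |x - y| := by
    rw [show (2 : ℝ) = Real.sqrt (2 ^ 2) by rw [Real.sqrt_sq (by norm_num)],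
      ← Real.sqrt_mul (by norm_num)]
    refine Real.abs_le_sqrt ?_
    have e1 := Real.sq_sqrt ha
    have e2 := Real.sq_sqrt hb
    have s1 := Real.sqrt_nonneg (4 - x ^ 2)
    have s2 := Real.sqrt_nonneg (4 - y ^ 2)
    calc (Real.sqrt (4 - x ^ 2) - Real.sqrt (4 - y ^ 2)) ^ 2
        = |Real.sqrt (4 - x ^ 2) - Real.sqrt (4 - y ^ 2)| *
          |Real.sqrt (4 - x ^ 2) - Real.sqrt (4 - y ^ 2)| := by rw [abs_mul_abs_self, sq]
      _ ≤ |Real.sqrt (4 - x ^ 2) - Real.sqrt (4 - y ^ 2)| *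
          |Real.sqrt (4 - x ^ 2) + Real.sqrt (4 - y ^ 2)| := by
          refine mul_le_mul_of_nonneg_left ?_ (abs_nonneg _)
          rw [abs_of_nonneg (add_nonneg s1 s2), abs_le]
          constructor <;> linarith
      _ = |x - y| * |x + y| := by
          rw [← abs_mul, mul_comm, ← sq_sub_sq, e1, e2, ← abs_mul, ← abs_neg]
          congr 1; ring
      _ ≤ |x - y| * 4 := by
          refine mul_le_mul_of_nonneg_left ?_ (abs_nonneg _)
          rw [abs_le]; constructor <;> linarith [hx.1, hx.2, hy.1, hy.2]
      _ = 2 ^ 2 * |x - y| := by ring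
  unfold rhoSC
  rw [← sub_div, abs_div, abs_of_pos (by positivity : (0 : ℝ) < 2 * Real.pi),
    div_le_iff₀ (by positivity)]
  nlinarith [Real.sqrt_nonneg |x - y|, Real.pi_gt_three]

/-- The distribution function of the semicircle law. -/
def scCDF (x : ℝ) : ℝ := ∫ t in (-2 : ℝ)..x, rhoSC t

lemma hasDerivAt_scCDF (x : ℝ) : HasDerivAt scCDF (rhoSC x) x :=
  intervalIntegral.integral_hasDerivAt_right (continuous_rhoSC.intervalIntegrable _ _)
    (continuous_rhoSC.stronglyMeasurableAtFilter _ _) continuous_rhoSC.continuousAt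

lemma exists_scCDF_sub_eq {x x' : ℝ} (h : x ≤ x') :
    ∃ ξ ∈ Set.Icc x x', scCDF x' - scCDF x = rhoSC ξ * (x' - x) := by
  rcases h.eq_or_lt with rfl | h
  · exact ⟨x, by simp, by simp⟩
  obtain ⟨c, hc, he⟩ := exists_hasDerivAt_eq_slope scCDF rhoSC h
    (fun t _ => (hasDerivAt_scCDF t).continuousAt.continuousWithinAt)
    (fun t _ => hasDerivAt_scCDF t)
  refine ⟨c, Set.Ioo_subset_Icc_self hc, ?_⟩
  rw [he]; field_simp [(sub_pos.2 h).ne']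

lemma scCDF_sub_le {x x' : ℝ} (h : x ≤ x') : scCDF x' - scCDF x ≤ x' - x := by
  obtain ⟨ξ, _, he⟩ := exists_scCDF_sub_eq h
  rw [he]
  exact mul_le_of_le_one_left (sub_nonneg.2 h) (rhoSC_le_one ξ)

lemma scCDF_sub_neg (x : ℝ) : scCDF 2 - scCDF x = scCDF (-x) := by
  have h1 : scCDF 2 - scCDF x = ∫ t in x..2, rhoSC t := by
    unfold scCDF
    exact intervalIntegral.integral_interval_sub_left (continuous_rhoSC.intervalIntegrable _ _)
      (continuous_rhoSC.intervalIntegrable _ _)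
  rw [h1, scCDF, ← intervalIntegral.integral_comp_neg]
  simp [rhoSC_neg]

lemma scCDF_two : scCDF 2 = 1 := by
  have h1 : scCDF 2 = ∫ t in (2 * (-1 : ℝ))..(2 * 1), rhoSC t := by norm_num [scCDF]
  rw [h1, ← intervalIntegral.smul_integral_comp_mul_left]
  have h2 : ∀ x : ℝ, rhoSC (2 * x) = (1 / Real.pi) * Real.sqrt (1 - x ^ 2) := by
    intro x
    unfold rhoSC
    rw [show 4 - (2 * x) ^ 2 = 2 ^ 2 * (1 - x ^ 2) by ring, Real.sqrt_mul (by norm_num),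
      Real.sqrt_sq (by norm_num)]
    field_simp
  simp_rw [h2]
  rw [intervalIntegral.integral_const_mul, integral_sqrt_one_sub_sq]
  have := Real.pi_pos
  simp only [smul_eq_mul]
  field_simp

lemma scCDF_zero : scCDF 0 = 1 / 2 := by
  have := scCDF_sub_neg 0
  rw [scCDF_two, neg_zero] at this
  linarith

/-- On `[-2, -2 + κ]` one has `4 - x² ≤ 4κ`, and `π > 3`. The factor `1/3` lies below `1/2`, and the
margin `κ^(3/2)/6` later keeps indices above `N κ^(3/2)/2` in the bulk. -/
lemma scCDF_left {κ : ℝ} (hκ : 0 < κ) :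
    scCDF (-2 + κ) ≤ κ ^ (3 / 2 : ℝ) / 3 := by
  obtain ⟨ξ, hξ, he⟩ := exists_scCDF_sub_eq (by linarith : -2 ≤ -2 + κ)
  have h0 : scCDF (-2) = 0 := by simp [scCDF]
  have h1 : rhoSC ξ ≤ Real.sqrt κ / 3 := by
    unfold rhoSC
    have h2 : Real.sqrt (4 - ξ ^ 2) ≤ 2 * Real.sqrt κ := by
      rw [show (2 : ℝ) = Real.sqrt (2 ^ 2) by rw [Real.sqrt_sq (by norm_num)],
        ← Real.sqrt_mul (by norm_num)]
      refine Real.sqrt_le_sqrt ?_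
      nlinarith [hξ.1, hξ.2, sq_nonneg (ξ + 2)]
    rw [div_le_iff₀ (by positivity)]
    nlinarith [Real.sqrt_nonneg κ, Real.pi_gt_three]
  have h3 : κ ^ (3 / 2 : ℝ) = Real.sqrt κ * κ := by
    rw [Real.sqrt_eq_rpow, ← Real.rpow_add_one hκ.ne']; norm_num
  rw [h0, sub_zero] at he
  rw [he, h3]
  nlinarith

lemma scCDF_right {κ : ℝ} (hκ : 0 < κ) :
    1 - κ ^ (3 / 2 : ℝ) / 3 ≤ scCDF (2 - κ) := by
  have := scCDF_sub_neg (2 - κ)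
  rw [scCDF_two, show -(2 - κ) = -2 + κ by ring] at this
  linarith [scCDF_left hκ]

lemma rhoSC_ge {κ x : ℝ} (hκ : 0 < κ) (hκ1 : κ ≤ 1) (hx : x ∈ Set.Icc (-2 + κ) (2 - κ)) :
    Real.sqrt κ / 7 ≤ rhoSC x := by
  unfold rhoSC
  have h1 : Real.sqrt κ ≤ Real.sqrt (4 - x ^ 2) := by
    refine Real.sqrt_le_sqrt ?_
    nlinarith [hx.1, hx.2, mul_nonneg (sub_nonneg.2 hx.1) (sub_nonneg.2 hx.2)]
  gcongr
  linarith [Real.pi_lt_d2]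

/-! ### Counting functions -/

section

variable {N : ℕ} {lam : Fin N → ℝ}

/-- The number of points below `x`. -/
def lowCount {N : ℕ} (lam : Fin N → ℝ) (x : ℝ) : ℕ := Set.ncard {i : Fin N | lam i < x}

lemma lowCount_mono {x x' : ℝ} (h : x ≤ x') : lowCount lam x ≤ lowCount lam x' :=
  Set.ncard_le_ncard (fun _ hi => lt_of_lt_of_le hi h) (Set.toFinite _)

lemma lowCount_apply (hlam : StrictMono lam) (i : Fin N) : lowCount lam (lam i) = i := by
  have : {j : Fin N | lam j < lam i} = (Finset.Iio i : Finset (Fin N)) := by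
    ext j; simp [hlam.lt_iff_lt]
  rw [lowCount, this, Set.ncard_coe_finset, Fin.card_Iio]

lemma lowCount_add_le (η E : ℝ) :
    lowCount lam (E + η / 2) ≤ lowCount lam (E - η / 2) + count lam η E := by
  refine le_trans (Set.ncard_le_ncard (t := {i | lam i < E - η / 2} ∪
    {i | lam i ∈ Set.Icc (E - η / 2) (E + η / 2)}) (fun i hi => ?_) (Set.toFinite _))
    (Set.ncard_union_le _ _)
  have hi' : lam i < E + η / 2 := hi
  rcases lt_or_ge (lam i) (E - η / 2) with h | h
  · exact Or.inl h
  · exact Or.inr ⟨h, hi'.le⟩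

/-- The extra `1` accounts for a point exactly at the right end of the closed window, which
`lowCount` omits; there is at most one. -/
lemma lowCount_add_ge (hlam : StrictMono lam) (η E : ℝ) (hη : 0 ≤ η) :
    lowCount lam (E - η / 2) + count lam η E ≤ lowCount lam (E + η / 2) + 1 := by
  have h1 : Set.ncard ({i | lam i < E - η / 2} ∪
      {i : Fin N | lam i ∈ Set.Icc (E - η / 2) (E + η / 2)}) =
      lowCount lam (E - η / 2) + count lam η E := by
    refine Set.ncard_union_eq ?_ (Set.toFinite _) (Set.toFinite _)
    rw [Set.disjoint_left]
    intro i hi hi'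
    exact absurd hi'.1 (not_le.2 hi)
  have h2 : Set.ncard {i : Fin N | lam i = E + η / 2} ≤ 1 := by
    rw [Set.ncard_le_one (Set.toFinite _)]
    intro i hi j hj
    exact hlam.injective (Eq.trans hi hj.symm)
  rw [← h1]
  refine le_trans (Set.ncard_le_ncard (t := {i | lam i < E + η / 2} ∪
    {i : Fin N | lam i = E + η / 2}) ?_ (Set.toFinite _)) ((Set.ncard_union_le _ _).trans
      (Nat.add_le_add_left h2 _))
  rintro i (hi | hi)
  · have hi' : lam i < E - η / 2 := hi
    exact Or.inl (show lam i < E + η / 2 by linarith)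
  · rcases hi.2.lt_or_eq with h | h
    · exact Or.inl h
    · exact Or.inr h

lemma lowCount_zero (hlam : StrictMono lam) :
    lowCount lam 0 ≤ Set.ncard {i : Fin N | lam i ≤ 0} ∧
      Set.ncard {i : Fin N | lam i ≤ 0} ≤ lowCount lam 0 + 1 := by
  constructor
  · exact Set.ncard_le_ncard (fun i (hi : lam i < 0) => hi.le) (Set.toFinite _)
  · have h2 : Set.ncard {i : Fin N | lam i = 0} ≤ 1 := by
      rw [Set.ncard_le_one (Set.toFinite _)]
      intro i hi j hj
      exact hlam.injective (Eq.trans hi hj.symm)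
    refine le_trans (Set.ncard_le_ncard (t := {i | lam i < 0} ∪
      {i : Fin N | lam i = 0}) (fun i hi => ?_) (Set.toFinite _)) ((Set.ncard_union_le _ _).trans
      (Nat.add_le_add_left h2 _))
    exact lt_or_eq_of_le (show lam i ≤ 0 from hi)

variable {κ W δ θ : ℝ}

/-- Discrepancy of the counting function in one window of length `W / N`. -/
lemma abs_lowCount_window_le (hlam : StrictMono lam) (hN : 0 < N) (hW : 0 < W) (hκ : 0 < κ)
    (hcount : ∀ E ∈ Set.Icc (-2 + κ / 2) (2 - κ / 2),
      |(count lam (W / N) E : ℝ) / W - rhoSC E| ≤ δ)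
    (hθ : δ + 1 / W + Real.sqrt (W / N) ≤ θ) {x : ℝ} (hx1 : -2 + κ / 2 ≤ x)
    (hx2 : x + W / N ≤ 2 - κ / 2) :
    |((lowCount lam (x + W / N) : ℝ) - lowCount lam x) - N * (scCDF (x + W / N) - scCDF x)| ≤
      θ * W := by
  have hN' : (0 : ℝ) < N := by exact_mod_cast hN
  set η := W / N with hη
  have hη0 : 0 < η := by positivity
  have hNη : N * η = W := by rw [hη]; field_simp
  set E := x + η / 2 with hE
  have e1 : E - η / 2 = x := by rw [hE]; ring
  have e2 : E + η / 2 = x + η := by rw [hE]; ring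
  have c1 := lowCount_add_le (lam := lam) η E
  have c2 := lowCount_add_ge hlam η E hη0.le
  rw [e1, e2] at c1 c2
  have c1' : (lowCount lam (x + η) : ℝ) ≤ lowCount lam x + count lam η E := by exact_mod_cast c1
  have c2' : (lowCount lam x : ℝ) + count lam η E ≤ lowCount lam (x + η) + 1 := by
    exact_mod_cast c2
  have hEm : E ∈ Set.Icc (-2 + κ / 2) (2 - κ / 2) := ⟨by linarith, by linarith⟩
  have h3 := hcount E hEm
  have h4 : |(count lam η E : ℝ) - W * rhoSC E| ≤ W * δ := by
    have : (count lam η E : ℝ) - W * rhoSC E = W * ((count lam η E : ℝ) / W - rhoSC E) := by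
      field_simp
    rw [this, abs_mul, abs_of_pos hW]
    exact mul_le_mul_of_nonneg_left h3 hW.le
  obtain ⟨ξ, hξ, he⟩ := exists_scCDF_sub_eq (by linarith : x ≤ x + η)
  have h5 : |rhoSC E - rhoSC ξ| ≤ Real.sqrt η := by
    refine (abs_rhoSC_sub_le ⟨by linarith, by linarith⟩
      ⟨by linarith [hξ.1], by linarith [hξ.2]⟩).trans (Real.sqrt_le_sqrt ?_)
    rw [abs_le]; constructor <;> linarith [hξ.1, hξ.2]
  have h6 : |W * rhoSC E - N * (scCDF (x + η) - scCDF x)| ≤ W * Real.sqrt η := by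
    have : W * rhoSC E - N * (scCDF (x + η) - scCDF x) = W * (rhoSC E - rhoSC ξ) := by
      rw [he, ← hNη]; ring
    rw [this, abs_mul, abs_of_pos hW]
    exact mul_le_mul_of_nonneg_left h5 hW.le
  -- The three parts of `θ`: `δ` from the count estimate, `1/W` from the right end of the window,
  -- `√(W/N)` from the variation of the density inside it.
  have h7 : W * δ + 1 + W * Real.sqrt η ≤ θ * W := by
    have := mul_le_mul_of_nonneg_left hθ hW.le
    have h8 : W * (δ + 1 / W + Real.sqrt η) = W * δ + 1 + W * Real.sqrt η := by field_simp
    linarith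
  rw [abs_le] at h4 h6 ⊢
  constructor <;> linarith [h4.1, h4.2, h6.1, h6.2]

/-- Discrepancy of the counting function against the semicircle law. -/
lemma abs_lowCount_sub_le (hlam : StrictMono lam) (hN : 0 < N) (hW : 0 < W) (hκ : 0 < κ)
    (hcount : ∀ E ∈ Set.Icc (-2 + κ / 2) (2 - κ / 2),
      |(count lam (W / N) E : ℝ) / W - rhoSC E| ≤ δ)
    (hθ : δ + 1 / W + Real.sqrt (W / N) ≤ θ) (hθ0 : 0 ≤ θ) (hθ1 : θ ≤ 1) {x x' : ℝ}
    (hx1 : -2 + κ / 2 ≤ x) (hxx : x ≤ x') (hx2 : x' + W / N ≤ 2 - κ / 2) :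
    |((lowCount lam x' : ℝ) - lowCount lam x) - N * (scCDF x' - scCDF x)| ≤
      θ * (N * (x' - x)) + 2 * W := by
  have hN' : (0 : ℝ) < N := by exact_mod_cast hN
  set η := W / N with hη
  have hη0 : 0 < η := by positivity
  have hNη : N * η = W := by rw [hη]; field_simp
  have hind : ∀ q : ℕ, x + q * η ≤ 2 - κ / 2 →
      |((lowCount lam (x + q * η) : ℝ) - lowCount lam x) -
        N * (scCDF (x + q * η) - scCDF x)| ≤ q * (θ * W) := by
    intro q
    induction q with
    | zero => intro _; simp
    | succ q ih =>
      intro hq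
      have e : x + ((q + 1 : ℕ) : ℝ) * η = (x + q * η) + η := by push_cast; ring
      rw [e] at hq ⊢
      have h1 := ih (by linarith)
      have h2 := abs_lowCount_window_le hlam hN hW hκ hcount hθ (x := x + q * η)
        (by have : 0 ≤ (q : ℝ) * η := by positivity
            linarith) hq
      rw [← hη] at h2
      have h3 := abs_add_le (((lowCount lam (x + q * η) : ℝ) - lowCount lam x) -
        N * (scCDF (x + q * η) - scCDF x)) (((lowCount lam (x + q * η + η) : ℝ) -
        lowCount lam (x + q * η)) - N * (scCDF (x + q * η + η) - scCDF (x + q * η)))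
      push_cast
      refine le_trans (le_of_eq ?_) (h3.trans (by linarith))
      congr 1; ring
  -- `x'` is bracketed by `q` and `q + 1` windows. The partial window costs at most `W`, since the
  -- density is at most `1`, and the additional window at most `θ W ≤ W`; this is the `2 W`.
  set q := ⌊(x' - x) / η⌋₊ with hq
  have hq1 : q * η ≤ x' - x := by
    rw [← le_div_iff₀ hη0]; exact Nat.floor_le (div_nonneg (by linarith) hη0.le)
  have hq2 : x' - x < (q + 1) * η := by
    rw [← div_lt_iff₀ hη0]; exact Nat.lt_floor_add_one _
  have a1 := hind q (by linarith)
  have a2 := hind (q + 1) (by push_cast; linarith)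
  push_cast at a2
  have m1 : (lowCount lam (x + q * η) : ℝ) ≤ lowCount lam x' := by
    exact Nat.cast_le.2 (lowCount_mono (by linarith))
  have m2 : (lowCount lam x' : ℝ) ≤ lowCount lam (x + (q + 1) * η) := by
    exact Nat.cast_le.2 (lowCount_mono (by linarith))
  have f1 := mul_le_mul_of_nonneg_left (scCDF_sub_le (by linarith : x + q * η ≤ x')) hN'.le
  have f2 := mul_le_mul_of_nonneg_left
    (scCDF_sub_le (by linarith : x' ≤ x + (q + 1) * η)) hN'.le
  have f3 : (N : ℝ) * (x' - (x + q * η)) ≤ W := by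
    rw [← hNη]; exact mul_le_mul_of_nonneg_left (by linarith) hN'.le
  have f4 : (N : ℝ) * (x + (q + 1) * η - x') ≤ W := by
    rw [← hNη]; exact mul_le_mul_of_nonneg_left (by linarith) hN'.le
  have g1 : (q : ℝ) * (θ * W) ≤ θ * (N * (x' - x)) := by
    have := mul_le_mul_of_nonneg_left hq1 (mul_nonneg hθ0 hN'.le)
    have e : (q : ℝ) * (θ * W) = θ * N * (q * η) := by rw [← hNη]; ring
    rw [e]; linarith
  have g2 : θ * W ≤ W := mul_le_of_le_one_left hW.le hθ1
  rw [abs_le] at a1 a2 ⊢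
  constructor <;> linarith [a1.1, a1.2, a2.1, a2.2]

end


/-! ### Location and rigidity of the points of a good configuration -/

section

variable {N : ℕ} {lam : Fin N → ℝ} {κ W δ θ ω D : ℝ}

/-- The points with index at least `N κ ^ (3/2) / 2` lie to the right of `-2 + κ`. -/
lemma le_of_index_ge (hlam : StrictMono lam) (hN : 0 < N) (hW : 0 < W) (hκ : 0 < κ) (hκ1 : κ ≤ 1)
    (hcount : ∀ E ∈ Set.Icc (-2 + κ / 2) (2 - κ / 2),
      |(count lam (W / N) E : ℝ) / W - rhoSC E| ≤ δ)
    (hθ : δ + 1 / W + Real.sqrt (W / N) ≤ θ) (hθ0 : 0 ≤ θ) (hθ1 : θ ≤ 1)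
    (hWN : W / N ≤ κ / 2) (h0 : (lowCount lam 0 : ℝ) ≤ N / 2 + ω * N)
    (hsmall : ω * N + 2 * θ * N + 2 * W + 1 < κ ^ (3 / 2 : ℝ) / 6 * N) {i : Fin N}
    (hi : N * κ ^ (3 / 2 : ℝ) / 2 ≤ i) : -2 + κ ≤ lam i := by
  by_contra! hlt
  have hN' : (0 : ℝ) < N := by exact_mod_cast hN
  -- The count at `0` anchors absolute indices: fewer than `N κ^(3/2) (1/3 + 1/6)` points lie below
  -- `-2 + κ`, which contradicts the lower bound on `i`.
  have h1 := abs_lowCount_sub_le hlam hN hW hκ hcount hθ hθ0 hθ1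
    (by linarith : -2 + κ / 2 ≤ -2 + κ) (by linarith : -2 + κ ≤ 0) (by linarith)
  have h2 : ((i : ℕ) : ℝ) ≤ lowCount lam (-2 + κ) := by
    rw [← lowCount_apply hlam i]
    exact Nat.cast_le.2 (lowCount_mono hlt.le)
  have h3 := mul_le_mul_of_nonneg_left (scCDF_left hκ) hN'.le
  rw [abs_le, scCDF_zero] at h1
  have h4 : θ * (N * (0 - (-2 + κ))) ≤ 2 * θ * N := by
    have : 0 ≤ θ * N * κ := by positivity
    linarith
  linarith [h1.1, h1.2]

/-- The points with index at most `N (1 - κ ^ (3/2) / 2)` lie to the left of `2 - κ`. -/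
lemma le_of_index_le (hlam : StrictMono lam) (hN : 0 < N) (hW : 0 < W) (hκ : 0 < κ) (hκ1 : κ ≤ 1)
    (hcount : ∀ E ∈ Set.Icc (-2 + κ / 2) (2 - κ / 2),
      |(count lam (W / N) E : ℝ) / W - rhoSC E| ≤ δ)
    (hθ : δ + 1 / W + Real.sqrt (W / N) ≤ θ) (hθ0 : 0 ≤ θ) (hθ1 : θ ≤ 1)
    (hWN : W / N ≤ κ / 2) (h0 : (N : ℝ) / 2 - ω * N - 1 ≤ lowCount lam 0)
    (hsmall : ω * N + 2 * θ * N + 2 * W + 1 < κ ^ (3 / 2 : ℝ) / 6 * N) {i : Fin N}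
    (hi : (i : ℝ) ≤ N * (1 - κ ^ (3 / 2 : ℝ) / 2)) : lam i ≤ 2 - κ := by
  by_contra! hlt
  have hN' : (0 : ℝ) < N := by exact_mod_cast hN
  have h1 := abs_lowCount_sub_le hlam hN hW hκ hcount hθ hθ0 hθ1
    (by linarith : -2 + κ / 2 ≤ 0) (by linarith : 0 ≤ 2 - κ) (by linarith)
  have h2 : (lowCount lam (2 - κ) : ℝ) ≤ ((i : ℕ) : ℝ) := by
    rw [← lowCount_apply hlam i]
    exact Nat.cast_le.2 (lowCount_mono hlt.le)
  have h3 := mul_le_mul_of_nonneg_left (scCDF_right hκ) hN'.le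
  rw [abs_le, scCDF_zero] at h1
  have h4 : θ * (N * (2 - κ - 0)) ≤ 2 * θ * N := by
    have : 0 ≤ θ * N * κ := by positivity
    linarith
  linarith [h1.1, h1.2]

/-- Index differences in a short bulk interval are proportional to distances. -/
lemma abs_index_sub_le (hlam : StrictMono lam) (hN : 0 < N) (hW : 0 < W) (hκ : 0 < κ)
    (hcount : ∀ E ∈ Set.Icc (-2 + κ / 2) (2 - κ / 2),
      |(count lam (W / N) E : ℝ) / W - rhoSC E| ≤ δ)
    (hθ : δ + 1 / W + Real.sqrt (W / N) ≤ θ) (hθ0 : 0 ≤ θ) (hθ1 : θ ≤ 1)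
    (hWN : W / N ≤ κ / 2) {i₀ i j j₀ : Fin N} (h1 : i₀ ≤ i) (h2 : i ≤ j) (h3 : j ≤ j₀)
    (hi₀ : -2 + κ ≤ lam i₀) (hj₀ : lam j₀ ≤ 2 - κ) (hD : lam j₀ - lam i₀ ≤ D) :
    |((j : ℝ) - i) - N * rhoSC (lam i₀) * (lam j - lam i)| ≤
      (θ + Real.sqrt D) * (N * (lam j - lam i)) + 2 * W := by
  have m1 := hlam.monotone h1
  have m2 := hlam.monotone h2
  have m3 := hlam.monotone h3
  have a := abs_lowCount_sub_le hlam hN hW hκ hcount hθ hθ0 hθ1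
    (by linarith : -2 + κ / 2 ≤ lam i) m2 (by linarith)
  rw [lowCount_apply hlam, lowCount_apply hlam] at a
  obtain ⟨ξ, hξ, he⟩ := exists_scCDF_sub_eq m2
  -- The density is frozen at the leftmost point; its variation over a length `D` costs `√D`.
  have b : |rhoSC ξ - rhoSC (lam i₀)| ≤ Real.sqrt D := by
    refine (abs_rhoSC_sub_le ⟨by linarith [hξ.1], by linarith [hξ.2]⟩
      ⟨by linarith, by linarith⟩).trans (Real.sqrt_le_sqrt ?_)
    rw [abs_le]; constructor <;> linarith [hξ.1, hξ.2]
  have hpos : 0 ≤ (N : ℝ) * (lam j - lam i) := mul_nonneg (Nat.cast_nonneg _) (by linarith)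
  have c := mul_le_mul_of_nonneg_right b hpos
  rw [← abs_of_nonneg hpos, ← abs_mul, abs_of_nonneg hpos] at c
  rw [he] at a
  rw [abs_le] at a c ⊢
  constructor <;> linarith [a.1, a.2, c.1, c.2]

/-- The length of a bulk interval is controlled by the number of points in it. -/
lemma length_le (hlam : StrictMono lam) (hN : 0 < N) (hW : 0 < W) (hκ : 0 < κ) (hκ1 : κ ≤ 1)
    (hcount : ∀ E ∈ Set.Icc (-2 + κ / 2) (2 - κ / 2),
      |(count lam (W / N) E : ℝ) / W - rhoSC E| ≤ δ)
    (hθ : δ + 1 / W + Real.sqrt (W / N) ≤ θ) (hθ0 : 0 ≤ θ) (hθ1 : θ ≤ 1)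
    (hθκ : θ ≤ Real.sqrt κ / 14)
    (hWN : W / N ≤ κ / 2) {i₀ j₀ : Fin N} (h : i₀ ≤ j₀)
    (hi₀ : -2 + κ ≤ lam i₀) (hj₀ : lam j₀ ≤ 2 - κ) :
    lam j₀ - lam i₀ ≤ 14 * ((j₀ : ℝ) - i₀ + 2 * W) / (Real.sqrt κ * N) := by
  have hN' : (0 : ℝ) < N := by exact_mod_cast hN
  have hs := Real.sqrt_pos.2 hκ
  have m := hlam.monotone h
  have a := abs_lowCount_sub_le hlam hN hW hκ hcount hθ hθ0 hθ1
    (by linarith : -2 + κ / 2 ≤ lam i₀) m (by linarith)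
  rw [lowCount_apply hlam, lowCount_apply hlam] at a
  obtain ⟨ξ, hξ, he⟩ := exists_scCDF_sub_eq m
  have b := rhoSC_ge hκ hκ1 (x := ξ) ⟨by linarith [hξ.1], by linarith [hξ.2]⟩
  have hpos : 0 ≤ (N : ℝ) * (lam j₀ - lam i₀) := mul_nonneg hN'.le (by linarith)
  have c1 := mul_le_mul_of_nonneg_right b hpos
  -- `θ` is at most half of the lower bound `√κ/7` for the density, so a density of at least `√κ/14`
  -- remains.
  have c2 := mul_le_mul_of_nonneg_right hθκ hpos
  rw [he] at a
  rw [abs_le] at a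
  rw [le_div_iff₀ (by positivity)]
  linarith [a.1]

end

/-- Comparison of a ratio of two approximately counted lengths with the ratio of the counts. -/
lemma abs_ratio_sub_le {n k W θ X Y : ℝ} (hn : 0 < n) (hk : 0 ≤ k) (hW : 1 ≤ W) (hθ : 0 ≤ θ)
    (hs : 8 * (θ + W / n) ≤ 1) (hX : 0 ≤ X) (hY : 0 < Y) (hkX : |k - X| ≤ θ * X + 2 * W)
    (hnY : |(n + 1) - Y| ≤ θ * Y + 2 * W) :
    |2 * X / Y - 2 / n * (k + 1)| ≤ 8 * (θ + W / n) * (2 / n * (k + 1)) + 8 * (W / n) := by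
  set ω := W / n with hω
  have hWe : W = ω * n := by rw [hω]; field_simp
  have hω0 : 0 < ω := by positivity
  set s := θ + ω with hsdef
  have hs0 : 0 < s := by positivity
  rw [abs_le] at hkX hnY
  -- After clearing denominators, `k ≈ X` and `n + 1 ≈ Y` are multiplied crosswise; the mismatches
  -- between `k`, `k + 1` and `n`, `n + 1` are absorbed through `W ≥ 1`.
  have key : |n * X - (k + 1) * Y| ≤ (8 * s * (k + 1) + 4 * W) * Y := by
    have x1 : X * (1 - θ) ≤ k + 2 * W := by linarith [hkX.1]
    have x2 : k - 2 * W ≤ X * (1 + θ) := by linarith [hkX.2]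
    have y1 : n * (1 - 2 * ω) ≤ Y * (1 + θ) := by linarith [hnY.2]
    have y2 : Y * (1 - θ) ≤ n * (1 + 3 * ω) := by linarith [hnY.1]
    have t1 : 1 + θ ≤ (1 + 8 * s) * ((1 - θ) * (1 - 2 * ω)) := by
      have : 1 - 2 * s ≤ (1 - θ) * (1 - 2 * ω) := by
        have : 0 ≤ θ * ω := by positivity
        rw [hsdef]; linarith
      have := mul_le_mul_of_nonneg_left this (by positivity : 0 ≤ 1 + 8 * s)
      nlinarith
    have t2 : (1 - 8 * s) * ((1 + θ) * (1 + 3 * ω)) ≤ 1 - θ := by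
      have : (1 + θ) * (1 + 3 * ω) ≤ 1 + 4 * s := by
        have : θ * ω ≤ 1 / 8 * θ := by nlinarith
        rw [hsdef]; linarith
      have := mul_le_mul_of_nonneg_left this (by linarith : 0 ≤ 1 - 8 * s)
      nlinarith
    have p1 : 0 < (1 - θ) * (1 - 2 * ω) := mul_pos (by linarith) (by linarith)
    have p2 : 0 < (1 + θ) * (1 + 3 * ω) := by positivity
    have q1 : n * X ≤ Y * (k + 2 * W) * (1 + 8 * s) := by
      refine le_of_mul_le_mul_right ?_ p1
      calc n * X * ((1 - θ) * (1 - 2 * ω)) = (X * (1 - θ)) * (n * (1 - 2 * ω)) := by ring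
        _ ≤ (k + 2 * W) * (Y * (1 + θ)) :=
          mul_le_mul x1 y1 (mul_nonneg hn.le (by linarith)) (by linarith)
        _ = Y * (k + 2 * W) * (1 + θ) := by ring
        _ ≤ Y * (k + 2 * W) * ((1 + 8 * s) * ((1 - θ) * (1 - 2 * ω))) :=
          mul_le_mul_of_nonneg_left t1 (mul_nonneg hY.le (by linarith))
        _ = _ := by ring
    have q2 : (Y * (k - 2 * W)) * (1 - 8 * s) ≤ n * X := by
      rcases le_or_gt k (2 * W) with h | h
      · refine le_trans (mul_nonpos_of_nonpos_of_nonneg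
          (mul_nonpos_of_nonneg_of_nonpos hY.le (by linarith)) (by linarith)) (by positivity)
      · refine le_of_mul_le_mul_right ?_ p2
        calc (Y * (k - 2 * W)) * (1 - 8 * s) * ((1 + θ) * (1 + 3 * ω))
            = (Y * (k - 2 * W)) * ((1 - 8 * s) * ((1 + θ) * (1 + 3 * ω))) := by ring
          _ ≤ (Y * (k - 2 * W)) * (1 - θ) :=
            mul_le_mul_of_nonneg_left t2 (mul_nonneg hY.le (by linarith))
          _ = (k - 2 * W) * (Y * (1 - θ)) := by ring
          _ ≤ (X * (1 + θ)) * (n * (1 + 3 * ω)) :=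
            mul_le_mul x2 y2 (mul_nonneg hY.le (by linarith)) (by positivity)
          _ = _ := by ring
    have hYW : 0 ≤ Y * W := by positivity
    have e1 : Y * W * (8 * s) ≤ Y * W := mul_le_of_le_one_right hYW hs
    have e2 : Y ≤ Y * W := le_mul_of_one_le_right hY.le hW
    have e3 : 0 ≤ Y * s := by positivity
    rw [abs_le]
    constructor
    · nlinarith
    · nlinarith
  have e : 2 * X / Y - 2 / n * (k + 1) = 2 / (n * Y) * (n * X - (k + 1) * Y) := by
    field_simp
  rw [e, abs_mul, abs_of_pos (by positivity)]
  refine (mul_le_mul_of_nonneg_left key (by positivity)).trans (le_of_eq ?_)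
  rw [hω]
  field_simp
  ring


/-! ### Rigidity of the external points -/

section

variable {N L n M : ℕ} {lam : Fin N → ℝ} {y : ℤ → ℝ} {κ W δ θ D Θ : ℝ}

/-- Rigidity of the distances of the external points from the window, relative to its length. -/
lemma external_rigidity (hlam : StrictMono lam) (hn : 0 < n) (hW : 1 ≤ W) (hκ : 0 < κ)
    (hκ1 : κ ≤ 1)
    (hcount : ∀ E ∈ Set.Icc (-2 + κ / 2) (2 - κ / 2),
      |(count lam (W / N) E : ℝ) / W - rhoSC E| ≤ δ)
    (hθ : δ + 1 / W + Real.sqrt (W / N) ≤ θ) (hθ0 : 0 ≤ θ) (hθ1 : θ ≤ 1)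
    (hθκ : θ ≤ Real.sqrt κ / 14) (hWN : W / N ≤ κ / 2)
    (hM : 1 ≤ M) (hML : M ≤ L) (hMN : L + n + M ≤ N)
    (hl : ∀ i : Fin N, (i : ℕ) + M = L → -2 + κ ≤ lam i)
    (hr : ∀ i : Fin N, (i : ℕ) + 1 = L + n + M → lam i ≤ 2 - κ)
    (hD : 14 * ((n : ℝ) + 2 * M + 2 * W) / (Real.sqrt κ * N) ≤ D)
    (hΘ : 7 * (θ + Real.sqrt D) / Real.sqrt κ ≤ Θ) (hΘ1 : 8 * (Θ + W / n) ≤ 1)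
    (hyr : ∀ k < M, ∀ i : Fin N, (i : ℕ) = L + n + k → y ((k : ℤ) + 1) = lam i)
    (hyl : ∀ k < M, ∀ i : Fin N, (i : ℕ) + k + 1 = L → y (-((k : ℤ) + 1)) = lam i) :
    y (-1) < y 1 ∧ ∀ k < M,
      |2 * (y ((k : ℤ) + 1) - y 1) / (y 1 - y (-1)) - 2 / n * ((k : ℝ) + 1)| ≤
        8 * (Θ + W / n) * (2 / n * ((k : ℝ) + 1)) + 8 * (W / n) ∧
      |2 * (y (-1) - y (-((k : ℤ) + 1))) / (y 1 - y (-1)) - 2 / n * ((k : ℝ) + 1)| ≤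
        8 * (Θ + W / n) * (2 / n * ((k : ℝ) + 1)) + 8 * (W / n) := by
  have hN : 0 < N := by omega
  have hN' : (0 : ℝ) < N := by exact_mod_cast hN
  have hn' : (0 : ℝ) < n := by exact_mod_cast hn
  have hs := Real.sqrt_pos.2 hκ
  have hW0 : 0 < W := by linarith
  -- The outermost points used. Counting from `0`, `y_(-M)` has index `L - M` and `y_M` has index `L
  -- + n + M - 1`.
  let i₀ : Fin N := ⟨L - M, by omega⟩
  let j₀ : Fin N := ⟨L + n + M - 1, by omega⟩
  have hi₀ : -2 + κ ≤ lam i₀ := hl i₀ (by simp only [i₀]; omega)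
  have hj₀ : lam j₀ ≤ 2 - κ := hr j₀ (by simp only [j₀]; omega)
  have hij : i₀ ≤ j₀ := by simp only [i₀, j₀, Fin.mk_le_mk]; omega
  have hlen : lam j₀ - lam i₀ ≤ D := by
    refine (length_le hlam hN hW0 hκ hκ1 hcount hθ hθ0 hθ1 hθκ hWN hij hi₀ hj₀).trans
      (le_trans ?_ hD)
    gcongr
    have h1 : ((j₀ : ℕ) : ℝ) + 1 = L + n + M := by
      have : (j₀ : ℕ) + 1 = L + n + M := by simp only [j₀]; omega
      exact_mod_cast this
    have h2 : ((i₀ : ℕ) : ℝ) + M = L := by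
      have : (i₀ : ℕ) + M = L := by simp only [i₀]; omega
      exact_mod_cast this
    linarith
  -- One value of the density serves all pairs of points, and it cancels when lengths are divided by
  -- the length of the window.
  set ρ := rhoSC (lam i₀) with hρ
  have hρκ : Real.sqrt κ / 7 ≤ ρ :=
    rhoSC_ge hκ hκ1 ⟨hi₀, (hlam.monotone hij).trans hj₀⟩
  have hρ0 : 0 < ρ := lt_of_lt_of_le (by positivity) hρκ
  have hΘ0 : 0 ≤ Θ := le_trans (by positivity) hΘ
  have hΘ' : θ + Real.sqrt D ≤ Θ * ρ := by
    have h1 : θ + Real.sqrt D ≤ Θ * (Real.sqrt κ / 7) := by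
      rw [div_le_iff₀ hs] at hΘ; linarith
    exact h1.trans (mul_le_mul_of_nonneg_left hρκ hΘ0)
  have main : ∀ i j : Fin N, i₀ ≤ i → i ≤ j → j ≤ j₀ →
      |((j : ℝ) - i) - N * ρ * (lam j - lam i)| ≤ Θ * (N * ρ * (lam j - lam i)) + 2 * W := by
    intro i j h1 h2 h3
    refine (abs_index_sub_le hlam hN hW0 hκ hcount hθ hθ0 hθ1 hWN h1 h2 h3 hi₀ hj₀ hlen).trans ?_
    have h4 : 0 ≤ (N : ℝ) * (lam j - lam i) :=
      mul_nonneg hN'.le (sub_nonneg.2 (hlam.monotone h2))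
    have := mul_le_mul_of_nonneg_right hΘ' h4
    linarith
  let u : Fin N := ⟨L - 1, by omega⟩
  let v : Fin N := ⟨L + n, by omega⟩
  have hu : y (-1) = lam u := by
    simpa using hyl 0 hM u (by simp only [u]; omega)
  have hv : y 1 = lam v := by
    simpa using hyr 0 hM v (by simp only [v]; omega)
  have huv : lam u < lam v := hlam (by simp only [u, v, Fin.mk_lt_mk]; omega)
  have hY : |((n : ℝ) + 1) - N * ρ * (lam v - lam u)| ≤
      Θ * (N * ρ * (lam v - lam u)) + 2 * W := by
    have := main u v (by simp only [i₀, u, Fin.mk_le_mk]; omega)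
      (by simp only [u, v, Fin.mk_le_mk]; omega) (by simp only [j₀, v, Fin.mk_le_mk]; omega)
    have e : ((v : ℕ) : ℝ) - (u : ℕ) = n + 1 := by
      have : (v : ℕ) = (u : ℕ) + (n + 1) := by simp only [u, v]; omega
      rw [this]; push_cast; ring
    rwa [e] at this
  have hY0 : 0 < N * ρ * (lam v - lam u) := mul_pos (by positivity) (sub_pos.2 huv)
  rw [hu, hv]
  refine ⟨huv, fun k hk => ⟨?_, ?_⟩⟩
  · let j : Fin N := ⟨L + n + k, by omega⟩
    have hj := hyr k hk j rfl
    have hvj : v ≤ j := by simp only [v, j, Fin.mk_le_mk]; omega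
    have hX := main v j (by simp only [i₀, v, Fin.mk_le_mk]; omega) hvj
      (by simp only [j₀, j, Fin.mk_le_mk]; omega)
    have e : ((j : ℕ) : ℝ) - (v : ℕ) = k := by
      simp only [j, v]; push_cast; ring
    rw [e] at hX
    have := abs_ratio_sub_le hn' (Nat.cast_nonneg k) hW hΘ0 hΘ1
      (mul_nonneg (by positivity) (sub_nonneg.2 (hlam.monotone hvj))) hY0 hX hY
    rw [hj]
    convert this using 3
    rw [show 2 * (N * ρ * (lam j - lam v)) = (N * ρ) * (2 * (lam j - lam v)) by ring,
      mul_div_mul_left _ _ (by positivity)]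
  · let j : Fin N := ⟨L - 1 - k, by omega⟩
    have hj := hyl k hk j (by simp only [j]; omega)
    have hvj : j ≤ u := by simp only [u, j, Fin.mk_le_mk]; omega
    have hX := main j u (by simp only [i₀, j, Fin.mk_le_mk]; omega) hvj
      (by simp only [j₀, u, Fin.mk_le_mk]; omega)
    have e : ((u : ℕ) : ℝ) - (j : ℕ) = k := by
      have : (u : ℕ) = (j : ℕ) + k := by simp only [u, j]; omega
      rw [this]; push_cast; ring
    rw [e] at hX
    have := abs_ratio_sub_le hn' (Nat.cast_nonneg k) hW hΘ0 hΘ1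
      (mul_nonneg (by positivity) (sub_nonneg.2 (hlam.monotone hvj))) hY0 hX hY
    rw [hj]
    convert this using 3
    rw [show 2 * (N * ρ * (lam u - lam j)) = (N * ρ) * (2 * (lam u - lam j)) by ring,
      mul_div_mul_left _ _ (by positivity)]

end

/-! ### Asymptotics of the parameters -/

lemma eventually_mul_rpow_le (C : ℝ) {a b : ℝ} (h : a < b) :
    ∀ᶠ x : ℝ in atTop, C * x ^ a ≤ x ^ b := by
  filter_upwards [(tendsto_rpow_atTop (sub_pos.2 h)).eventually_ge_atTop C,
    eventually_gt_atTop 0] with x hx h0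
  have : x ^ b = x ^ (b - a) * x ^ a := by rw [← Real.rpow_add h0]; ring_nf
  rw [this]
  exact mul_le_mul_of_nonneg_right hx (Real.rpow_nonneg h0.le _)

lemma eventually_mul_rpow_neg_lt (C : ℝ) {a c : ℝ} (ha : a < 0) (hc : 0 < c) :
    ∀ᶠ x : ℝ in atTop, C * x ^ a < c := by
  have h := (tendsto_rpow_neg_atTop (neg_pos.2 ha)).const_mul C
  rw [mul_zero, neg_neg] at h
  exact h.eventually_lt_const hc

variable {p : Params}

lemma one_le_n (p : Params) (N : ℕ) : 1 ≤ p.n N := by unfold Params.n; omega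

lemma one_le_nr (p : Params) (N : ℕ) : 1 ≤ p.nr N := by exact_mod_cast one_le_n p N

lemma tendsto_nr (hp : p.Admissible) : Tendsto p.nr atTop atTop := by
  have h1 : Tendsto (fun N : ℕ => (N : ℝ) ^ p.ε - 1) atTop atTop :=
    tendsto_atTop_add_const_right _ _
      ((tendsto_rpow_atTop hp.ε_pos).comp tendsto_natCast_atTop_atTop)
  refine tendsto_atTop_mono (fun N => ?_) h1
  have := Nat.lt_floor_add_one ((N : ℝ) ^ p.ε / 2)
  simp only [Params.nr, Params.n]
  push_cast
  linarith

lemma nr_le (hp : p.Admissible) {N : ℕ} (hN : 1 ≤ N) : p.nr N ≤ 2 * (N : ℝ) ^ p.ε := by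
  have h1 : (1 : ℝ) ≤ (N : ℝ) ^ p.ε :=
    Real.one_le_rpow (by exact_mod_cast hN) hp.ε_pos.le
  have := Nat.floor_le (by positivity : 0 ≤ (N : ℝ) ^ p.ε / 2)
  simp only [Params.nr, Params.n]
  push_cast
  linarith

lemma eventually_nr_sq_le (hp : p.Admissible) : ∀ᶠ N : ℕ in atTop, p.nr N ^ 2 ≤ N := by
  have h := tendsto_natCast_atTop_atTop.eventually
    (eventually_mul_rpow_le 4 (by norm_num : (1 / 5 : ℝ) < 1))
  filter_upwards [h, eventually_ge_atTop 1] with N h hN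
  rw [Real.rpow_one] at h
  have hN' : (1 : ℝ) ≤ N := by exact_mod_cast hN
  refine le_trans ?_ h
  calc p.nr N ^ 2 ≤ (2 * (N : ℝ) ^ p.ε) ^ 2 := by
        gcongr; exact nr_le hp hN
    _ = 4 * (N : ℝ) ^ (p.ε * 2) := by
        rw [mul_pow, Real.rpow_mul (by positivity), Real.rpow_two]; norm_num
    _ ≤ 4 * (N : ℝ) ^ (1 / 5 : ℝ) := by
        gcongr
        linarith [hp.ε_le]

/-- `Bε < 1/2` enters here: the `n^B` points on either side then fill a length `O(N^(-1/2))`, on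
which the density is nearly constant. -/
lemma nr_rpow_le (hp : p.Admissible) {N : ℕ} (hN : 1 ≤ N) :
    p.nr N ^ p.B ≤ 2 ^ p.B * Real.sqrt N := by
  have hN' : (1 : ℝ) ≤ N := by exact_mod_cast hN
  have hB : 0 ≤ p.B := by linarith [hp.B_ge]
  calc p.nr N ^ p.B ≤ (2 * (N : ℝ) ^ p.ε) ^ p.B :=
        Real.rpow_le_rpow (by positivity) (nr_le hp hN) hB
    _ = 2 ^ p.B * (N : ℝ) ^ (p.ε * p.B) := by
        rw [Real.mul_rpow (by norm_num) (by positivity), Real.rpow_mul (by positivity)]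
    _ ≤ 2 ^ p.B * Real.sqrt N := by
        rw [Real.sqrt_eq_rpow]
        gcongr
        linarith [hp.Bε_lt]

/-- A dyadic scale `2 ^ m n ^ γ` comparable with `√n`. -/
lemma exists_scale (hp : p.Admissible) {N : ℕ} (hN : p.nr N ^ 2 ≤ N) :
    ∃ m : ℕ, (m : ℝ) ≤ Real.log N ∧ 2 ^ m * p.nr N ^ p.γ ≤ p.nr N ^ (1 / 2 : ℝ) ∧
      p.nr N ^ (1 / 2 : ℝ) ≤ 2 * (2 ^ m * p.nr N ^ p.γ) := by
  have h1 := one_le_nr p N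
  set x := p.nr N with hx
  have hx0 : 0 < x := by linarith
  have hge : 1 ≤ x ^ (1 / 2 - p.γ) := Real.one_le_rpow h1 (by linarith [hp.γ_le])
  obtain ⟨m, hm1, hm2⟩ := exists_nat_pow_near hge (by norm_num : (1 : ℝ) < 2)
  have e : x ^ (1 / 2 : ℝ) = x ^ (1 / 2 - p.γ) * x ^ p.γ := by
    rw [← Real.rpow_add hx0]; ring_nf
  have hpos : 0 < x ^ p.γ := Real.rpow_pos_of_pos hx0 _
  refine ⟨m, ?_, ?_, ?_⟩
  -- From `(2^m)² ≤ n² ≤ N` follows `2 m log 2 ≤ log N`, and `2 log 2 > 1`.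
  · have h2 : (2 : ℝ) ^ m ≤ x := hm1.trans (by
      conv_rhs => rw [← Real.rpow_one x]
      exact Real.rpow_le_rpow_of_exponent_le h1 (by linarith [hp.γ_pos]))
    have h3 : ((2 : ℝ) ^ m) ^ 2 ≤ N := le_trans (by gcongr) hN
    have h4 := Real.log_le_log (by positivity) h3
    rw [Real.log_pow, Real.log_pow] at h4
    have := Real.log_two_gt_d9
    push_cast at h4
    nlinarith [Nat.cast_nonneg (α := ℝ) m]
  · rw [e]; exact mul_le_mul_of_nonneg_right hm1 hpos.le
  · rw [e, ← mul_assoc, ← pow_succ']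
    exact mul_le_mul_of_nonneg_right hm2.le hpos.le


/-! ### Rigid external configurations -/

/-- The rescaled external points with `|k| ≤ M`, the ones entering the potential, are close to the
two lattices `±(1 + 2 k / n)`. -/
structure Params.Rigid (p : Params) (N L : ℕ) (y : ℤ → ℝ) (M : ℕ) : Prop where
  one_le : 1 ≤ M
  lt_rpow : (M : ℝ) < p.nr N ^ p.B
  rpow_le : p.nr N ^ p.B ≤ M + 1
  sum_cutoff : ∀ g : ℤ → ℝ, ∑ k ∈ p.cutoff N L, g k =
    ∑ k ∈ Finset.range M, g ((k : ℤ) + 1) + ∑ k ∈ Finset.range M, g (-((k : ℤ) + 1))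
  mem_cutoff : ∀ k : ℤ, k ∈ p.cutoff N L ↔ ∃ j < M, k = (j : ℤ) + 1 ∨ k = -((j : ℤ) + 1)
  lt : y (-1) < y 1
  right_ge : ∀ k < M, 1 ≤ rescaled y ((k : ℤ) + 1)
  left_le : ∀ k < M, rescaled y (-((k : ℤ) + 1)) ≤ -1
  right : ∀ k < M, |rescaled y ((k : ℤ) + 1) - 1 - 2 / p.nr N * ((k : ℝ) + 1)| ≤
    p.nr N ^ (-(1 / 10) : ℝ) * (2 / p.nr N * ((k : ℝ) + 1)) + p.nr N ^ (-(1 / 3) : ℝ)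
  left : ∀ k < M, |-1 - rescaled y (-((k : ℤ) + 1)) - 2 / p.nr N * ((k : ℝ) + 1)| ≤
    p.nr N ^ (-(1 / 10) : ℝ) * (2 / p.nr N * ((k : ℝ) + 1)) + p.nr N ^ (-(1 / 3) : ℝ)

lemma rescaled_sub_one {y : ℤ → ℝ} (h : y (-1) < y 1) (k : ℤ) :
    rescaled y k - 1 = 2 * (y k - y 1) / (y 1 - y (-1)) := by
  have : 0 < y 1 - y (-1) := by linarith
  rw [rescaled, abs_of_pos this]
  field_simp
  ring

lemma neg_one_sub_rescaled {y : ℤ → ℝ} (h : y (-1) < y 1) (k : ℤ) :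
    -1 - rescaled y k = 2 * (y (-1) - y k) / (y 1 - y (-1)) := by
  have : 0 < y 1 - y (-1) := by linarith
  rw [rescaled, abs_of_pos this]
  field_simp
  ring

variable {p : Params}

lemma mem_cutoff_iff {N L M : ℕ} (h1 : (M : ℝ) < p.nr N ^ p.B) (h2 : p.nr N ^ p.B ≤ M + 1)
    (hML : M ≤ L) (hMN : L + p.n N + M ≤ N) (k : ℤ) :
    k ∈ p.cutoff N L ↔ ∃ j < M, k = (j : ℤ) + 1 ∨ k = -((j : ℤ) + 1) := by
  simp only [Params.cutoff, Params.J, Finset.mem_filter, Finset.mem_erase, Finset.mem_Icc]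
  constructor
  · rintro ⟨⟨h0, -⟩, hk⟩
    have h3 : |k| < (M : ℤ) + 1 := by
      have : (|k| : ℝ) < M + 1 := hk.trans_le h2
      exact_mod_cast this
    rw [abs_lt] at h3
    refine ⟨k.natAbs - 1, by omega, by omega⟩
  · rintro ⟨j, hj, hk⟩
    refine ⟨⟨by omega, by omega, by omega⟩, lt_of_le_of_lt ?_ h1⟩
    have : |k| ≤ (M : ℤ) := abs_le.2 ⟨by omega, by omega⟩
    exact_mod_cast this

lemma sum_cutoff_eq {N L M : ℕ} (h1 : (M : ℝ) < p.nr N ^ p.B) (h2 : p.nr N ^ p.B ≤ M + 1)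
    (hML : M ≤ L) (hMN : L + p.n N + M ≤ N) (g : ℤ → ℝ) :
    ∑ k ∈ p.cutoff N L, g k =
      ∑ k ∈ Finset.range M, g ((k : ℤ) + 1) + ∑ k ∈ Finset.range M, g (-((k : ℤ) + 1)) := by
  have : p.cutoff N L = (Finset.range M).image (fun k : ℕ => (k : ℤ) + 1) ∪
      (Finset.range M).image (fun k : ℕ => -((k : ℤ) + 1)) := by
    ext k
    rw [mem_cutoff_iff h1 h2 hML hMN]
    simp only [Finset.mem_union, Finset.mem_image, Finset.mem_range]
    grind
  rw [this, Finset.sum_union, Finset.sum_image, Finset.sum_image]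
  · intro a _ b _ h; simpa using h
  · intro a _ b _ h; simpa using h
  · rw [Finset.disjoint_left]
    intro k hk hk'
    simp only [Finset.mem_image] at hk hk'
    omega

/-- A good external configuration extends to a good global configuration. -/
lemma exists_goodGlobal {N L : ℕ} {τ : ℝ} {f : (Fin N → ℝ) → ℝ} {y : ℤ → ℝ}
    (hy : y ∈ p.goodExternal N τ f L) (h : p.C₀ * Real.exp (-(p.nr N ^ (p.γ / 12))) < 1) :
    ∃ lam ∈ p.goodGlobal N,
      (∀ (k : ℕ) (i : Fin N), (i : ℕ) = L + p.n N + k → y ((k : ℤ) + 1) = lam i) ∧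
      ∀ (k : ℕ) (i : Fin N), (i : ℕ) + k + 1 = L → y (-((k : ℤ) + 1)) = lam i := by
  obtain ⟨x, hx⟩ : ∃ x, p.glue N L y x ∈ p.goodGlobal N := by
    -- Positive conditional probability makes `Ω_y` nonempty, and any of its members supplies the
    -- global configuration.
    by_contra! hne
    have h1 : p.goodSection N L y = ∅ := Set.eq_empty_iff_forall_notMem.2 hne
    have h2 := hy.2.1
    rw [h1, measure_empty, nonpos_iff_eq_zero, ENNReal.ofReal_eq_zero] at h2
    linarith
  refine ⟨_, hx, fun k i hi => ?_, fun k i hi => ?_⟩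
  · rw [Params.glue, dif_neg (by omega), dif_neg (by omega)]
    congr 1
    rw [hi]; push_cast; ring
  · rw [Params.glue, dif_pos (by omega)]
    congr 1
    omega

set_option maxHeartbeats 1000000 in
/-- For large `N`, the good external configurations are rigid. -/
theorem eventually_rigid (hp : p.Admissible) : ∀ᶠ N : ℕ in atTop, ∀ (τ : ℝ)
    (f : (Fin N → ℝ) → ℝ), ∀ L ∈ p.goodIndices N τ f, ∀ y ∈ p.goodExternal N τ f L,
      p.Rigid N L y (⌈p.nr N ^ p.B⌉₊ - 1) := by
  have hκ := hp.κ_pos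
  have hγ := hp.γ_pos
  have hB := hp.B_ge
  have hC₀ := hp.C₀_pos
  set z := p.κ ^ (3 / 2 : ℝ) with hz
  have hz0 : 0 < z := Real.rpow_pos_of_pos hκ _
  have hs := Real.sqrt_pos.2 hκ
  -- `A n^(-1)` will bound the length of the stretch of points with `|k| ≤ M`, and `C n^(-7/60)` the
  -- resulting relative error of index differences.
  set A := 70 * 2 ^ p.B / Real.sqrt p.κ with hA
  have hA0 : 0 < A := by positivity
  set C := 7 * (5 + Real.sqrt A) / Real.sqrt p.κ with hC
  have hC0 : 0 < C := by positivity
  have hT := tendsto_nr hp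
  have hexp : ∀ᶠ x : ℝ in atTop, p.C₀ * Real.exp (-(x ^ (p.γ / 12))) < 1 := by
    have h := (Real.tendsto_exp_neg_atTop_nhds_zero.comp
      (tendsto_rpow_atTop (by linarith : 0 < p.γ / 12))).const_mul p.C₀
    rw [mul_zero] at h
    exact h.eventually_lt_const one_pos
  filter_upwards [eventually_nr_sq_le hp, eventually_ge_atTop 1,
    hT.eventually (eventually_ge_atTop 4),
    hT.eventually (eventually_mul_rpow_le (8 * (C + 1))
      (by norm_num : (-(7 / 60) : ℝ) < -(1 / 10))),
    hT.eventually (eventually_mul_rpow_le 8 (by norm_num : (-(1 / 2) : ℝ) < -(1 / 3))),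
    hT.eventually (eventually_mul_rpow_neg_lt 5 (by norm_num : (-(7 / 60) : ℝ) < 0)
      (by positivity : 0 < Real.sqrt p.κ / 14)),
    hT.eventually (eventually_mul_rpow_neg_lt 5 (by norm_num : (-(7 / 60) : ℝ) < 0) one_pos),
    hT.eventually (eventually_mul_rpow_neg_lt 1 (by norm_num : (-1 : ℝ) < 0)
      (by positivity : 0 < p.κ / 2)),
    hT.eventually (eventually_mul_rpow_neg_lt 1 (by linarith : -p.γ / 6 < 0)
      (by positivity : 0 < z / 18)),
    hT.eventually (eventually_mul_rpow_neg_lt 10 (by norm_num : (-(7 / 60) : ℝ) < 0)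
      (by positivity : 0 < z / 18)),
    hT.eventually (eventually_mul_rpow_neg_lt 3 (by norm_num : (-1 : ℝ) < 0)
      (by positivity : 0 < z / 18)),
    hT.eventually (eventually_mul_rpow_neg_lt (2 * 2 ^ p.B) (by norm_num : (-1 : ℝ) < 0)
      (by positivity : 0 < z / 2)),
    hT.eventually hexp]
    with N hsq hN hx4 f1 f2 f3 f3' f4 f5 f5' f5'' f6 f7 τ f L hL y hy
  obtain ⟨lam, hglue, hyr, hyl⟩ := exists_goodGlobal hy f7
  obtain ⟨m, hm, hW1, hW2⟩ := exists_scale hp hsq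
  have hpow := nr_rpow_le hp hN
  set n := p.n N with hn
  set x := p.nr N with hx
  have hnx : (n : ℝ) = x := rfl
  have hx1 : 1 ≤ x := by linarith
  have hx0 : 0 < x := by linarith
  have hN' : (0 : ℝ) < N := by exact_mod_cast hN
  have hL1 := hL.1.1
  have hL2 := hL.1.2.1
  rw [← hz] at hL1 hL2
  -- An index `L` between `N κ^(3/2)` and `N (1 - κ^(3/2))` can exist only if `κ ≤ 1`.
  have hz1 : z ≤ 1 := by
    by_contra! hlt
    have := mul_lt_mul_of_pos_left hlt hN'
    have h0 : (0 : ℝ) ≤ L := Nat.cast_nonneg L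
    linarith
  have hκ1 : p.κ ≤ 1 := by
    by_contra! hlt
    exact absurd (Real.one_lt_rpow hlt (by norm_num : (0 : ℝ) < 3 / 2)) (not_lt.2 hz1)
  obtain ⟨hlam, hcount, hzero, -, -⟩ := hglue
  set W := 2 ^ m * x ^ p.γ with hW
  -- size of the scale
  have hsqrt2 : 2 ≤ x ^ (1 / 2 : ℝ) := by
    rw [← Real.sqrt_eq_rpow]; exact Real.le_sqrt_of_sq_le (by linarith)
  have hWge : 1 ≤ W := by linarith
  have hW0 : 0 < W := by linarith
  have heta : p.eta N m = W / N := rfl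
  have hNeta : (N : ℝ) * p.eta N m = W := by rw [heta]; field_simp
  have hcount' := hcount m hm
  rw [hNeta, heta] at hcount'
  have hWx : W ≤ x := hW1.trans (by
    conv_rhs => rw [← Real.rpow_one x]
    exact Real.rpow_le_rpow_of_exponent_le hx1 (by norm_num))
  have hinv : x ^ (-1 : ℝ) = 1 / x := by rw [Real.rpow_neg_one, one_div]
  have hxN : x ≤ N * x ^ (-1 : ℝ) := by
    rw [hinv, mul_one_div, le_div_iff₀ hx0]; linarith
  have hWN : W / N ≤ x ^ (-1 : ℝ) := by
    rw [div_le_iff₀ hN']; linarith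
  have hWn : W / n ≤ x ^ (-(1 / 2) : ℝ) := by
    rw [hnx, div_le_iff₀ hx0]
    refine hW1.trans (le_of_eq ?_)
    rw [← Real.rpow_add_one hx0.ne']; norm_num
  have hhalf : x ^ (-(1 / 2) : ℝ) ≤ x ^ (-(7 / 60) : ℝ) := Real.rpow_le_rpow_of_exponent_le hx1 (by norm_num)
  -- discrepancy
  have hθ : x ^ (p.γ / 12) / W ^ (1 / 4 : ℝ) + 1 / W + Real.sqrt (W / N) ≤
      5 * x ^ (-(7 / 60) : ℝ) := by
    -- The exponent: `W ≥ √n / 2` and `γ/12 ≤ 1/120` give `1/120 - 1/8 = -7/60`.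
    have d1 : x ^ (p.γ / 12) / W ^ (1 / 4 : ℝ) ≤ 2 * x ^ (-(7 / 60) : ℝ) := by
      have h1 : x ^ (1 / 8 : ℝ) ≤ 2 * W ^ (1 / 4 : ℝ) := by
        calc x ^ (1 / 8 : ℝ) = (x ^ (1 / 2 : ℝ)) ^ (1 / 4 : ℝ) := by
              rw [← Real.rpow_mul hx0.le]; norm_num
          _ ≤ (2 * W) ^ (1 / 4 : ℝ) := Real.rpow_le_rpow (by positivity) hW2 (by norm_num)
          _ = 2 ^ (1 / 4 : ℝ) * W ^ (1 / 4 : ℝ) := Real.mul_rpow (by norm_num) hW0.le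
          _ ≤ 2 * W ^ (1 / 4 : ℝ) := by
              gcongr
              calc (2 : ℝ) ^ (1 / 4 : ℝ) ≤ 2 ^ (1 : ℝ) :=
                    Real.rpow_le_rpow_of_exponent_le (by norm_num) (by norm_num)
                _ = 2 := Real.rpow_one 2
      rw [div_le_iff₀ (Real.rpow_pos_of_pos hW0 _)]
      calc x ^ (p.γ / 12) ≤ x ^ (-(7 / 60) + 1 / 8 : ℝ) :=
            Real.rpow_le_rpow_of_exponent_le hx1 (by linarith [hp.γ_le])
        _ = x ^ (-(7 / 60) : ℝ) * x ^ (1 / 8 : ℝ) := Real.rpow_add hx0 _ _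
        _ ≤ x ^ (-(7 / 60) : ℝ) * (2 * W ^ (1 / 4 : ℝ)) := by gcongr
        _ = _ := by ring
    have d2 : 1 / W ≤ 2 * x ^ (-(1 / 2) : ℝ) := by
      rw [Real.rpow_neg hx0.le, div_le_iff₀ hW0, mul_right_comm, ← div_eq_mul_inv,
        le_div_iff₀ (by positivity)]
      linarith
    have d3 : Real.sqrt (W / N) ≤ x ^ (-(1 / 2) : ℝ) := by
      refine (Real.sqrt_le_sqrt hWN).trans (le_of_eq ?_)
      rw [Real.sqrt_eq_rpow, ← Real.rpow_mul hx0.le]; norm_num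
    linarith
  -- cutoff
  have hxB : x ≤ x ^ p.B := by
    conv_lhs => rw [← Real.rpow_one x]
    exact Real.rpow_le_rpow_of_exponent_le hx1 (by linarith)
  have hceil : 2 ≤ ⌈x ^ p.B⌉₊ := by
    have : (1 : ℝ) < x ^ p.B := by linarith
    exact Nat.lt_ceil.2 (by simpa using this)
  set M := ⌈x ^ p.B⌉₊ - 1 with hM
  have hM1 : 1 ≤ M := by omega
  have hMlt : (M : ℝ) < x ^ p.B := Nat.lt_ceil.1 (by omega)
  have hMge : x ^ p.B ≤ M + 1 := by
    have h1 := Nat.le_ceil (x ^ p.B)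
    have h2 : ⌈x ^ p.B⌉₊ = M + 1 := by omega
    rw [h2] at h1
    exact_mod_cast h1
  have hsqN : Real.sqrt N ≤ N * x ^ (-1 : ℝ) := by
    have h1 : x ≤ Real.sqrt N := Real.le_sqrt_of_sq_le hsq
    rw [hinv, mul_one_div, le_div_iff₀ hx0]
    calc Real.sqrt N * x ≤ Real.sqrt N * Real.sqrt N := by gcongr
      _ = N := Real.mul_self_sqrt hN'.le
  have hpowN : 2 * x ^ p.B ≤ z / 2 * N := by
    have h1 : 2 * 2 ^ p.B * Real.sqrt N ≤ 2 * 2 ^ p.B * (N * x ^ (-1 : ℝ)) := by gcongr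
    have h2 := mul_le_mul_of_nonneg_right f6.le hN'.le
    linarith
  have hML : M ≤ L := by
    have : (M : ℝ) ≤ L := by
      have : 0 ≤ z * N := by positivity
      have : 0 ≤ x ^ p.B := by positivity
      linarith
    exact_mod_cast this
  -- The `n + M ≤ 2 n^B` additional points use up at most half of the margin `N κ^(3/2)`.
  have hMN' : (L : ℝ) + n + M ≤ N * (1 - z / 2) := by linarith
  have hMN : L + n + M ≤ N := by
    have : (L : ℝ) + n + M ≤ N := by
      have : 0 ≤ N * (z / 2) := by positivity
      linarith
    exact_mod_cast this
  -- location
  have hsmall : x ^ (-p.γ / 6) * N + 2 * (5 * x ^ (-(7 / 60) : ℝ)) * N + 2 * W + 1 <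
      z / 6 * N := by
    have g1 := mul_lt_mul_of_pos_right f5 hN'
    have g2 := mul_lt_mul_of_pos_right f5' hN'
    have g3 := mul_lt_mul_of_pos_right f5'' hN'
    linarith
  have hncard : |(Set.ncard {i : Fin N | lam i ≤ 0} : ℝ) - N / 2| ≤ x ^ (-p.γ / 6) * (N / 2) := by
    have : (Set.ncard {i : Fin N | lam i ≤ 0} : ℝ) - N / 2 =
        ((Set.ncard {i : Fin N | lam i ≤ 0} : ℝ) / (N / 2) - 1) * (N / 2) := by field_simp
    rw [this, abs_mul, abs_of_pos (by positivity : (0 : ℝ) < N / 2)]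
    exact mul_le_mul_of_nonneg_right hzero (by positivity)
  rw [abs_le] at hncard
  have hlow := lowCount_zero hlam
  have hlow1 : (lowCount lam 0 : ℝ) ≤ Set.ncard {i : Fin N | lam i ≤ 0} := by
    exact_mod_cast hlow.1
  have hlow2 : (Set.ncard {i : Fin N | lam i ≤ 0} : ℝ) ≤ lowCount lam 0 + 1 := by
    exact_mod_cast hlow.2
  have hω0 : 0 ≤ x ^ (-p.γ / 6) * N := by positivity
  have hWNκ : W / N ≤ p.κ / 2 := by linarith
  have hθ0 : 0 ≤ 5 * x ^ (-(7 / 60) : ℝ) := by positivity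
  have hl : ∀ i : Fin N, (i : ℕ) + M = L → -2 + p.κ ≤ lam i := by
    intro i hi
    refine le_of_index_ge hlam hN hW0 hκ hκ1 hcount' hθ hθ0 f3'.le hWNκ
      (ω := x ^ (-p.γ / 6)) (by linarith) hsmall ?_
    have : ((i : ℕ) : ℝ) + M = L := by exact_mod_cast hi
    rw [← hz]
    linarith
  have hr : ∀ i : Fin N, (i : ℕ) + 1 = L + n + M → lam i ≤ 2 - p.κ := by
    intro i hi
    refine le_of_index_le hlam hN hW0 hκ hκ1 hcount' hθ hθ0 f3'.le hWNκ
      (ω := x ^ (-p.γ / 6)) (by linarith) hsmall ?_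
    have : ((i : ℕ) : ℝ) + 1 = L + n + M := by exact_mod_cast hi
    rw [← hz]
    linarith
  -- density
  have hD : 14 * ((n : ℝ) + 2 * M + 2 * W) / (Real.sqrt p.κ * N) ≤ A * x ^ (-1 : ℝ) := by
    rw [div_le_iff₀ (by positivity), hA]
    have e : 70 * 2 ^ p.B / Real.sqrt p.κ * x ^ (-1 : ℝ) * (Real.sqrt p.κ * N) =
        70 * 2 ^ p.B * (N * x ^ (-1 : ℝ)) := by field_simp
    rw [e]
    have h1 : 70 * 2 ^ p.B * Real.sqrt N ≤ 70 * 2 ^ p.B * (N * x ^ (-1 : ℝ)) := by gcongr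
    linarith
  have hΘ : 7 * (5 * x ^ (-(7 / 60) : ℝ) + Real.sqrt (A * x ^ (-1 : ℝ))) / Real.sqrt p.κ ≤
      C * x ^ (-(7 / 60) : ℝ) := by
    have h1 : Real.sqrt (A * x ^ (-1 : ℝ)) ≤ Real.sqrt A * x ^ (-(7 / 60) : ℝ) := by
      rw [Real.sqrt_mul hA0.le]
      gcongr
      refine le_trans (le_of_eq ?_) hhalf
      rw [Real.sqrt_eq_rpow, ← Real.rpow_mul hx0.le]; norm_num
    rw [hC, div_mul_eq_mul_div (7 * (5 + Real.sqrt A))]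
    refine div_le_div_of_nonneg_right ?_ hs.le
    linarith
  -- Constants are absorbed by weakening the exponent from `-7/60` to `-1/10`.
  have hΘ2 : 8 * (C * x ^ (-(7 / 60) : ℝ) + W / n) ≤ x ^ (-(1 / 10) : ℝ) := by linarith
  have hΘ1 : 8 * (C * x ^ (-(7 / 60) : ℝ) + W / n) ≤ 1 :=
    hΘ2.trans (Real.rpow_le_one_of_one_le_of_nonpos hx1 (by norm_num))
  obtain ⟨hlt, hrig⟩ := external_rigidity hlam (one_le_n p N) hWge hκ hκ1 hcount' hθ hθ0 f3'.le
    f3.le hWNκ hM1 hML hMN hl hr hD hΘ hΘ1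
    (fun k _ => hyr k) (fun k _ => hyl k)
  have hbound : ∀ k : ℕ, 8 * (C * x ^ (-(7 / 60) : ℝ) + W / n) * (2 / n * ((k : ℝ) + 1)) +
      8 * (W / n) ≤ x ^ (-(1 / 10) : ℝ) * (2 / x * ((k : ℝ) + 1)) + x ^ (-(1 / 3) : ℝ) := by
    intro k
    rw [hnx] at hΘ2 hWn ⊢
    have : 0 ≤ 2 / x * ((k : ℝ) + 1) := by positivity
    have := mul_le_mul_of_nonneg_right hΘ2 this
    linarith
  have hpos : 0 < y 1 - y (-1) := sub_pos.2 hlt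
  refine ⟨hM1, hMlt, hMge, sum_cutoff_eq hMlt hMge hML hMN, mem_cutoff_iff hMlt hMge hML hMN,
    hlt, fun k hk => ?_, fun k hk => ?_, fun k hk => ?_, fun k hk => ?_⟩
  · have h1 := hyr k ⟨L + n + k, by omega⟩ rfl
    have h2 := hyr 0 ⟨L + n, by omega⟩ rfl
    simp only [Nat.cast_zero, zero_add] at h2
    have h3 : y 1 ≤ y ((k : ℤ) + 1) := by
      rw [h1, h2]; exact hlam.monotone (by simp)
    have := rescaled_sub_one hlt ((k : ℤ) + 1)
    have h4 : 0 ≤ 2 * (y ((k : ℤ) + 1) - y 1) / (y 1 - y (-1)) :=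
      div_nonneg (by linarith) hpos.le
    linarith
  · have h1 := hyl k ⟨L - 1 - k, by omega⟩ (by simp only; omega)
    have h2 := hyl 0 ⟨L - 1, by omega⟩ (by simp only; omega)
    simp only [Nat.cast_zero, zero_add] at h2
    have h3 : y (-((k : ℤ) + 1)) ≤ y (-1) := by
      rw [h1, h2]; exact hlam.monotone (by simp)
    have := neg_one_sub_rescaled hlt (-((k : ℤ) + 1))
    have h4 : 0 ≤ 2 * (y (-1) - y (-((k : ℤ) + 1))) / (y 1 - y (-1)) :=
      div_nonneg (by linarith) hpos.le
    linarith
  · rw [rescaled_sub_one hlt]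
    exact ((hrig k hk).1).trans (hbound k)
  · rw [neg_one_sub_rescaled hlt]
    exact ((hrig k hk).2).trans (hbound k)


/-! ### Derivatives of the rescaled potential -/

/-- Telescoping: each term is at most an increment of `-1/(1 + h k)`. -/
lemma sum_inv_sq_le {h : ℝ} (hh : 0 < h) (M : ℕ) :
    ∑ k ∈ Finset.range M, h * (1 / (1 + h * ((k : ℝ) + 1)) ^ 2) ≤ 1 - 1 / (1 + h * M) := by
  induction M with
  | zero => simp
  | succ M ih =>
    rw [Finset.sum_range_succ]
    have h1 : 0 < 1 + h * (M : ℝ) := by positivity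
    have h2 : 0 < 1 + h * ((M : ℝ) + 1) := by positivity
    have : h * (1 / (1 + h * ((M : ℝ) + 1)) ^ 2) ≤
        1 / (1 + h * M) - 1 / (1 + h * ((M : ℝ) + 1)) := by
      rw [div_sub_div _ _ h1.ne' h2.ne', mul_one_div, sq]
      refine div_le_div₀ (by linarith) (by linarith) (by positivity) ?_
      exact mul_le_mul_of_nonneg_right (by linarith) h2.le
    push_cast
    linarith

/-- Telescoping, with `1 - 1/t ≤ log t` at the ratio of consecutive arguments. -/
lemma sum_inv_le_log {h : ℝ} (hh : 0 < h) (M : ℕ) :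
    ∑ k ∈ Finset.range M, h * (1 / (1 + h * ((k : ℝ) + 1))) ≤ Real.log (1 + h * M) := by
  induction M with
  | zero => simp
  | succ M ih =>
    rw [Finset.sum_range_succ]
    have h1 : 0 < 1 + h * (M : ℝ) := by positivity
    have h2 : 0 < 1 + h * ((M : ℝ) + 1) := by positivity
    have h3 := Real.one_sub_inv_le_log_of_pos (div_pos h2 h1)
    rw [Real.log_div h2.ne' h1.ne', inv_div] at h3
    have : h * (1 / (1 + h * ((M : ℝ) + 1))) =
        1 - (1 + h * M) / (1 + h * ((M : ℝ) + 1)) := by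
      field_simp; ring
    push_cast
    linarith

section

variable {h θ e m d r : ℝ} {M : ℕ}

/-- Lower bound for the distance to a perturbed lattice point. -/
lemma perturbed_ge {s : ℝ} (hs : 0 ≤ s) (hθ : θ ≤ 1 / 2) (he : e ≤ 1 / 2) (hm : 0 < m)
    (hm1 : m ≤ 1) (hd : m ≤ d) (hr0 : 0 ≤ r) (hr : |r - s| ≤ θ * s + e) :
    m / 2 * (1 + s) ≤ d + r := by
  have h1 := (abs_le.1 hr).1
  have h2 : θ * s ≤ 1 / 2 * s := mul_le_mul_of_nonneg_right hθ hs
  have h3 : (1 + s) / 2 ≤ 1 + r := by linarith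
  have h4 := mul_le_mul_of_nonneg_left h3 hm.le
  have h5 : m * r ≤ r := mul_le_of_le_one_left hr0 hm1
  linarith

/-- The difference is `|r - s|` over two factors of order at least `m (1 + s)`. The relative error
therefore costs a multiple of `1/(1+s)`, and the absolute error a summable `1/(1+s)²`. -/
lemma abs_inv_perturbed_sub_le {s : ℝ} (hs : 0 ≤ s) (hθ0 : 0 ≤ θ) (hθ : θ ≤ 1 / 2) (he0 : 0 ≤ e)
    (he : e ≤ 1 / 2) (hm : 0 < m) (hm1 : m ≤ 1) (hd : m ≤ d) (hr0 : 0 ≤ r)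
    (hr : |r - s| ≤ θ * s + e) :
    |1 / (d + r) - 1 / (d + s)| ≤ 2 / m ^ 2 * (θ * (1 / (1 + s)) + e * (1 / (1 + s) ^ 2)) := by
  have h1 := perturbed_ge hs hθ he hm hm1 hd hr0 hr
  have h2 : m * (1 + s) ≤ d + s := by
    have : m * s ≤ s := mul_le_of_le_one_left hs hm1
    linarith
  have hs1 : 0 < 1 + s := by linarith
  have p1 : 0 < d + r := lt_of_lt_of_le (by positivity) h1
  have p2 : 0 < d + s := lt_of_lt_of_le (by positivity) h2
  have e1 : 1 / (d + r) - 1 / (d + s) = -(r - s) / ((d + r) * (d + s)) := by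
    rw [div_sub_div _ _ p1.ne' p2.ne']; congr 1; ring
  rw [e1, abs_div, abs_neg, abs_of_pos (mul_pos p1 p2)]
  have h3 : m / 2 * (1 + s) * (m * (1 + s)) ≤ (d + r) * (d + s) :=
    mul_le_mul h1 h2 (by positivity) p1.le
  have h4 : |r - s| ≤ θ * (1 + s) + e := by linarith
  calc |r - s| / ((d + r) * (d + s))
      ≤ (θ * (1 + s) + e) / (m / 2 * (1 + s) * (m * (1 + s))) :=
        div_le_div₀ (by positivity) h4 (by positivity) h3
    _ = _ := by field_simp

/-- Comparison of the Stieltjes sum of a perturbed lattice with that of the lattice. -/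
lemma abs_sum_perturbed_sub_le {r : ℕ → ℝ} (hh : 0 < h) (hθ0 : 0 ≤ θ) (hθ : θ ≤ 1 / 2)
    (he0 : 0 ≤ e) (he : e ≤ 1 / 2) (hm : 0 < m) (hm1 : m ≤ 1) (hd : m ≤ d)
    (hr0 : ∀ k < M, 0 ≤ r k)
    (hr : ∀ k < M, |r k - h * ((k : ℝ) + 1)| ≤ θ * (h * ((k : ℝ) + 1)) + e) :
    |h * ∑ k ∈ Finset.range M, 1 / (d + r k) -
      h * ∑ k ∈ Finset.range M, 1 / (d + h * ((k : ℝ) + 1))| ≤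
      2 / m ^ 2 * (θ * Real.log (1 + h * M) + e) := by
  rw [← mul_sub, ← Finset.sum_sub_distrib, abs_mul, abs_of_pos hh]
  have h1 : |∑ k ∈ Finset.range M, (1 / (d + r k) - 1 / (d + h * ((k : ℝ) + 1)))| ≤
      ∑ k ∈ Finset.range M, 2 / m ^ 2 * (θ * (1 / (1 + h * ((k : ℝ) + 1))) +
        e * (1 / (1 + h * ((k : ℝ) + 1)) ^ 2)) := by
    refine (Finset.abs_sum_le_sum_abs _ _).trans (Finset.sum_le_sum fun k hk => ?_)
    rw [Finset.mem_range] at hk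
    exact abs_inv_perturbed_sub_le (by positivity) hθ0 hθ he0 he hm hm1 hd (hr0 k hk) (hr k hk)
  refine (mul_le_mul_of_nonneg_left h1 hh.le).trans ?_
  have h2 := mul_le_mul_of_nonneg_left (sum_inv_le_log hh M) hθ0
  have h3 := mul_le_mul_of_nonneg_left (sum_inv_sq_le hh M) he0
  have h4 : 0 ≤ e * (1 / (1 + h * M)) := by positivity
  have h5 : h * ∑ k ∈ Finset.range M, 2 / m ^ 2 * (θ * (1 / (1 + h * ((k : ℝ) + 1))) +
        e * (1 / (1 + h * ((k : ℝ) + 1)) ^ 2)) =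
      2 / m ^ 2 * (θ * ∑ k ∈ Finset.range M, h * (1 / (1 + h * ((k : ℝ) + 1))) +
        e * ∑ k ∈ Finset.range M, h * (1 / (1 + h * ((k : ℝ) + 1)) ^ 2)) := by
    rw [← Finset.mul_sum, Finset.sum_add_distrib, ← Finset.mul_sum, ← Finset.mul_sum,
      ← Finset.mul_sum, ← Finset.mul_sum]
    ring
  rw [h5]
  refine mul_le_mul_of_nonneg_left ?_ (by positivity)
  linarith

/-- The Stieltjes sums of the two opposite lattices nearly cancel. -/
lemma abs_sum_lattice_sub_le {x : ℝ} (hh : 0 < h) (hm : 0 < m) (hm1 : m ≤ 1)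
    (hx1 : m ≤ 1 - x) (hx2 : m ≤ 1 + x) :
    |h * ∑ k ∈ Finset.range M, 1 / ((1 - x) + h * ((k : ℝ) + 1)) -
      h * ∑ k ∈ Finset.range M, 1 / ((1 + x) + h * ((k : ℝ) + 1))| ≤ 2 / m ^ 2 := by
  rw [← mul_sub, ← Finset.sum_sub_distrib, abs_mul, abs_of_pos hh]
  have h1 : |∑ k ∈ Finset.range M, (1 / ((1 - x) + h * ((k : ℝ) + 1)) -
      1 / ((1 + x) + h * ((k : ℝ) + 1)))| ≤
      ∑ k ∈ Finset.range M, 2 / m ^ 2 * (1 / (1 + h * ((k : ℝ) + 1)) ^ 2) := by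
    refine (Finset.abs_sum_le_sum_abs _ _).trans (Finset.sum_le_sum fun k _ => ?_)
    set s := h * ((k : ℝ) + 1) with hs
    have hs0 : 0 ≤ s := by positivity
    have hms : m * s ≤ s := mul_le_of_le_one_left hs0 hm1
    have p1 : m * (1 + s) ≤ (1 - x) + s := by linarith
    have p2 : m * (1 + s) ≤ (1 + x) + s := by linarith
    have q1 : 0 < (1 - x) + s := lt_of_lt_of_le (by positivity) p1
    have q2 : 0 < (1 + x) + s := lt_of_lt_of_le (by positivity) p2
    have e1 : 1 / ((1 - x) + s) - 1 / ((1 + x) + s) =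
        2 * x / (((1 - x) + s) * ((1 + x) + s)) := by
      rw [div_sub_div _ _ q1.ne' q2.ne']; congr 1; ring
    rw [e1, abs_div, abs_of_pos (mul_pos q1 q2)]
    have h2 : |2 * x| ≤ 2 := by rw [abs_le]; constructor <;> linarith
    calc |2 * x| / (((1 - x) + s) * ((1 + x) + s))
        ≤ 2 / ((m * (1 + s)) * (m * (1 + s))) :=
          div_le_div₀ (by norm_num) h2 (by positivity) (mul_le_mul p1 p2 (by positivity) q1.le)
      _ = _ := by field_simp
  refine (mul_le_mul_of_nonneg_left h1 hh.le).trans ?_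
  have h3 : h * ∑ k ∈ Finset.range M, 2 / m ^ 2 * (1 / (1 + h * ((k : ℝ) + 1)) ^ 2) =
      2 / m ^ 2 * ∑ k ∈ Finset.range M, h * (1 / (1 + h * ((k : ℝ) + 1)) ^ 2) := by
    rw [← Finset.mul_sum, ← Finset.mul_sum]; ring
  rw [h3]
  refine mul_le_of_le_one_right (by positivity) ((sum_inv_sq_le hh M).trans ?_)
  have : 0 ≤ 1 / (1 + h * (M : ℝ)) := by positivity
  linarith

lemma sum_inv_sq_perturbed_le {r : ℕ → ℝ} (hh : 0 < h) (hθ : θ ≤ 1 / 2)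
    (he : e ≤ 1 / 2) (hm : 0 < m) (hm1 : m ≤ 1) (hd : m ≤ d)
    (hr0 : ∀ k < M, 0 ≤ r k)
    (hr : ∀ k < M, |r k - h * ((k : ℝ) + 1)| ≤ θ * (h * ((k : ℝ) + 1)) + e) :
    h * ∑ k ∈ Finset.range M, 1 / (d + r k) ^ 2 ≤ 4 / m ^ 2 := by
  have h1 : ∑ k ∈ Finset.range M, 1 / (d + r k) ^ 2 ≤
      ∑ k ∈ Finset.range M, 4 / m ^ 2 * (1 / (1 + h * ((k : ℝ) + 1)) ^ 2) := by
    refine Finset.sum_le_sum fun k hk => ?_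
    rw [Finset.mem_range] at hk
    have p := perturbed_ge (by positivity) hθ he hm hm1 hd (hr0 k hk) (hr k hk)
    calc 1 / (d + r k) ^ 2 ≤ 1 / (m / 2 * (1 + h * ((k : ℝ) + 1))) ^ 2 := by gcongr
      _ = _ := by field_simp; norm_num
  refine (mul_le_mul_of_nonneg_left h1 hh.le).trans ?_
  have h3 : h * ∑ k ∈ Finset.range M, 4 / m ^ 2 * (1 / (1 + h * ((k : ℝ) + 1)) ^ 2) =
      4 / m ^ 2 * ∑ k ∈ Finset.range M, h * (1 / (1 + h * ((k : ℝ) + 1)) ^ 2) := by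
    rw [← Finset.mul_sum, ← Finset.mul_sum]; ring
  rw [h3]
  refine mul_le_of_le_one_right (by positivity) ((sum_inv_sq_le hh M).trans ?_)
  have : 0 ≤ 1 / (1 + h * (M : ℝ)) := by positivity
  linarith

end

section

variable {p : Params} {N L M : ℕ} {y : ℤ → ℝ}

lemma Params.Rigid.one_le_abs (h : p.Rigid N L y M) {k : ℤ} (hk : k ∈ p.cutoff N L) :
    1 ≤ |rescaled y k| := by
  obtain ⟨j, hj, rfl | rfl⟩ := (h.mem_cutoff k).1 hk
  · exact (h.right_ge j hj).trans (le_abs_self _)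
  · exact le_trans (by linarith [h.left_le j hj]) (neg_le_abs _)

lemma sub_rescaled_ne_zero (hy : ∀ k ∈ p.cutoff N L, 1 ≤ |rescaled y k|) {x : ℝ}
    (hx : x ∈ Set.Ioo (-1 : ℝ) 1) {k : ℤ} (hk : k ∈ p.cutoff N L) : x - rescaled y k ≠ 0 := by
  intro h
  have h1 := hy k hk
  rw [← sub_eq_zero.1 h] at h1
  exact absurd (abs_lt.2 hx) (not_lt.2 h1)

/-- `Real.log` is even, so the absolute values can be dropped and both sides differentiated alike.
-/
lemma potential_eq (p : Params) (N L : ℕ) (y : ℤ → ℝ) : p.potential N L y =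
    fun x => -(2 / p.nr N) * ∑ k ∈ p.cutoff N L, Real.log (x - rescaled y k) := by
  funext x
  simp [Params.potential, Real.log_abs]

lemma contDiffOn_potential (hy : ∀ k ∈ p.cutoff N L, 1 ≤ |rescaled y k|) :
    ContDiffOn ℝ 2 (p.potential N L y) (Set.Ioo (-1) 1) := by
  rw [potential_eq]
  refine contDiffOn_const.mul (ContDiffOn.sum fun k hk => ?_)
  exact (contDiffOn_id.sub contDiffOn_const).log fun x hx => sub_rescaled_ne_zero hy hx hk

lemma hasDerivAt_potential (hy : ∀ k ∈ p.cutoff N L, 1 ≤ |rescaled y k|) {x : ℝ}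
    (hx : x ∈ Set.Ioo (-1 : ℝ) 1) : HasDerivAt (p.potential N L y)
      (-(2 / p.nr N) * ∑ k ∈ p.cutoff N L, 1 / (x - rescaled y k)) x := by
  rw [potential_eq]
  refine HasDerivAt.const_mul _ (HasDerivAt.fun_sum fun k hk => ?_)
  exact ((hasDerivAt_id x).sub_const _).log (sub_rescaled_ne_zero hy hx hk)

lemma iteratedDeriv_two_potential (hy : ∀ k ∈ p.cutoff N L, 1 ≤ |rescaled y k|) {x : ℝ}
    (hx : x ∈ Set.Ioo (-1 : ℝ) 1) : iteratedDeriv 2 (p.potential N L y) x =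
      2 / p.nr N * ∑ k ∈ p.cutoff N L, 1 / (x - rescaled y k) ^ 2 := by
  have h1 : iteratedDeriv 2 (p.potential N L y) = deriv (deriv (p.potential N L y)) := by
    rw [iteratedDeriv_succ, iteratedDeriv_one]
  have h2 : deriv (p.potential N L y) =ᶠ[𝓝 x] fun x =>
      -(2 / p.nr N) * ∑ k ∈ p.cutoff N L, (x - rescaled y k)⁻¹ := by
    filter_upwards [isOpen_Ioo.mem_nhds hx] with z hz
    simpa using (hasDerivAt_potential hy hz).deriv
  rw [h1, h2.deriv_eq]
  have h3 : HasDerivAt (fun x => -(2 / p.nr N) * ∑ k ∈ p.cutoff N L, (x - rescaled y k)⁻¹)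
      (-(2 / p.nr N) * ∑ k ∈ p.cutoff N L, -1 / (x - rescaled y k) ^ 2) x := by
    refine HasDerivAt.const_mul _ (HasDerivAt.fun_sum fun k hk => ?_)
    exact ((hasDerivAt_id x).sub_const _).inv (sub_rescaled_ne_zero hy hx hk)
  rw [h3.deriv]
  simp only [neg_div, Finset.sum_neg_distrib]
  ring

/-- Bounds on the first two derivatives of the potential away from the edges of the window. -/
lemma Params.Rigid.derivative_bounds (h : p.Rigid N L y M)
    (hB : 0 ≤ p.B) (hθ : p.nr N ^ (-(1 / 10) : ℝ) ≤ 1 / 2) (he : p.nr N ^ (-(1 / 3) : ℝ) ≤ 1 / 2)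
    {m x : ℝ} (hm : 0 < m) (hx : x ∈ Set.Icc (-1 + m) (1 - m)) :
    |deriv (p.potential N L y) x| ≤ 2 / m ^ 2 + 2 * (2 / m ^ 2 * (11 + 10 * p.B)) ∧
      |iteratedDeriv 2 (p.potential N L y) x| ≤ 8 / m ^ 2 := by
  have hn1 := one_le_nr p N
  set n := p.nr N with hn
  have hn0 : 0 < n := by linarith
  have hm1 : m ≤ 1 := by linarith [hx.1, hx.2]
  have hxI : x ∈ Set.Ioo (-1 : ℝ) 1 := ⟨by linarith [hx.1], by linarith [hx.2]⟩
  have hh : 0 < 2 / n := by positivity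
  set θ := n ^ (-(1 / 10) : ℝ) with hθdef
  set e := n ^ (-(1 / 3) : ℝ) with hedef
  have hθ0 : 0 ≤ θ := by positivity
  have he0 : 0 ≤ e := by positivity
  set r : ℕ → ℝ := fun k => rescaled y ((k : ℤ) + 1) - 1 with hr
  set l : ℕ → ℝ := fun k => -1 - rescaled y (-((k : ℤ) + 1)) with hl
  have hr0 : ∀ k < M, 0 ≤ r k := fun k hk => by linarith [h.right_ge k hk]
  have hl0 : ∀ k < M, 0 ≤ l k := fun k hk => by linarith [h.left_le k hk]
  have hd1 : m ≤ 1 - x := by linarith [hx.2]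
  have hd2 : m ≤ 1 + x := by linarith [hx.1]
  -- The one-sided sums diverge like `B log n ≤ 10 B n^(1/10)`, which the relative error `n^(-1/10)`
  -- exactly compensates.
  have hlog : θ * Real.log (1 + 2 / n * M) ≤ 10 + 10 * p.B := by
    have h1 : 1 + 2 / n * M ≤ 3 * n ^ p.B := by
      have a1 : (1 : ℝ) ≤ n ^ p.B := Real.one_le_rpow hn1 hB
      have a2 : 2 / n * M ≤ 2 * n ^ p.B :=
        mul_le_mul (by rw [div_le_iff₀ hn0]; linarith) h.lt_rpow.le (by positivity) (by norm_num)
      linarith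
    have h2 : Real.log (1 + 2 / n * M) ≤ Real.log 3 + p.B * Real.log n := by
      rw [← Real.log_rpow hn0, ← Real.log_mul (by norm_num) (by positivity)]
      exact Real.log_le_log (by positivity) h1
    have h3 : Real.log n ≤ 10 * n ^ (1 / 10 : ℝ) := by
      have := Real.log_le_rpow_div hn0.le (by norm_num : (0 : ℝ) < 1 / 10)
      linarith
    have h4 : Real.log 3 ≤ 2 := by linarith [Real.log_le_sub_one_of_pos (by norm_num : (0:ℝ) < 3)]
    have h5 : θ * n ^ (1 / 10 : ℝ) = 1 := by
      rw [hθdef, ← Real.rpow_add hn0]; norm_num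
    calc θ * Real.log (1 + 2 / n * M) ≤ θ * (2 + p.B * (10 * n ^ (1 / 10 : ℝ))) := by
          refine mul_le_mul_of_nonneg_left ?_ hθ0
          linarith [mul_le_mul_of_nonneg_left h3 hB]
      _ = 2 * θ + 10 * p.B * (θ * n ^ (1 / 10 : ℝ)) := by ring
      _ ≤ 10 + 10 * p.B := by rw [h5]; linarith
  have hy : ∀ k ∈ p.cutoff N L, 1 ≤ |rescaled y k| := fun k hk => h.one_le_abs hk
  constructor
  · have b1 := abs_sum_perturbed_sub_le hh hθ0 hθ he0 he hm hm1 hd1 hr0 h.right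
    have b2 := abs_sum_perturbed_sub_le hh hθ0 hθ he0 he hm hm1 hd2 hl0 h.left
    have b3 := abs_sum_lattice_sub_le (M := M) hh hm hm1 hd1 hd2
    have hC : 2 / m ^ 2 * (θ * Real.log (1 + 2 / n * M) + e) ≤ 2 / m ^ 2 * (11 + 10 * p.B) :=
      mul_le_mul_of_nonneg_left (by linarith) (by positivity)
    -- `U'` is the sum over the right charges minus the sum over the left ones; `b1` and `b2`
    -- replace each by its lattice, and `b3` lets the lattices cancel.
    have hU : deriv (p.potential N L y) x = 2 / n * ∑ k ∈ Finset.range M, 1 / ((1 - x) + r k) -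
        2 / n * ∑ k ∈ Finset.range M, 1 / ((1 + x) + l k) := by
      rw [(hasDerivAt_potential hy hxI).deriv, h.sum_cutoff]
      have e1 : ∀ k : ℕ, 1 / (x - rescaled y ((k : ℤ) + 1)) = -(1 / ((1 - x) + r k)) := by
        intro k
        rw [← one_div_neg_eq_neg_one_div]; congr 1; simp only [hr]; ring
      have e2 : ∀ k : ℕ, 1 / (x - rescaled y (-((k : ℤ) + 1))) = 1 / ((1 + x) + l k) := by
        intro k
        congr 1; simp only [hl]; ring
      simp only [e1, e2, Finset.sum_neg_distrib]
      ring
    rw [hU]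
    rw [abs_le] at b1 b2 b3 ⊢
    constructor <;> linarith [b1.1, b1.2, b2.1, b2.2, b3.1, b3.2]
  · have b1 := sum_inv_sq_perturbed_le hh hθ he hm hm1 hd1 hr0 h.right
    have b2 := sum_inv_sq_perturbed_le hh hθ he hm hm1 hd2 hl0 h.left
    rw [iteratedDeriv_two_potential hy hxI, abs_of_nonneg (mul_nonneg hh.le
      (Finset.sum_nonneg fun k _ => by positivity)), h.sum_cutoff]
    have e1 : ∀ k : ℕ, 1 / (x - rescaled y ((k : ℤ) + 1)) ^ 2 = 1 / ((1 - x) + r k) ^ 2 := by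
      intro k
      congr 1; simp only [hr]; ring
    have e2 : ∀ k : ℕ, 1 / (x - rescaled y (-((k : ℤ) + 1))) ^ 2 = 1 / ((1 + x) + l k) ^ 2 := by
      intro k
      congr 1; simp only [hl]; ring
    simp only [e1, e2]
    rw [mul_add]
    have : 8 / m ^ 2 = 4 / m ^ 2 + 4 / m ^ 2 := by ring
    linarith

end


/-! ### Endpoints of the equilibrium measure -/

/-- For large `n` the balance condition for nearly periodic external points forces the larger of the
two gaps between the support and the window to be small. -/
lemma eventually_gap_le {B γ : ℝ} (hB : 2 ≤ B) (hγ : 0 < γ) (hγ1 : γ ≤ 1 / 10) :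
    ∀ᶠ n : ℝ in atTop, ∀ (M : ℕ) (α β : ℝ) (r l : ℕ → ℝ), (M : ℝ) < n ^ B → n ^ B ≤ M + 1 →
      0 < α → 0 < β → β ≤ α → α + β < 2 → (∀ k < M, 0 ≤ r k) → (∀ k < M, 0 ≤ l k) →
      (∀ k < M, |r k - 2 / n * ((k : ℝ) + 1)| ≤
        n ^ (-(1 / 10) : ℝ) * (2 / n * ((k : ℝ) + 1)) + n ^ (-(1 / 3) : ℝ)) →
      (∀ k < M, |l k - 2 / n * ((k : ℝ) + 1)| ≤
        n ^ (-(1 / 10) : ℝ) * (2 / n * ((k : ℝ) + 1)) + n ^ (-(1 / 3) : ℝ)) →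
      ∑ k ∈ Finset.range M, (Real.sqrt ((r k + β) / (r k + (2 - α))) - 1) +
        ∑ k ∈ Finset.range M, (Real.sqrt ((l k + (2 - β)) / (l k + α)) - 1) = n →
      α ≤ n ^ (-γ / 3) := by
  -- `29 + 60 B = 2 + (18 + 60 B) + 4 + 4 + 1` collects the five error terms of `sqrt_defect_le` in
  -- units of `n^(-1/20)`.
  filter_upwards [eventually_mul_rpow_le (29 + 60 * B)
      (by norm_num : (-(1 / 20) : ℝ) < -(1 / 60)), eventually_ge_atTop 2,
    eventually_mul_rpow_neg_lt 1 (by norm_num : (-(1 / 10) : ℝ) < 0)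
      (by norm_num : (0 : ℝ) < 1 / 2)]
    with n hbig hn2 hθ M α β r l hM1 hM2 hα hβ hβα hαβ hr0 hl0 hr hl hcond
  by_contra! hlt
  have hn0 : 0 < n := by linarith
  have hn1 : 1 ≤ n := by linarith
  have hnB : n ≤ n ^ B / n := by
    rw [le_div_iff₀ hn0, ← sq, ← Real.rpow_two]
    exact Real.rpow_le_rpow_of_exponent_le hn1 hB
  have hnB' : n * n ≤ n ^ B := by rwa [le_div_iff₀ hn0] at hnB
  have hnB1 : 2 ≤ n ^ B := by nlinarith
  have hM : 1 ≤ M := by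
    have : (1 : ℝ) ≤ M := by linarith
    exact_mod_cast this
  set θ := n ^ (-(1 / 10) : ℝ) with hθd
  set e := n ^ (-(1 / 3) : ℝ) with hed
  set q := n ^ (-(1 / 20) : ℝ) with hq
  have hq0 : 0 < q := Real.rpow_pos_of_pos hn0 _
  have hθ0 : 0 ≤ θ := by positivity
  have he0 : 0 ≤ e := by positivity
  have main := sqrt_defect_le hn0 hθ0 (by linarith) he0 hM hα hβ hβα hαβ hr0 hl0
    (fun k hk => by
      have := (abs_le.1 (hr k hk)).2
      push_cast
      linarith)
    (fun k hk => by
      have := (abs_le.1 (hl k hk)).1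
      push_cast
      linarith) hcond
  -- `γ ≤ 1/10` turns `α > n^(-γ/3)` into `√α > n^(-1/60)`, which eventually beats the errors.
  have hsα : n ^ (-(1 / 60) : ℝ) < Real.sqrt α := by
    refine Real.lt_sqrt_of_sq_lt (lt_of_le_of_lt ?_ hlt)
    rw [← Real.rpow_two, ← Real.rpow_mul hn0.le]
    exact Real.rpow_le_rpow_of_exponent_le hn1 (by linarith)
  have hinv : 1 / n ≤ q := by
    rw [one_div, ← Real.rpow_neg_one]
    exact Real.rpow_le_rpow_of_exponent_le hn1 (by norm_num)
  have heq : e ≤ q := Real.rpow_le_rpow_of_exponent_le hn1 (by norm_num)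
  have hθq : θ ≤ q := Real.rpow_le_rpow_of_exponent_le hn1 (by norm_num)
  have t1 : 2 / (2 / n * M) ≤ 2 * q := by
    have h1 : n ≤ 2 / n * M := by
      rw [div_mul_eq_mul_div, le_div_iff₀ hn0]; linarith
    calc 2 / (2 / n * M) ≤ 2 / n := by gcongr
      _ = 2 * (1 / n) := by ring
      _ ≤ 2 * q := by linarith
  have t2 : 3 * θ * (3 + Real.log (4 * (2 / n * M + 2))) ≤ (18 + 60 * B) * q := by
    have h1 : 4 * (2 / n * M + 2) ≤ 16 * n ^ B := by
      have : 2 / n * M ≤ 2 * n ^ B :=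
        mul_le_mul (by rw [div_le_iff₀ hn0]; linarith) hM1.le (by positivity) (by norm_num)
      linarith
    have h2 : Real.log (4 * (2 / n * M + 2)) ≤ Real.log 16 + B * Real.log n := by
      rw [← Real.log_rpow hn0, ← Real.log_mul (by norm_num) (by positivity)]
      exact Real.log_le_log (by positivity) h1
    have h3 : Real.log n ≤ 20 * n ^ (1 / 20 : ℝ) := by
      have := Real.log_le_rpow_div hn0.le (by norm_num : (0 : ℝ) < 1 / 20)
      linarith
    have h4 : Real.log 16 ≤ 3 := by
      rw [show (16 : ℝ) = 2 ^ 4 by norm_num, Real.log_pow]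
      have := Real.log_two_lt_d9
      push_cast
      linarith
    have h5 : θ * n ^ (1 / 20 : ℝ) = q := by
      rw [hθd, ← Real.rpow_add hn0]; norm_num [hq]
    calc 3 * θ * (3 + Real.log (4 * (2 / n * M + 2)))
        ≤ 3 * θ * (3 + (3 + B * (20 * n ^ (1 / 20 : ℝ)))) := by
          refine mul_le_mul_of_nonneg_left ?_ (by positivity)
          linarith [mul_le_mul_of_nonneg_left h3 (by linarith : 0 ≤ B)]
      _ = 18 * θ + 60 * B * (θ * n ^ (1 / 20 : ℝ)) := by ring
      _ ≤ (18 + 60 * B) * q := by rw [h5]; linarith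
  have t3 : 4 * e / Real.sqrt α ≤ 4 * q := by
    -- `-1/3 ≤ -1/20 - 1/60`, so `e/√α` is still at most `q`.
    have h1 : e ≤ q * n ^ (-(1 / 60) : ℝ) := by
      rw [hq, ← Real.rpow_add hn0]
      exact Real.rpow_le_rpow_of_exponent_le hn1 (by norm_num)
    rw [div_le_iff₀ (lt_of_le_of_lt (by positivity) hsα)]
    linarith [mul_le_mul_of_nonneg_left hsα.le hq0.le]
  have t4 : 2 * (2 / n) ≤ 4 * q := by
    calc 2 * (2 / n) = 4 * (1 / n) := by ring
      _ ≤ 4 * q := by linarith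
  linarith

variable {p : Params} {N L M : ℕ} {y : ℤ → ℝ}

lemma potentialE_eq (p : Params) (N L : ℕ) (y : ℤ → ℝ) :
    p.potentialE N L y = chargePotential (p.cutoff N L) (rescaled y) (1 / p.nr N) := by
  funext x
  simp only [Params.potentialE, chargePotential, Params.potential, mul_one_div]

/-- The equilibrium measures of a rigid configuration, with the balance conditions for their
support split into the contributions of the two sides. -/
lemma Params.Rigid.equilibrium (h : p.Rigid N L y M) :
    ∃ a b : ℝ, -1 < a ∧ a < b ∧ b < 1 ∧
      (∑ k ∈ Finset.range M, (Real.sqrt ((rescaled y ((k : ℤ) + 1) - 1 + (1 - b)) /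
          (rescaled y ((k : ℤ) + 1) - 1 + (2 - (1 + a)))) - 1) +
        ∑ k ∈ Finset.range M, (Real.sqrt ((-1 - rescaled y (-((k : ℤ) + 1)) + (2 - (1 - b))) /
          (-1 - rescaled y (-((k : ℤ) + 1)) + (1 + a))) - 1) = p.nr N) ∧
      (∑ k ∈ Finset.range M, (Real.sqrt ((-1 - rescaled y (-((k : ℤ) + 1)) + (1 + a)) /
          (-1 - rescaled y (-((k : ℤ) + 1)) + (2 - (1 - b)))) - 1) +
        ∑ k ∈ Finset.range M, (Real.sqrt ((rescaled y ((k : ℤ) + 1) - 1 + (2 - (1 + a))) /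
          (rescaled y ((k : ℤ) + 1) - 1 + (1 - b))) - 1) = p.nr N) ∧
      (∃ ν, IsEquilibriumMeasure (p.potentialE N L y) ν) ∧
      ∀ ν, IsEquilibriumMeasure (p.potentialE N L y) ν → ν.support = Set.Icc a b := by
  have hn0 : 0 < p.nr N := by linarith [one_le_nr p N]
  have h1 : (1 : ℤ) ∈ p.cutoff N L := (h.mem_cutoff 1).2 ⟨0, h.one_le, by simp⟩
  have h2 : (-1 : ℤ) ∈ p.cutoff N L := (h.mem_cutoff (-1)).2 ⟨0, h.one_le, by simp⟩
  have e1 : rescaled y 1 = 1 := by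
    have := rescaled_sub_one h.lt 1
    rw [sub_self, mul_zero, zero_div] at this
    linarith
  have e2 : rescaled y (-1) = -1 := by
    have := neg_one_sub_rescaled h.lt (-1)
    rw [sub_self, mul_zero, zero_div] at this
    linarith
  obtain ⟨a, b, ha, hab, hb, hA, hB, hex, hsupp⟩ := exists_unique_equilibrium
    (one_div_pos.2 hn0) (fun k hk => h.one_le_abs hk) h2 e2 h1 e1
  rw [← potentialE_eq] at hex hsupp
  rw [one_div, inv_mul_eq_one₀ hn0.ne', h.sum_cutoff] at hA hB
  refine ⟨a, b, ha, hab, hb, hA.symm ▸ ?_, hB.symm ▸ ?_, hex, hsupp⟩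
  · congr 1
    · refine Finset.sum_congr rfl fun k _ => ?_
      congr 3 <;> ring
    · refine Finset.sum_congr rfl fun k _ => ?_
      congr 2
      rw [← neg_div_neg_eq]
      congr 1 <;> ring
  · rw [add_comm]
    congr 1
    · refine Finset.sum_congr rfl fun k _ => ?_
      congr 3 <;> ring
    · refine Finset.sum_congr rfl fun k _ => ?_
      congr 2
      rw [← neg_div_neg_eq]
      congr 1 <;> ring

/-- The larger gap is already at most `n^(-γ/3)` by `eventually_gap_le`; the logarithm is at least
`1` once `n ≥ e`, so the constant is `1`. -/
theorem eventually_endpoints (hp : p.Admissible) : ∀ᶠ N : ℕ in atTop, ∀ (L M : ℕ) (y : ℤ → ℝ),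
    p.Rigid N L y M →
      (∃ ν, IsEquilibriumMeasure (p.potentialE N L y) ν) ∧
      ∀ ν, IsEquilibriumMeasure (p.potentialE N L y) ν →
        ∃ a b : ℝ, a < b ∧ ν.support = Set.Icc a b ∧
          |a + 1| ≤ 1 * p.nr N ^ (-p.γ / 3) * Real.log (p.nr N) ∧
          |b - 1| ≤ 1 * p.nr N ^ (-p.γ / 3) * Real.log (p.nr N) := by
  filter_upwards [(tendsto_nr hp).eventually (eventually_gap_le (by linarith [hp.B_ge])
    hp.γ_pos hp.γ_le), (tendsto_nr hp).eventually (eventually_ge_atTop (Real.exp 1))]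
    with N hgap hn L M y h
  obtain ⟨a, b, ha, hab, hb, hA, hB, hex, hsupp⟩ := h.equilibrium
  refine ⟨hex, fun ν hν => ⟨a, b, hab, hsupp ν hν, ?_⟩⟩
  have hlog : 1 ≤ Real.log (p.nr N) := by
    rw [Real.le_log_iff_exp_le (lt_of_lt_of_le (Real.exp_pos 1) hn)]
    exact hn
  have hr0 : ∀ k < M, 0 ≤ rescaled y ((k : ℤ) + 1) - 1 := fun k hk => by
    linarith [h.right_ge k hk]
  have hl0 : ∀ k < M, 0 ≤ -1 - rescaled y (-((k : ℤ) + 1)) := fun k hk => by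
    linarith [h.left_le k hk]
  have key : 1 + a ≤ p.nr N ^ (-p.γ / 3) ∧ 1 - b ≤ p.nr N ^ (-p.γ / 3) := by
    -- The larger gap plays the role of `α`. If it is the right one, reflection exchanges the two
    -- sides and the condition at `b` replaces the one at `a`.
    rcases le_total (1 - b) (1 + a) with hle | hle
    · have := hgap M (1 + a) (1 - b) _ _ h.lt_rpow h.rpow_le (by linarith) (by linarith) hle
        (by linarith) hr0 hl0 h.right h.left hA
      exact ⟨this, hle.trans this⟩
    · have := hgap M (1 - b) (1 + a) _ _ h.lt_rpow h.rpow_le (by linarith) (by linarith) hle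
        (by linarith) hl0 hr0 h.left h.right hB
      exact ⟨hle.trans this, this⟩
  have hpos : 0 ≤ p.nr N ^ (-p.γ / 3) := by positivity
  have h1 : p.nr N ^ (-p.γ / 3) ≤ 1 * p.nr N ^ (-p.γ / 3) * Real.log (p.nr N) := by
    rw [one_mul]; exact le_mul_of_one_le_right hpos hlog
  constructor
  · rw [abs_of_pos (by linarith)]; linarith
  · rw [abs_of_neg (by linarith)]; linarith

end WignerLocal

end

/-! ### The two assertions combined -/

theorem lemmaI1 (p : WignerLocal.Params) (hp : p.Admissible) :
    ∃ N₀ : ℕ,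
      (∀ σ : ℝ, 0 < σ → ∃ C₁ C₂ : ℝ, ∀ N : ℕ, N₀ ≤ N → ∀ τ : ℝ, 2 ≤ τ →
        ∀ ν₀ νd₀ : Measure ℝ,
        WignerLocal.IsEntryLaw ν₀ (1 / 2) → WignerLocal.IsEntryLaw νd₀ 1 →
        ∀ L ∈ p.goodIndices N τ (WignerLocal.eigenvalueDensity N (τ / N) ν₀ νd₀),
        ∀ y ∈ p.goodExternal N τ (WignerLocal.eigenvalueDensity N (τ / N) ν₀ νd₀) L,
          ContDiffOn ℝ 2 (p.potential N L y) (Set.Ioo (-1) 1) ∧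
          ∀ x ∈ Set.Icc (-1 + σ / 2) (1 - σ / 2),
            |deriv (p.potential N L y) x| ≤ C₁ ∧
            |iteratedDeriv 2 (p.potential N L y) x| ≤ C₂) ∧
      (∃ C : ℝ, ∀ N : ℕ, N₀ ≤ N → ∀ τ : ℝ, 2 ≤ τ →
        ∀ ν₀ νd₀ : Measure ℝ,
        WignerLocal.IsEntryLaw ν₀ (1 / 2) → WignerLocal.IsEntryLaw νd₀ 1 →
        ∀ L ∈ p.goodIndices N τ (WignerLocal.eigenvalueDensity N (τ / N) ν₀ νd₀),
        ∀ y ∈ p.goodExternal N τ (WignerLocal.eigenvalueDensity N (τ / N) ν₀ νd₀) L,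
          (∃ ν, WignerLocal.IsEquilibriumMeasure (p.potentialE N L y) ν) ∧
          ∀ ν, WignerLocal.IsEquilibriumMeasure (p.potentialE N L y) ν →
            ∃ a b : ℝ, a < b ∧ ν.support = Set.Icc a b ∧
              |a + 1| ≤ C * p.nr N ^ (-p.γ / 3) * Real.log (p.nr N) ∧
              |b - 1| ≤ C * p.nr N ^ (-p.γ / 3) * Real.log (p.nr N)) := by
  open WignerLocal in
  -- `N₀` is determined by rigidity, the endpoint bound and the smallness of `n^(-1/10)` and
  -- `n^(-1/3)`. None of these involves `σ`, which enters only through the distance `m = σ/2` of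
  -- `J'` from `±1`.
  obtain ⟨N₀, hN₀⟩ := eventually_atTop.1 (((eventually_rigid hp).and (eventually_endpoints hp)).and
    (((tendsto_nr hp).eventually (eventually_mul_rpow_neg_lt 1
      (by norm_num : (-(1 / 10) : ℝ) < 0) (by norm_num : (0 : ℝ) < 1 / 2))).and
    ((tendsto_nr hp).eventually (eventually_mul_rpow_neg_lt 1
      (by norm_num : (-(1 / 3) : ℝ) < 0) (by norm_num : (0 : ℝ) < 1 / 2)))))
  refine ⟨N₀, fun σ hσ => ⟨2 / (σ / 2) ^ 2 + 2 * (2 / (σ / 2) ^ 2 * (11 + 10 * p.B)),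
    8 / (σ / 2) ^ 2, fun N hN τ _ ν₀ νd₀ _ _ L hL y hy => ?_⟩,
    1, fun N hN τ _ ν₀ νd₀ _ _ L hL y hy => ?_⟩
  · obtain ⟨⟨hrig, -⟩, hθ, he⟩ := hN₀ N hN
    have h := hrig τ _ L hL y hy
    exact ⟨WignerLocal.contDiffOn_potential fun k hk => h.one_le_abs hk, fun x hx =>
      h.derivative_bounds (by linarith [hp.B_ge]) (by linarith) (by linarith) (half_pos hσ) hx⟩
  · obtain ⟨⟨hrig, hend⟩, -⟩ := hN₀ N hN
    exact hend L _ y (hrig τ _ L hL y hy)
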